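/- Let $\Lambda\subset\mathbb{C}^2$ be a lattice, i.e. a discrete additive subgroup (of any rank), let $q_1,\dots,q_m\in\mathbb{C}^2$, and let $\Lambda_0=\bigcup_{j=1}^m(\Lambda+q_j)$. Then $\Lambda_0$ is tame: it is a closed discrete subset of $\mathbb{C}^2$ and there is a holomorphic automorphism $F$ of $\mathbb{C}^2$ such that $F(\Lambda_0)$ is contained in a (not necessarily linear) complex line. Moreover there is an injective holomorphic map $\mathbb{C}^2\to\mathbb{C}^2\setminus\Lambda_0$ whose Jacobian determinant is not identically zero. Call a connected Hausdorff two-dimensional complex manifold (a surface), or an open subset of one, dominable by $\mathbb{C}^2$ if it admits a holomorphic map from $\mathbb{C}^2$ whose Jacobian determinant is not identically zero. Suppose now that $\Lambda$ has real rank $4$ (it spans $\mathbb{C}^2$ over $\mathbb{R}$), and let $X=\mathbb{C}^2/\Lambda$ be the corresponding compact complex torus. Then: (a) for every finite set $T\subset X$, the complement $X\setminus T$ is dominable by $\mathbb{C}^2$; (b) every surface $Y$ bimeromorphic to $X$ is dominable by $\mathbb{C}^2$. Here $Y$ is bimeromorphic to $X$ if there is an analytic subset $\Gamma\subset Y\times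 X$ such that each of the two projections of $\Gamma$ to $Y$ and to $X$ is a proper modification: it is proper and surjective, and it is biholomorphic over the complement of some nowhere dense analytic subset of the target whose preimage in $\Gamma$ is nowhere dense. (Such a $Y$ is automatically compact.) -/

import Mathlib

open Set Topology
open scoped Manifold ContDiff

/-- The complex plane `ℂ²`; `𝓘(ℂ, C2)` is the model of two-dimensional complex manifolds
without boundary. -/
abbrev C2 : Type := ℂ × ℂ

/-! ### Complex tori -/

/-- The quotient of `ℂ²` by a discrete subgroup `Λ`, with the quotient topology and with the local
inverses of the projection `ℂ² → ℂ² ⧸ Λ` as charts. -/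
noncomputable instance torusChartedSpace (Λ : AddSubgroup C2) [hΛ : DiscreteTopology Λ] :
    ChartedSpace C2 (C2 ⧸ Λ) :=
  (Λ.isAddQuotientCoveringMap_of_comm
    ⟨hΛ⟩).isCoveringMap.isLocalHomeomorph.chartedSpace Quotient.mk_surjective

theorem torusChart_rightInverse (Λ : AddSubgroup C2) [DiscreteTopology Λ]
    (e : OpenPartialHomeomorph (C2 ⧸ Λ) C2) (he : e ∈ atlas C2 (C2 ⧸ Λ)) (x : C2) :
    e.symm x = (QuotientAddGroup.mk x : C2 ⧸ Λ) := by
  obtain ⟨q, rfl⟩ := he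
  simp [chartAt_self_eq]

instance torusIsManifold (Λ : AddSubgroup C2) [DiscreteTopology Λ] :
    IsManifold 𝓘(ℂ, C2) ω (C2 ⧸ Λ) := by
  apply isManifold_of_contDiffOn
  intro e e' he he'
  simp only [modelWithCornersSelf_coe, modelWithCornersSelf_coe_symm, Function.comp_id,
    Function.id_comp, preimage_id, range_id, inter_univ]
  set T := e.symm ≫ₕ e' with hT
  have hmem : ∀ y ∈ T.source, T y - y ∈ (Λ : Set C2) := by
    intro y hy
    have h1 : e'.symm (T y) = e.symm y := by
      rw [hT, OpenPartialHomeomorph.trans_source] at hy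
      simpa [hT] using e'.left_inv hy.2
    rw [torusChart_rightInverse Λ e he, torusChart_rightInverse Λ e' he'] at h1
    have h2 := QuotientAddGroup.eq.1 h1.symm
    rwa [neg_add_eq_sub] at h2
  intro x hx
  have hsrc : T.source ∈ 𝓝 x := T.open_source.mem_nhds hx
  have hcont : ContinuousAt (fun y => T y - y) x :=
    (T.continuousAt hx).sub continuousAt_id
  obtain ⟨V, hV, hVΛ⟩ : ∃ V ∈ 𝓝 (T x - x), V ∩ (Λ : Set C2) = {T x - x} :=
    nhds_inter_eq_singleton_of_mem_discrete (s := (Λ : Set C2)) ⟨‹_›⟩ (hmem x hx)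
  have hev : T =ᶠ[𝓝 x] fun y => y + (T x - x) := by
    filter_upwards [hsrc, hcont.preimage_mem_nhds hV] with y hy hyV
    have : T y - y ∈ ({T x - x} : Set C2) := hVΛ ▸ ⟨hyV, hmem y hy⟩
    rw [← mem_singleton_iff.1 this]
    abel
  exact ((contDiffAt_id.add contDiffAt_const).congr_of_eventuallyEq hev).contDiffWithinAt

/-! ### Holomorphic maps and dominability -/

/-- A dominating map from `ℂ²` to a two-dimensional complex manifold `M`: a holomorphic map whose
Jacobian determinant is not identically zero, that is, whose differential is invertible at some
point. -/
def IsDominatingMap {M : Type*} [TopologicalSpace M] [ChartedSpace C2 M] (F : C2 → M) : Prop :=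
  MDifferentiable 𝓘(ℂ, C2) 𝓘(ℂ, C2) F ∧
    ∃ z : C2, Function.Bijective (mfderiv 𝓘(ℂ, C2) 𝓘(ℂ, C2) F z)

/-- The open subset `U` of the two-dimensional complex manifold `M` is dominable by `ℂ²`. -/
def DominableByC2 {M : Type*} [TopologicalSpace M] [ChartedSpace C2 M] (U : Set M) : Prop :=
  ∃ F : C2 → M, IsDominatingMap F ∧ ∀ z, F z ∈ U

/-! ### Tame sets -/

/-- A discrete subset of `ℂ²` (closed, all of whose points are isolated) is tame if some holomorphic
automorphism of `ℂ²` maps it into a complex line. -/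
def IsTame (A : Set C2) : Prop :=
  IsClosed A ∧ IsDiscrete A ∧
    ∃ F : C2 ≃ C2, Differentiable ℂ F ∧ Differentiable ℂ F.symm ∧
      ∃ a v : C2, v ≠ 0 ∧ ∀ x ∈ A, ∃ t : ℂ, F x = a + t • v

/-! ### Bimeromorphic surfaces -/

section Bimeromorphic

variable {E : Type*} [NormedAddCommGroup E] [NormedSpace ℂ E] {H : Type*} [TopologicalSpace H]
  {E' : Type*} [NormedAddCommGroup E'] [NormedSpace ℂ E'] {H' : Type*} [TopologicalSpace H']

/-- A (closed) analytic subset of a complex manifold: near every point of the manifold it is the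
set of common zeros of finitely many holomorphic functions. -/
def IsAnalyticSubset (I : ModelWithCorners ℂ E H) {M : Type*} [TopologicalSpace M]
    [ChartedSpace H M] (A : Set M) : Prop :=
  ∀ p : M, ∃ U : Set M, IsOpen U ∧ p ∈ U ∧ ∃ (k : ℕ) (f : Fin k → M → ℂ),
    (∀ i, MDifferentiableOn I 𝓘(ℂ, ℂ) (f i) U) ∧ A ∩ U = {x ∈ U | ∀ i, f i x = 0}

/-- For an analytic subset `Γ` of the complex manifold `M` and a holomorphic map `π : M → N`, the
restriction `π : Γ → N` is a proper modification: it is proper and onto, and there is a nowhere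
dense analytic set `S ⊆ N`, with nowhere dense preimage in `Γ`, such that `π` restricts to a
biholomorphic map from `Γ ∖ π⁻¹(S)` to `N ∖ S`, with inverse `g`. -/
structure IsProperModification (I : ModelWithCorners ℂ E H) (J : ModelWithCorners ℂ E' H')
    {M : Type*} [TopologicalSpace M] [ChartedSpace H M]
    {N : Type*} [TopologicalSpace N] [ChartedSpace H' N] (Γ : Set M) (π : M → N) : Prop where
  isProperMap : IsProperMap (fun p : Γ => π p)
  surjOn : SurjOn π Γ univ
  biholomorphic : ∃ S : Set N, IsAnalyticSubset J S ∧ interior S = ∅ ∧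
    Γ ⊆ closure (Γ \ π ⁻¹' S) ∧
    ∃ g : N → M, MDifferentiableOn J I g Sᶜ ∧ MapsTo g Sᶜ Γ ∧
      (∀ x ∈ Sᶜ, π (g x) = x) ∧ ∀ p ∈ Γ, π p ∈ Sᶜ → g (π p) = p

/-- Two complex manifolds are bimeromorphic: some analytic subset of their product (the graph of a
bimeromorphic map) is a proper modification of each factor under the projection. If the manifolds
are connected, then the graph is automatically irreducible. -/
def IsBimeromorphic (I : ModelWithCorners ℂ E H) (J : ModelWithCorners ℂ E' H')
    (M : Type*) [TopologicalSpace M] [ChartedSpace H M]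
    (N : Type*) [TopologicalSpace N] [ChartedSpace H' N] : Prop :=
  ∃ Γ : Set (M × N), IsAnalyticSubset (I.prod J) Γ ∧
    IsProperModification (I.prod J) I Γ Prod.fst ∧ IsProperModification (I.prod J) J Γ Prod.snd

end Bimeromorphic

/-! ### Holomorphic functions on complex normed spaces -/

section SeveralVariables

open Metric Filter

variable {E : Type*} [NormedAddCommGroup E] [NormedSpace ℂ E]
  {F : Type*} [NormedAddCommGroup F] [NormedSpace ℂ F]

/-! Tameness. A discrete subgroup lies in a full lattice `L` spanned by a real basis. Some
complex-linear `ζ` has one coordinate of that basis as imaginary part. On finitely many translates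
of `L`, `Im ζ` takes values in finitely many cosets of `ℤ`, so for suitable `N` the function `g z =
-z ^ 2 + cosh (2πNz)` satisfies `Re g ≥ |z|²` on the values of `ζ` (`exists_near_int`,
`norm_sq_le_re_cosh`). Take `ζ` as first coordinate. Since the sum of `(1 + ‖x‖)⁻⁵` over the
translates converges, Borel–Cantelli shows that for almost every `c` in the unit disc the
automorphism `(z, w) ↦ (z, e^{g(z)} (w + c))` makes the second coordinate injective and proper on
the set (`exists_generic_shear`). An additive shear by an interpolating entire function then moves
the set into `z = 0` (`exists_automorphism_of_growth`).

Domination. A composite of shears preserves the line `z = 0` and has derivative `1/2` at the fixed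
point `(1, 0)`. Its basin of attraction is a biholomorphic copy of `ℂ²` missing the line
(`exists_injective_of_basin`, `exists_fatouBieberbach`). Pulling back by the straightening
automorphism gives an injective map missing the translates. Applied to lifts of a finite set `T` and
projected to the torus, it gives (a).

Bimeromorphic surfaces. The inverse correspondence from the torus to `Y` extends holomorphically off
a finite set; composing it with a dominating map into the complement of that set gives (b). Where a
fibre of the graph `Γ` has an isolated point, Riemann extension makes `Γ` a holomorphic graph over a
neighbourhood (`exists_nhds_graph_of_isolated`). So one must show that fibres with non-isolated
points lie over a discrete set (`eventually_isolated_fiber`). Morally this is a dimension count: a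
curve of positive-dimensional fibres would be a two-dimensional piece of the surface `Γ` inside the
nowhere dense exceptional locus. The count is carried out by elimination: `exists_elimination`
projects analytic sets along a finite direction, `exists_graph_of_accPt` extracts a smooth curve
from a non-discrete analytic set, and `eventually_zero_of_frequently_zero` shows that the eliminants
vanish to infinite order along that curve. -/

theorem continuousOn_fderiv_of_differentiableOn {f : E → F} {U : Set E}
    (hf : DifferentiableOn ℂ f U) (hU : IsOpen U) : ContinuousOn (fderiv ℂ f) U := by
  intro z₀ hz₀
  refine ContinuousAt.continuousWithinAt ?_
  have h1 : U ∩ f ⁻¹' (closedBall (f z₀) 1) ∈ 𝓝 z₀ :=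
    inter_mem (hU.mem_nhds hz₀)
      ((hf.continuousOn.continuousAt (hU.mem_nhds hz₀)).preimage_mem_nhds
        (closedBall_mem_nhds _ one_pos))
  obtain ⟨r, hr, hball⟩ := Metric.mem_nhds_iff.1 h1
  obtain ⟨R, hR, rfl⟩ : ∃ R > 0, r = 4 * R := ⟨r / 4, by positivity, by ring⟩
  -- Schwarz lemma: on the ball of radius `4 * R` the oscillation of `f` is at most 2.
  have hlip : ∀ z ∈ ball z₀ (2 * R), ∀ z' ∈ ball z (2 * R), dist (f z') (f z) ≤ dist z' z / R := by
    intro z hz z' hz'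
    have hsub : ball z (2 * R) ⊆ ball z₀ (4 * R) := by
      apply ball_subset_ball'
      rw [mem_ball] at hz; linarith
    have := Complex.dist_le_div_mul_dist_of_mapsTo_ball (f := f) (c := z) (R₁ := 2 * R) (R₂ := 2)
      (z := z') (hf.mono fun x hx => (hball (hsub hx)).1) ?_ hz'
    · refine this.trans_eq ?_
      field_simp
    · intro x hx
      have hx1 := (hball (hsub hx)).2
      have hz1 := (hball (hsub (mem_ball_self (by positivity)))).2
      simp only [mem_preimage, mem_closedBall] at hx1 hz1 ⊢
      have := dist_triangle_right (f x) (f z) (f z₀)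
      linarith
  have hdiffat : ∀ z ∈ ball z₀ (4 * R), DifferentiableAt ℂ f z := fun z hz =>
    (hf z (hball hz).1).differentiableAt (hU.mem_nhds (hball hz).1)
  -- Cauchy's estimate is applied to the increment `f (· + h) - f`, which is uniformly of size `‖h‖
  -- / R` by the Lipschitz bound.
  have key : ∀ h : E, ‖h‖ < R → ‖fderiv ℂ f (z₀ + h) - fderiv ℂ f z₀‖ ≤ 2 * ‖h‖ / R / R := by
    intro h hh
    have hmem : ∀ w ∈ ball z₀ R, w + h ∈ ball z₀ (4 * R) := by
      intro w hw
      rw [mem_ball, dist_eq_norm] at *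
      have : w + h - z₀ = (w - z₀) + h := by abel
      rw [this]
      have := norm_add_le (w - z₀) h
      linarith
    have hg : DifferentiableOn ℂ (fun w => f (w + h) - f w) (ball z₀ R) := by
      intro w hw
      have hw' : w ∈ ball z₀ (4 * R) := ball_subset_ball (by linarith) hw
      have h1 : DifferentiableAt ℂ (fun w => f (w + h)) w :=
        DifferentiableAt.comp w (hdiffat _ (hmem w hw)) (differentiableAt_id.add_const h)
      exact (h1.sub (hdiffat w hw')).differentiableWithinAt
    have hbd : ∀ w ∈ ball z₀ R, ‖f (w + h) - f w‖ ≤ ‖h‖ / R := by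
      intro w hw
      have := hlip w (ball_subset_ball (by linarith) hw) (w + h) (by
        rw [mem_ball, dist_eq_norm]; simp; linarith)
      simpa [dist_eq_norm] using this
    have hz0 : z₀ ∈ ball z₀ R := mem_ball_self hR
    have hmaps : MapsTo (fun w => f (w + h) - f w) (ball z₀ R)
        (closedBall (f (z₀ + h) - f z₀) (2 * ‖h‖ / R)) := by
      intro w hw
      rw [mem_closedBall, dist_eq_norm]
      refine (norm_sub_le _ _).trans ?_
      have h1 := hbd w hw
      have h2 := hbd z₀ hz0
      have : 2 * ‖h‖ / R = ‖h‖ / R + ‖h‖ / R := by ring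
      rw [this]; exact add_le_add h1 h2
    have := Complex.norm_fderiv_le_div_of_mapsTo_ball hg hmaps hR
    have hd : fderiv ℂ (fun w => f (w + h) - f w) z₀ = fderiv ℂ f (z₀ + h) - fderiv ℂ f z₀ := by
      rw [fderiv_fun_sub, fderiv_comp_add_right]
      · exact DifferentiableAt.comp z₀ (hdiffat _ (hmem z₀ hz0)) (differentiableAt_id.add_const h)
      · exact hdiffat _ (mem_ball_self (by positivity))
    rwa [hd] at this
  rw [ContinuousAt, tendsto_iff_norm_sub_tendsto_zero]
  refine squeeze_zero' (g := fun z => 2 * ‖z - z₀‖ / R / R) (Eventually.of_forall fun _ => norm_nonneg _)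
    ?_ ?_
  · filter_upwards [ball_mem_nhds z₀ hR] with z hz
    have := key (z - z₀) (by rwa [← dist_eq_norm])
    simpa using this
  · have : ContinuousAt (fun z => 2 * ‖z - z₀‖ / R / R) z₀ := by fun_prop
    simpa [ContinuousAt] using this

theorem contDiffOn_one_of_differentiableOn {f : E → F} {U : Set E}
    (hf : DifferentiableOn ℂ f U) (hU : IsOpen U) : ContDiffOn ℂ 1 f U :=
  ((contDiffOn_succ_iff_fderiv_of_isOpen (n := 0) hU).2
    ⟨hf, by simp, contDiffOn_zero.2 (continuousOn_fderiv_of_differentiableOn hf hU)⟩).of_le (by simp)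

/-- Cauchy's estimate turns the bound `u n` on the terms into the bound `2 * u n / R` on their
derivatives over the smaller ball, which justifies termwise differentiation. -/
theorem differentiableOn_tsum_of_summable_norm_ball [CompleteSpace F] {f : ℕ → E → F} {u : ℕ → ℝ}
    (hu : Summable u) {c : E} {R : ℝ} (hR : 0 < R) (hf : ∀ n, DifferentiableOn ℂ (f n) (ball c (2 * R)))
    (hb : ∀ n, ∀ z ∈ ball c (2 * R), ‖f n z‖ ≤ u n) {z : E} (hz : z ∈ ball c R) :
    HasFDerivAt (fun z => ∑' n, f n z) (∑' n, fderiv ℂ (f n) z) z := by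
  have hc : c ∈ ball c (2 * R) := mem_ball_self (by positivity)
  refine hasFDerivAt_tsum_of_isPreconnected (𝕜 := ℂ) (u := fun n => 2 * u n / R)
    ((hu.mul_left 2).div_const R) isOpen_ball
    ((convex_ball (E := E) c R).isPreconnected) (f := f) (f' := fun n z => fderiv ℂ (f n) z) (x₀ := c)
    ?_ ?_ (mem_ball_self hR) ?_ hz
  · intro n y hy
    have hy' : y ∈ ball c (2 * R) := ball_subset_ball (by linarith) hy
    exact ((hf n y hy').differentiableAt (isOpen_ball.mem_nhds hy')).hasFDerivAt
  · intro n y hy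
    have hsub : ball y R ⊆ ball c (2 * R) := by
      apply ball_subset_ball'
      rw [mem_ball] at hy; linarith
    refine Complex.norm_fderiv_le_div_of_mapsTo_ball ((hf n).mono hsub) ?_ hR
    intro w hw
    rw [mem_closedBall, dist_eq_norm]
    refine (norm_sub_le _ _).trans ?_
    have h1 := hb n w (hsub hw)
    have h2 := hb n y (hsub (mem_ball_self hR))
    linarith
  · exact Summable.of_norm_bounded hu fun n => hb n c hc

/-- Holomorphic dependence of circle integrals on parameters. -/
theorem differentiableAt_circleIntegral {f : E × ℂ → ℂ} {O : Set (E × ℂ)} (hO : IsOpen O)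
    (hf : DifferentiableOn ℂ f O) {c : ℂ} {R : ℝ} {z₀ : E}
    (hz : ∀ ζ ∈ sphere c |R|, (z₀, ζ) ∈ O) :
    DifferentiableAt ℂ (fun z => ∮ ζ in C(c, R), f (z, ζ)) z₀ := by
  have hcirc : ∀ θ, circleMap c R θ ∈ sphere c |R| := fun θ => by
    rw [← range_circleMap]; exact ⟨θ, rfl⟩
  have hfd : ContinuousOn (fderiv ℂ f) O := continuousOn_fderiv_of_differentiableOn hf hO
  have hcomp : IsCompact (sphere c |R|) := isCompact_sphere _ _
  obtain ⟨B, hB⟩ : ∃ B, ∀ ζ ∈ sphere c |R|, ‖fderiv ℂ f (z₀, ζ)‖ < B := by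
    obtain ⟨B, hB⟩ := (hcomp.bddAbove_image (f := fun ζ => ‖fderiv ℂ f (z₀, ζ)‖) (by
      refine ContinuousOn.norm (hfd.comp (by fun_prop) fun ζ hζ => hz ζ hζ)))
    exact ⟨B + 1, fun ζ hζ => lt_of_le_of_lt (hB (mem_image_of_mem _ hζ)) (lt_add_one B)⟩
  -- Compactness of the circle makes the bound uniform in a neighbourhood of `z₀`, which dominates
  -- the derivative under the integral.
  have hev : ∀ᶠ z in 𝓝 z₀, ∀ ζ ∈ sphere c |R|, (z, ζ) ∈ O ∧ ‖fderiv ℂ f (z, ζ)‖ < B := by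
    refine hcomp.eventually_forall_of_forall_eventually fun ζ hζ => ?_
    have h1 : ∀ᶠ p in 𝓝 (z₀, ζ), p ∈ O := hO.mem_nhds (hz ζ hζ)
    have h2 : ∀ᶠ p in 𝓝 (z₀, ζ), ‖fderiv ℂ f p‖ < B :=
      ((hfd.continuousAt (hO.mem_nhds (hz ζ hζ))).norm).eventually_lt continuousAt_const (hB ζ hζ)
    filter_upwards [h1, h2] with p hp1 hp2 using ⟨hp1, hp2⟩
  have hcont : ∀ z : E, (∀ ζ ∈ sphere c |R|, (z, ζ) ∈ O) →
      Continuous fun θ => deriv (circleMap c R) θ • f (z, circleMap c R θ) := by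
    intro z hz
    have h1 : Continuous fun θ => f (z, circleMap c R θ) :=
      hf.continuousOn.comp_continuous
        (continuous_const.prodMk (continuous_circleMap c R)) fun θ => hz _ (hcirc θ)
    simp only [deriv_circleMap]
    exact ((continuous_circleMap 0 R).mul continuous_const).smul h1
  have hmain := intervalIntegral.hasFDerivAt_integral_of_dominated_of_fderiv_le (𝕜 := ℂ)
    (μ := MeasureTheory.volume) (a := 0) (b := 2 * Real.pi)
    (F := fun z θ => deriv (circleMap c R) θ • f (z, circleMap c R θ))
    (F' := fun z θ => deriv (circleMap c R) θ •
      (fderiv ℂ f (z, circleMap c R θ)).comp (ContinuousLinearMap.inl ℂ E ℂ))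
    (bound := fun _ => |R| * B) hev ?_ ?_ ?_ ?_ ?_ ?_
  · exact hmain.differentiableAt
  · filter_upwards [hev] with z hz
    exact (hcont z fun ζ hζ => (hz ζ hζ).1).aestronglyMeasurable
  · exact (hcont z₀ hz).intervalIntegrable _ _
  · have h1 : Continuous fun θ => fderiv ℂ f (z₀, circleMap c R θ) :=
      hfd.comp_continuous
        (continuous_const.prodMk (continuous_circleMap c R)) fun θ => hz _ (hcirc θ)
    refine Continuous.aestronglyMeasurable ?_
    simp only [deriv_circleMap]
    refine ((continuous_circleMap 0 R).mul continuous_const).smul ?_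
    exact h1.clm_comp continuous_const
  · refine Eventually.of_forall fun θ _ z hz => ?_
    rw [norm_smul]
    have h1 : ‖deriv (circleMap c R) θ‖ = |R| := by simp
    rw [h1]
    refine mul_le_mul_of_nonneg_left ?_ (abs_nonneg _)
    refine (ContinuousLinearMap.opNorm_comp_le _ _).trans ?_
    have h2 := (hz _ (hcirc θ)).2
    have h3 := ContinuousLinearMap.norm_inl_le_one ℂ E ℂ
    nlinarith [norm_nonneg (fderiv ℂ f (z, circleMap c R θ))]
  · exact intervalIntegrable_const
  · refine Eventually.of_forall fun θ _ z hz => ?_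
    have h1 := (hf _ (hz _ (hcirc θ)).1).differentiableAt (hO.mem_nhds (hz _ (hcirc θ)).1)
    have h2 := h1.hasFDerivAt.comp z (hasFDerivAt_prodMk_left (𝕜 := ℂ) z (circleMap c R θ))
    exact HasFDerivAt.const_smul (R := ℂ) h2 (deriv (circleMap c R) θ)

/-- The partial derivative of a holomorphic function in its last variable is holomorphic. -/
theorem differentiableOn_deriv_snd {f : E × ℂ → ℂ} {O : Set (E × ℂ)} (hO : IsOpen O)
    (hf : DifferentiableOn ℂ f O) :
    DifferentiableOn ℂ (fun p : E × ℂ => deriv (fun w => f (p.1, w)) p.2) O := by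
  intro p₀ hp₀
  refine DifferentiableAt.differentiableWithinAt ?_
  obtain ⟨r, hr, hball⟩ := Metric.mem_nhds_iff.1 (hO.mem_nhds hp₀)
  obtain ⟨R, hR, rfl⟩ : ∃ R > 0, r = 2 * R := ⟨r / 2, by positivity, by ring⟩
  have hmem : ∀ p ∈ ball p₀ R, ∀ v ∈ closedBall (0 : ℂ) R, (p.1, p.2 + v) ∈ O := by
    intro p hp v hv
    apply hball
    rw [mem_ball, Prod.dist_eq, max_lt_iff] at *
    rw [mem_closedBall, dist_zero_right] at hv
    refine ⟨by linarith [hp.1], ?_⟩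
    have : dist (p.2 + v) p₀.2 ≤ dist (p.2 + v) p.2 + dist p.2 p₀.2 := dist_triangle _ _ _
    have h2 : dist (p.2 + v) p.2 = ‖v‖ := by simp [dist_eq_norm]
    simp only
    linarith [hp.2]
  -- Cauchy's formula, translated so that the contour is a fixed circle while the base point varies.
  have heq : (fun p : E × ℂ => deriv (fun w => f (p.1, w)) p.2) =ᶠ[𝓝 p₀]
      fun p => (2 * Real.pi * Complex.I : ℂ)⁻¹ * ∮ v in C(0, R), (1 / v ^ 2) * f (p.1, p.2 + v) := by
    filter_upwards [ball_mem_nhds p₀ hR] with p hp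
    have hd : DifferentiableOn ℂ (fun v => f (p.1, p.2 + v)) (closedBall 0 R) := by
      intro v hv
      have hm := hmem p hp v hv
      have h1 := (hf _ hm).differentiableAt (hO.mem_nhds hm)
      have h2 : DifferentiableAt ℂ (fun v : ℂ => (p.1, p.2 + v)) v := by fun_prop
      exact (DifferentiableAt.comp v h1 h2).differentiableWithinAt
    have := hd.deriv_eq_smul_circleIntegral hR
    rw [deriv_comp_const_add (f := fun w => f (p.1, w))] at this
    simp only [add_zero, sub_zero, smul_eq_mul] at this
    rw [this]
    field_simp
  refine DifferentiableAt.congr_of_eventuallyEq ?_ heq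
  refine DifferentiableAt.const_mul ?_ _
  have hO' : IsOpen {q : (E × ℂ) × ℂ | q.2 ≠ 0 ∧ (q.1.1, q.1.2 + q.2) ∈ O} :=
    (isOpen_ne_fun continuous_snd continuous_const).inter (hO.preimage (by fun_prop))
  refine differentiableAt_circleIntegral (f := fun q : (E × ℂ) × ℂ =>
    (1 / q.2 ^ 2) * f (q.1.1, q.1.2 + q.2)) hO' ?_ ?_
  · intro q hq
    have h1 := (hf _ hq.2).differentiableAt (hO.mem_nhds hq.2)
    have h2 : DifferentiableAt ℂ (fun q : (E × ℂ) × ℂ => (q.1.1, q.1.2 + q.2)) q := by fun_prop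
    have h4 : q.2 ^ 2 ≠ 0 := pow_ne_zero 2 hq.1
    have h3 : DifferentiableAt ℂ (fun q : (E × ℂ) × ℂ => 1 / q.2 ^ 2) q := by
      fun_prop (disch := exact h4)
    exact (h3.mul (DifferentiableAt.comp q h1 h2)).differentiableWithinAt
  · intro v hv
    rw [abs_of_pos hR] at hv
    refine ⟨?_, hmem p₀ (mem_ball_self hR) v (sphere_subset_closedBall hv)⟩
    rintro rfl
    simp at hv; exact hR.ne hv

/-- A convex set meets the complex line through two of its points in a convex, hence connected, set,
so the one-variable identity theorem applies there. -/
theorem eqOn_zero_of_convex {f : E → ℂ} {U : Set E} (hU : IsOpen U)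
    (hc : Convex ℝ U) (hf : DifferentiableOn ℂ f U) {z₀ : E} (hz₀ : z₀ ∈ U)
    (h0 : ∀ᶠ z in 𝓝 z₀, f z = 0) : EqOn f 0 U := by
  intro z hz
  let l : ℂ → E := fun t => z₀ + t • (z - z₀)
  have hl : Differentiable ℂ l := by fun_prop
  have hV : IsOpen (l ⁻¹' U) := hU.preimage hl.continuous
  have hconv : Convex ℝ (l ⁻¹' U) := by
    intro a ha b hb s t hs ht hst
    have : l (s • a + t • b) = s • l a + t • l b := by
      simp only [l, smul_add, add_smul, smul_assoc]
      have : z₀ = s • z₀ + t • z₀ := by rw [← add_smul, hst, one_smul]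
      nth_rw 1 [this]
      abel
    rw [mem_preimage, this]
    exact hc ha hb hs ht hst
  have hfl : DifferentiableOn ℂ (f ∘ l) (l ⁻¹' U) :=
    hf.comp hl.differentiableOn (mapsTo_preimage _ _)
  have h0' : ∀ᶠ t in 𝓝 (0 : ℂ), (f ∘ l) t = 0 := by
    have : Tendsto l (𝓝 0) (𝓝 z₀) := by
      have := hl.continuous.tendsto 0
      simpa [l] using this
    exact this.eventually h0
  have hmem0 : (0 : ℂ) ∈ l ⁻¹' U := by simp [l, hz₀]
  have hmem1 : (1 : ℂ) ∈ l ⁻¹' U := by simp [l, hz]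
  have := (hfl.analyticOnNhd hV).eqOn_zero_of_preconnected_of_eventuallyEq_zero
    hconv.isPreconnected hmem0 h0' hmem1
  simpa [l] using this

end SeveralVariables

/-! ### Zeros of holomorphic functions in a disc -/

section Zeros

open Metric Filter

theorem finite_zeros_closedBall {f : ℂ → ℂ} {V : Set ℂ} (hV : IsOpen V)
    (hf : DifferentiableOn ℂ f V) {c : ℂ} {ρ : ℝ} (hsub : closedBall c ρ ⊆ V) {z₁ : ℂ}
    (hz₁ : z₁ ∈ closedBall c ρ) (hne : f z₁ ≠ 0) : {z ∈ closedBall c ρ | f z = 0}.Finite := by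
  by_contra hinf
  obtain ⟨x, hx, hacc⟩ := Set.Infinite.exists_accPt_of_subset_isCompact hinf
    (isCompact_closedBall c ρ) (sep_subset _ _)
  have han : AnalyticOnNhd ℂ f (closedBall c ρ) := (hf.analyticOnNhd hV).mono hsub
  refine hne (han.eqOn_zero_of_preconnected_of_frequently_eq_zero
    (convex_closedBall c ρ).isPreconnected hx ?_ hz₁)
  exact (accPt_iff_frequently_nhdsNE.1 hacc).mono fun z hz => hz.2

/-- Induction on the number of distinct zeros in the closed disc: dividing by `(z - a) ^ m`, with
`m` the full order at `a`, removes exactly one of them. -/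
theorem exists_factorization_aux (n : ℕ) : ∀ {f : ℂ → ℂ} {V : Set ℂ}, IsOpen V →
    DifferentiableOn ℂ f V → ∀ {c : ℂ} {ρ : ℝ}, 0 < ρ → closedBall c ρ ⊆ V →
    (∀ z ∈ sphere c ρ, f z ≠ 0) → {z ∈ closedBall c ρ | f z = 0}.ncard = n →
    ∃ (M : Multiset ℂ) (u : ℂ → ℂ), (∀ w ∈ M, w ∈ ball c ρ) ∧ DifferentiableOn ℂ u V ∧
      (∀ z ∈ closedBall c ρ, u z ≠ 0) ∧ ∀ z ∈ V, f z = (M.map fun w => z - w).prod * u z := by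
  induction n with
  | zero =>
    intro f V hV hf c ρ hρ hsub hne hcard
    refine ⟨0, f, by simp, hf, ?_, by simp⟩
    obtain ⟨z₁, hz₁⟩ := (NormedSpace.sphere_nonempty (x := c)).2 hρ.le
    have hfin := finite_zeros_closedBall hV hf hsub (sphere_subset_closedBall hz₁) (hne z₁ hz₁)
    rw [Set.ncard_eq_zero hfin] at hcard
    intro z hz h0
    have : z ∈ {z ∈ closedBall c ρ | f z = 0} := ⟨hz, h0⟩
    rw [hcard] at this
    exact this
  | succ n ih =>
    intro f V hV hf c ρ hρ hsub hne hcard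
    obtain ⟨z₁, hz₁⟩ := (NormedSpace.sphere_nonempty (x := c)).2 hρ.le
    have hfin := finite_zeros_closedBall hV hf hsub (sphere_subset_closedBall hz₁) (hne z₁ hz₁)
    obtain ⟨a, ha, hfa⟩ := Set.nonempty_of_ncard_ne_zero (by omega :
      {z ∈ closedBall c ρ | f z = 0}.ncard ≠ 0)
    have haV := hsub ha
    have han : AnalyticOnNhd ℂ f V := hf.analyticOnNhd hV
    have htop : analyticOrderAt f a ≠ ⊤ := by
      intro h
      rw [analyticOrderAt_eq_top] at h
      exact hne z₁ hz₁ ((han.mono hsub).eqOn_zero_of_preconnected_of_eventuallyEq_zero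
        (convex_closedBall c ρ).isPreconnected ha h (sphere_subset_closedBall hz₁))
    obtain ⟨g, hg, hga, hfg⟩ := ((han a haV).analyticOrderAt_ne_top).1 htop
    set m := analyticOrderNatAt f a
    let G : ℂ → ℂ := fun z => if z = a then g a else f z / (z - a) ^ m
    have hGa : G =ᶠ[𝓝 a] g := by
      filter_upwards [hfg] with z hz
      by_cases h : z = a
      · simp [G, h]
      · have : (z - a) ^ m ≠ 0 := pow_ne_zero _ (sub_ne_zero.2 h)
        simp only [G, h, if_false, hz, smul_eq_mul]
        field_simp
    have hGd : DifferentiableOn ℂ G V := by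
      intro z hz
      by_cases h : z = a
      · subst h
        exact (hg.differentiableAt.congr_of_eventuallyEq hGa).differentiableWithinAt
      · have h1 : G =ᶠ[𝓝 z] fun z => f z / (z - a) ^ m := by
          filter_upwards [isOpen_ne.mem_nhds h] with w hw
          have hw' : w ≠ a := hw
          simp [G, hw']
        have h2 : DifferentiableAt ℂ (fun z => f z / (z - a) ^ m) z :=
          ((hf z hz).differentiableAt (hV.mem_nhds hz)).fun_div (by fun_prop)
            (pow_ne_zero _ (sub_ne_zero.2 h))
        exact (h2.congr_of_eventuallyEq h1).differentiableWithinAt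
    have hfG : ∀ z ∈ V, f z = (z - a) ^ m * G z := by
      intro z hz
      by_cases h : z = a
      · subst h
        have := hfg.self_of_nhds
        simpa [G] using this
      · have : (z - a) ^ m ≠ 0 := pow_ne_zero _ (sub_ne_zero.2 h)
        simp only [G, h, if_false]
        field_simp
    have hGne : ∀ z, z ∈ V → f z ≠ 0 → G z ≠ 0 := by
      intro z hz h h'
      rw [hfG z hz, h', mul_zero] at h
      exact h rfl
    have hzero : {z ∈ closedBall c ρ | G z = 0} = {z ∈ closedBall c ρ | f z = 0} \ {a} := by
      ext z
      simp only [mem_ofPred_eq, Set.mem_sdiff, mem_singleton_iff]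
      constructor
      · rintro ⟨hz, h⟩
        refine ⟨⟨hz, by rw [hfG z (hsub hz), h, mul_zero]⟩, ?_⟩
        rintro rfl
        simp [G, hga] at h
      · rintro ⟨⟨hz, h⟩, hza⟩
        refine ⟨hz, ?_⟩
        rw [hfG z (hsub hz)] at h
        exact (mul_eq_zero.1 h).resolve_left (pow_ne_zero _ (sub_ne_zero.2 hza))
    have hab : a ∈ ball c ρ := by
      rw [mem_closedBall] at ha
      refine lt_of_le_of_ne ha fun h => hne a h hfa
    obtain ⟨M, u, hM, hu, hune, hGu⟩ := ih hV hGd hρ hsub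
      (fun z hz => hGne z (hsub (sphere_subset_closedBall hz)) (hne z hz)) (by
        have hmem : a ∈ {z | z ∈ closedBall c ρ ∧ f z = 0} := ⟨ha, hfa⟩
        rw [hzero, Set.ncard_sdiff_singleton_of_mem hmem, hcard]; rfl)
    refine ⟨Multiset.replicate m a + M, u, ?_, hu, hune, ?_⟩
    · intro w hw
      rcases Multiset.mem_add.1 hw with h | h
      · rw [Multiset.eq_of_mem_replicate h]; exact hab
      · exact hM w h
    · intro z hz
      rw [hfG z hz, hGu z hz, Multiset.map_add, Multiset.prod_add, Multiset.map_replicate,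
        Multiset.prod_replicate, mul_assoc]

theorem exists_factorization {f : ℂ → ℂ} {V : Set ℂ} (hV : IsOpen V)
    (hf : DifferentiableOn ℂ f V) {c : ℂ} {ρ : ℝ} (hρ : 0 < ρ) (hsub : closedBall c ρ ⊆ V)
    (hne : ∀ z ∈ sphere c ρ, f z ≠ 0) :
    ∃ (d : ℕ) (w : Fin d → ℂ) (u : ℂ → ℂ), (∀ i, w i ∈ ball c ρ) ∧ DifferentiableOn ℂ u V ∧
      (∀ z ∈ closedBall c ρ, u z ≠ 0) ∧ ∀ z ∈ V, f z = (∏ i, (z - w i)) * u z := by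
  obtain ⟨M, u, hM, hu, hune, hfu⟩ := exists_factorization_aux _ hV hf hρ hsub hne rfl
  induction M using Quotient.inductionOn with
  | h l =>
    refine ⟨l.length, l.get, u, fun i => hM _ (by simp), hu, hune, fun z hz => ?_⟩
    rw [hfu z hz]
    congr 1
    simp only [Multiset.quot_mk_to_coe, Multiset.map_coe, Multiset.prod_coe]
    rw [← List.prod_ofFn]
    congr 1
    rw [← List.ofFn_get (l.map fun w => z - w)]
    apply List.ext_get <;> simp

/-- The residue theorem for `g f' / f`. -/
theorem circleIntegral_mul_deriv_div {f g : ℂ → ℂ} {V : Set ℂ} (hV : IsOpen V)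
    (hg : DifferentiableOn ℂ g V) {c : ℂ} {ρ : ℝ} (hρ : 0 < ρ)
    (hsub : closedBall c ρ ⊆ V) {d : ℕ} {w : Fin d → ℂ} {u : ℂ → ℂ} (hw : ∀ i, w i ∈ ball c ρ)
    (hu : DifferentiableOn ℂ u V) (hune : ∀ z ∈ closedBall c ρ, u z ≠ 0)
    (hfu : ∀ z ∈ V, f z = (∏ i, (z - w i)) * u z) :
    (∮ z in C(c, ρ), g z * (deriv f z / f z)) = 2 * Real.pi * Complex.I * ∑ i, g (w i) := by
  have hsph : ∀ z ∈ sphere c ρ, ∀ i, z - w i ≠ 0 := by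
    intro z hz i h
    have := hw i
    rw [← sub_eq_zero.1 h, mem_ball] at this
    rw [mem_sphere] at hz
    linarith
  have hint : ∀ z ∈ sphere c ρ, g z * (deriv f z / f z) =
      ∑ i, (z - w i)⁻¹ • g z + g z * (deriv u z / u z) := by
    intro z hz
    have hzV := hsub (sphere_subset_closedBall hz)
    have hzu := hune z (sphere_subset_closedBall hz)
    have h1 : f =ᶠ[𝓝 z] fun z => (∏ i, (z - w i)) * u z := by
      filter_upwards [hV.mem_nhds hzV] with x hx using hfu x hx
    have hpd : ∀ i, DifferentiableAt ℂ (fun z => z - w i) z := fun i => by fun_prop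
    have h2 : deriv f z / f z = ∑ i, (z - w i)⁻¹ + deriv u z / u z := by
      rw [← logDeriv_apply, ← logDeriv_apply, (logDeriv_congr_nhds h1).self_of_nhds,
        logDeriv_mul z (Finset.prod_ne_zero_iff.2 fun i _ => hsph z hz i) hzu
          (DifferentiableAt.fun_finsetProd fun i _ => hpd i)
          ((hu z hzV).differentiableAt (hV.mem_nhds hzV)),
        logDeriv_prod (fun i _ => hsph z hz i) fun i _ => hpd i]
      congr 1
      refine Finset.sum_congr rfl fun i _ => ?_
      simp [logDeriv_apply]
    rw [h2, mul_add, Finset.mul_sum]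
    simp [mul_comm]
  rw [circleIntegral.integral_congr hρ.le hint]
  have hgc : ContinuousOn g (sphere c ρ) :=
    hg.continuousOn.mono (sphere_subset_closedBall.trans hsub)
  have hui : ContinuousOn (fun z => g z * (deriv u z / u z)) (sphere c ρ) := by
    refine hgc.mul (ContinuousOn.div ?_ ?_ ?_)
    · exact (hu.deriv hV).continuousOn.mono (sphere_subset_closedBall.trans hsub)
    · exact hu.continuousOn.mono (sphere_subset_closedBall.trans hsub)
    · exact fun z hz => hune z (sphere_subset_closedBall hz)
  have hi : ∀ i, CircleIntegrable (fun z => (z - w i)⁻¹ • g z) c ρ := by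
    intro i
    refine ContinuousOn.circleIntegrable hρ.le ?_
    exact (ContinuousOn.inv₀ (by fun_prop) fun z hz => hsph z hz i).smul hgc
  rw [circleIntegral.integral_add (CircleIntegrable.fun_sum _ fun i _ => hi i)
    (hui.circleIntegrable hρ.le), circleIntegral.integral_fun_sum fun i _ => hi i, Finset.mul_sum]
  have h0 : (∮ z in C(c, ρ), g z * (deriv u z / u z)) = 0 := by
    refine DiffContOnCl.circleIntegral_eq_zero hρ.le (DifferentiableOn.diffContOnCl ?_)
    rw [closure_ball c hρ.ne']
    refine (hg.mono hsub).mul (((hu.deriv hV).mono hsub).fun_div (hu.mono hsub) hune)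
  rw [h0, add_zero]
  refine Finset.sum_congr rfl fun i _ => ?_
  rw [(hg.mono hsub).circleIntegral_sub_inv_smul (hw i), smul_eq_mul]

/-- If the power sums of finitely many functions are holomorphic, then so is their product. -/
theorem differentiableOn_prod_of_powerSums {E : Type*} [NormedAddCommGroup E] [NormedSpace ℂ E]
    {d : ℕ} {v : E → Fin d → ℂ} {Ω : Set E}
    (h : ∀ k, DifferentiableOn ℂ (fun z => ∑ i, v z i ^ k) Ω) :
    DifferentiableOn ℂ (fun z => ∏ i, v z i) Ω := by
  have key : ∀ k, DifferentiableOn ℂ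
      (fun z => MvPolynomial.aeval (v z) (MvPolynomial.esymm (Fin d) ℂ k)) Ω := by
    intro k
    induction k using Nat.strong_induction_on with
    | h k ih =>
      rcases Nat.eq_zero_or_pos k with rfl | hk
      · simp
      -- Newton's identities, solved for the top elementary symmetric function.
      have hN : ∀ z, MvPolynomial.aeval (v z) (MvPolynomial.esymm (Fin d) ℂ k) = (k : ℂ)⁻¹ *
          ((-1) ^ (k + 1) * ∑ a ∈ Finset.HasAntidiagonal.antidiagonal k with a.1 < k, (-1) ^ a.1 *
            MvPolynomial.aeval (v z) (MvPolynomial.esymm (Fin d) ℂ a.1) * ∑ i, v z i ^ a.2) := by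
        intro z
        have := congrArg (MvPolynomial.aeval (v z)) (MvPolynomial.mul_esymm_eq_sum (Fin d) ℂ k)
        simp only [map_mul, map_natCast, map_sum, map_pow, map_neg, map_one,
          MvPolynomial.psum, MvPolynomial.aeval_X] at this
        rw [← this, inv_mul_cancel_left₀ (Nat.cast_ne_zero.2 hk.ne')]
      simp only [hN]
      refine ((DifferentiableOn.fun_sum fun a ha => ?_).const_mul _).const_mul _
      exact ((ih a.1 (Finset.mem_filter.1 ha).2).const_mul _).mul (h a.2)
  refine (key d).congr fun z _ => ?_
  have : Finset.powersetCard d (Finset.univ : Finset (Fin d)) = {Finset.univ} := by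
    simpa using Finset.powersetCard_self (Finset.univ : Finset (Fin d))
  simp [MvPolynomial.esymm, this]

/-- The roots of a holomorphic function `f (z, ·)` in a disc, counted with multiplicity, depend
holomorphically on `z`, in the sense that the symmetric sums of their images do. -/
theorem exists_roots {E : Type*} [NormedAddCommGroup E] [NormedSpace ℂ E] {f : E × ℂ → ℂ}
    {O : Set (E × ℂ)} (hO : IsOpen O) (hf : DifferentiableOn ℂ f O) {Ω : Set E} (hΩ : IsOpen Ω)
    (hΩc : IsPreconnected Ω) {c : ℂ} {ρ : ℝ} (hρ : 0 < ρ)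
    (hsub : ∀ z ∈ Ω, ∀ w ∈ closedBall c ρ, (z, w) ∈ O)
    (hne : ∀ z ∈ Ω, ∀ w ∈ sphere c ρ, f (z, w) ≠ 0) :
    ∃ (d : ℕ) (W : E → Fin d → ℂ), (∀ z ∈ Ω, ∀ w, (w ∈ ball c ρ ∧ f (z, w) = 0) ↔ ∃ i, w = W z i) ∧
      ∀ h : E × ℂ → ℂ, DifferentiableOn ℂ h O →
        DifferentiableOn ℂ (fun z => ∑ i, h (z, W z i)) Ω := by
  have hV : ∀ z, IsOpen {w | (z, w) ∈ O} := fun z => hO.preimage (by fun_prop)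
  have hslice : ∀ h : E × ℂ → ℂ, DifferentiableOn ℂ h O → ∀ z,
      DifferentiableOn ℂ (fun w => h (z, w)) {w | (z, w) ∈ O} := fun h hh z =>
    hh.comp (by fun_prop) fun w hw => hw
  have hfac : ∀ z : E, ∃ (d : ℕ) (w : Fin d → ℂ) (u : ℂ → ℂ), z ∈ Ω → (∀ i, w i ∈ ball c ρ) ∧
      DifferentiableOn ℂ u {w | (z, w) ∈ O} ∧ (∀ y ∈ closedBall c ρ, u y ≠ 0) ∧
      ∀ y, (z, y) ∈ O → f (z, y) = (∏ i, (y - w i)) * u y := by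
    intro z
    by_cases hz : z ∈ Ω
    · obtain ⟨d, w, u, h⟩ := exists_factorization (hV z) (hslice f hf z) hρ (hsub z hz) (hne z hz)
      exact ⟨d, w, u, fun _ => h⟩
    · exact ⟨0, 0, 0, fun h => absurd h hz⟩
  choose d W u hfac using hfac
  have hsum : ∀ h : E × ℂ → ℂ, DifferentiableOn ℂ h O →
      DifferentiableOn ℂ (fun z => ∑ i, h (z, W z i)) Ω := by
    intro h hh
    have heq : ∀ z ∈ Ω, ∑ i, h (z, W z i) = (2 * Real.pi * Complex.I : ℂ)⁻¹ *
        ∮ w in C(c, ρ), h (z, w) * (deriv (fun w => f (z, w)) w / f (z, w)) := by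
      intro z hz
      obtain ⟨h1, h2, h3, h4⟩ := hfac z hz
      rw [circleIntegral_mul_deriv_div (f := fun w => f (z, w)) (g := fun w => h (z, w)) (hV z)
        (hslice h hh z) hρ (hsub z hz) h1 h2 h3 h4, inv_mul_cancel_left₀]
      simp [Complex.I_ne_zero, Real.pi_ne_zero]
    refine DifferentiableOn.congr ?_ heq
    intro z hz
    refine DifferentiableAt.differentiableWithinAt (DifferentiableAt.const_mul ?_ _)
    have hO' : IsOpen (O ∩ {p | f p ≠ 0}) := hf.continuousOn.isOpen_inter_preimage hO isOpen_ne
    refine differentiableAt_circleIntegral (f := fun p : E × ℂ =>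
      h p * (deriv (fun w => f (p.1, w)) p.2 / f p)) hO' ?_ ?_
    · have h1 := (differentiableOn_deriv_snd hO hf).mono
        (inter_subset_left : O ∩ {p | f p ≠ 0} ⊆ O)
      simp only [div_eq_mul_inv]
      exact (hh.mono inter_subset_left).mul
        (h1.mul ((hf.mono inter_subset_left).fun_inv fun p hp => hp.2))
    · intro w hw
      rw [abs_of_pos hρ] at hw
      exact ⟨hsub z hz w (sphere_subset_closedBall hw), hne z hz w hw⟩
  -- The sum for `h = 1` is the number of roots, which is therefore a continuous integer and
  -- constant on the connected set `Ω`.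
  have hd : ContinuousOn d Ω := by
    have h1 := (hsum (fun _ => 1) (differentiableOn_const _)).continuousOn
    have h2 : ContinuousOn (fun z => ((d z : ℕ) : ℝ)) Ω := by
      refine (Complex.continuous_re.comp_continuousOn h1).congr fun z _ => ?_
      simp
    exact Nat.isClosedEmbedding_coe_real.isInducing.continuousOn_iff.2 h2
  rcases Ω.eq_empty_or_nonempty with rfl | ⟨z₀, hz₀⟩
  · exact ⟨0, fun _ => 0, by simp, fun _ _ => differentiableOn_empty⟩
  have hconst : ∀ z ∈ Ω, d z = d z₀ := fun z hz => hΩc.constant hd hz hz₀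
  refine ⟨d z₀, fun z i => if hz : d z = d z₀ then W z (Fin.cast hz.symm i) else 0, ?_, ?_⟩
  · intro z hz w
    obtain ⟨h1, h2, h3, h4⟩ := hfac z hz
    have hdz := hconst z hz
    simp only [hdz, dite_true]
    have hiff : (w ∈ ball c ρ ∧ f (z, w) = 0) ↔ ∃ i, w = W z i := by
      constructor
      · rintro ⟨hw, h0⟩
        have hw' := ball_subset_closedBall hw
        rw [h4 w (hsub z hz w hw')] at h0
        obtain ⟨i, -, hi⟩ := Finset.prod_eq_zero_iff.1 ((mul_eq_zero.1 h0).resolve_right (h3 w hw'))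
        exact ⟨i, sub_eq_zero.1 hi⟩
      · rintro ⟨i, rfl⟩
        refine ⟨h1 i, ?_⟩
        rw [h4 _ (hsub z hz _ (ball_subset_closedBall (h1 i))),
          Finset.prod_eq_zero (Finset.mem_univ i) (sub_self _), zero_mul]
    rw [hiff]
    constructor
    · rintro ⟨i, rfl⟩
      exact ⟨Fin.cast hdz i, by simp⟩
    · rintro ⟨i, rfl⟩
      exact ⟨_, rfl⟩
  · intro h hh
    refine (hsum h hh).congr fun z hz => ?_
    have hdz := hconst z hz
    simp only [hdz, dite_true]
    exact Fintype.sum_equiv (finCongr hdz.symm) _ _ fun i => by simp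

/-- Elimination: the set of the `z` for which `f (z, ·)` and the functions of the family `Φ` have a
common zero in a disc is the set of common zeros of a family of holomorphic functions. -/
theorem exists_elimination {E : Type*} [NormedAddCommGroup E] [NormedSpace ℂ E] {f : E × ℂ → ℂ}
    {O : Set (E × ℂ)} (hO : IsOpen O) (hf : DifferentiableOn ℂ f O) {Ω : Set E} (hΩ : IsOpen Ω)
    (hΩc : IsPreconnected Ω) {c : ℂ} {ρ : ℝ} (hρ : 0 < ρ)
    (hsub : ∀ z ∈ Ω, ∀ w ∈ closedBall c ρ, (z, w) ∈ O)
    (hne : ∀ z ∈ Ω, ∀ w ∈ sphere c ρ, f (z, w) ≠ 0) (Φ : Set (E × ℂ → ℂ))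
    (hΦ : ∀ h ∈ Φ, DifferentiableOn ℂ h O) :
    ∃ Ψ : Set (E → ℂ), (∀ N ∈ Ψ, DifferentiableOn ℂ N Ω) ∧ ∀ z ∈ Ω,
      (∃ w ∈ ball c ρ, f (z, w) = 0 ∧ ∀ h ∈ Φ, h (z, w) = 0) ↔ ∀ N ∈ Ψ, N z = 0 := by
  obtain ⟨d, W, hW, hsum⟩ := exists_roots hO hf hΩ hΩc hρ hsub hne
  have hspan : ∀ h ∈ Submodule.span ℂ Φ, DifferentiableOn ℂ h O := by
    intro h hh
    induction hh using Submodule.span_induction with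
    | mem h hh => exact hΦ h hh
    | zero => exact differentiableOn_const 0
    | add f g _ _ hf hg => exact hf.add hg
    | smul a f _ hf => exact hf.const_smul a
  -- The eliminants are the products over the roots. All linear combinations of `Φ` must be used:
  -- products of the members alone could vanish at different roots.
  refine ⟨(fun h z => ∏ i, h (z, W z i)) '' (Submodule.span ℂ Φ : Set (E × ℂ → ℂ)), ?_, ?_⟩
  · rintro N ⟨h, hh, rfl⟩
    refine differentiableOn_prod_of_powerSums fun k => ?_
    exact hsum (fun p => h p ^ k) ((hspan h hh).pow k)
  · intro z hz
    constructor
    · rintro ⟨w, hw, h0, hall⟩ N ⟨h, hh, rfl⟩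
      obtain ⟨i, rfl⟩ := (hW z hz w).1 ⟨hw, h0⟩
      have h1 : ∀ h ∈ Submodule.span ℂ Φ, h (z, W z i) = 0 := by
        intro h hh
        induction hh using Submodule.span_induction with
        | mem h hh => exact hall h hh
        | zero => rfl
        | add f g _ _ hf hg => simp [hf, hg]
        | smul a f _ hf => simp [hf]
      exact Finset.prod_eq_zero (Finset.mem_univ i) (h1 h hh)
    · intro hN
      -- Every combination vanishes at some root, so finitely many kernels of evaluations cover the
      -- span. Over an infinite field one of them is the whole span, and its root is a common zero.
      have hcov : (⋃ i, ((LinearMap.ker ((LinearMap.proj (z, W z i) : (E × ℂ → ℂ) →ₗ[ℂ] ℂ).comp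
          (Submodule.span ℂ Φ).subtype) : Submodule ℂ (Submodule.span ℂ Φ)) :
            Set (Submodule.span ℂ Φ))) = univ := by
        refine eq_univ_of_forall fun h => ?_
        obtain ⟨i, -, hi⟩ := Finset.prod_eq_zero_iff.1 (hN _ ⟨h.1, h.2, rfl⟩)
        exact mem_iUnion.2 ⟨i, by simpa using hi⟩
      obtain ⟨i, hi⟩ := Subspace.exists_eq_top_of_iUnion_eq_univ hcov
      obtain ⟨h1, h2⟩ := (hW z hz (W z i)).2 ⟨i, rfl⟩
      refine ⟨W z i, h1, h2, fun h hh => ?_⟩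
      have : (⟨h, Submodule.subset_span hh⟩ : Submodule.span ℂ Φ) ∈ (⊤ : Submodule ℂ _) := trivial
      rw [← hi] at this
      simpa using this

end Zeros

/-! ### Local analytic sets -/

section LocalAnalytic

open Metric Filter

/-- The usual preparation for Weierstrass theory: a small circle misses the zeros of the central
slice, and by compactness it misses those of all neighbouring slices. -/
theorem exists_polydisc {E : Type*} [NormedAddCommGroup E] {f : E × ℂ → ℂ} {O : Set (E × ℂ)} (hO : IsOpen O)
    (hf : ContinuousOn f O) {p : E × ℂ} (hp : p ∈ O) (hne : ∀ᶠ w in 𝓝[≠] p.2, f (p.1, w) ≠ 0) :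
    ∃ ρ > 0, ∃ δ > 0, (∀ z ∈ ball p.1 δ, ∀ w ∈ closedBall p.2 ρ, (z, w) ∈ O) ∧
      (∀ z ∈ ball p.1 δ, ∀ w ∈ sphere p.2 ρ, f (z, w) ≠ 0) ∧
      ∀ w ∈ closedBall p.2 ρ, w ≠ p.2 → f (p.1, w) ≠ 0 := by
  obtain ⟨r, hr, hball⟩ := Metric.mem_nhds_iff.1 (hO.mem_nhds hp)
  obtain ⟨r', hr', hne'⟩ := Metric.mem_nhdsWithin_iff.1 hne
  set ρ := min r r' / 2 with hρ
  have hρ0 : 0 < ρ := by positivity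
  have hρr : ρ < r := by have := min_le_left r r'; linarith
  have hρr' : ρ < r' := by have := min_le_right r r'; linarith
  have h1 : ∀ w ∈ closedBall p.2 ρ, w ≠ p.2 → f (p.1, w) ≠ 0 := fun w hw hwp =>
    hne' ⟨closedBall_subset_ball hρr' hw, hwp⟩
  have h2 : ∀ᶠ z in 𝓝 p.1, ∀ w ∈ sphere p.2 ρ, f (z, w) ≠ 0 := by
    refine (isCompact_sphere _ _).eventually_forall_of_forall_eventually fun w hw => ?_
    have hwp : w ≠ p.2 := by
      rintro rfl
      simp at hw
      exact hρ0.ne hw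
    have hm : (p.1, w) ∈ O := by
      apply hball
      rw [mem_ball, Prod.dist_eq]
      simpa [hr] using lt_of_le_of_lt (sphere_subset_closedBall hw) hρr
    exact (hf.continuousAt (hO.mem_nhds hm)).eventually_ne (h1 w (sphere_subset_closedBall hw) hwp)
  obtain ⟨δ, hδ, hδ'⟩ := Metric.mem_nhds_iff.1 h2
  refine ⟨ρ, hρ0, min δ r, lt_min hδ hr, ?_, ?_, h1⟩
  · intro z hz w hw
    apply hball
    rw [mem_ball, Prod.dist_eq, max_lt_iff]
    exact ⟨lt_of_lt_of_le hz (min_le_right _ _), lt_of_le_of_lt hw hρr⟩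
  · intro z hz
    exact hδ' (ball_subset_ball (min_le_left _ _) hz)

/-- Division of a holomorphic function by its last variable. -/
theorem exists_eq_snd_mul {E : Type*} [NormedAddCommGroup E] [NormedSpace ℂ E] {f : E × ℂ → ℂ} {O : Set (E × ℂ)} (hO : IsOpen O)
    (hf : DifferentiableOn ℂ f O) (h0 : ∀ z, (z, (0 : ℂ)) ∈ O → f (z, 0) = 0) :
    ∃ g : E × ℂ → ℂ, DifferentiableOn ℂ g O ∧ ∀ p ∈ O, f p = p.2 * g p := by
  refine ⟨fun p => if p.2 = 0 then deriv (fun w => f (p.1, w)) 0 else p.2⁻¹ * f p, ?_, ?_⟩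
  · rintro ⟨z₀, w₀⟩ hp
    refine DifferentiableAt.differentiableWithinAt ?_
    by_cases hw : w₀ = 0
    · subst hw
      obtain ⟨r, hr, hball⟩ := Metric.mem_nhds_iff.1 (hO.mem_nhds hp)
      obtain ⟨R, hR, rfl⟩ : ∃ R > 0, r = 2 * R := ⟨r / 2, by positivity, by ring⟩
      have hmem : ∀ z ∈ ball z₀ R, ∀ v ∈ closedBall (0 : ℂ) R, (z, v) ∈ O := by
        intro z hz v hv
        apply hball
        rw [mem_ball, Prod.dist_eq, max_lt_iff]
        rw [mem_ball] at hz
        rw [mem_closedBall] at hv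
        exact ⟨by simp only; linarith, by simp only; linarith⟩
      -- On each slice the quotient is the difference quotient `dslope` at 0. Cauchy's formula
      -- expresses it through values of `f` on a circle away from 0, so it is holomorphic in both
      -- variables jointly.
      have heq : (fun p : E × ℂ => if p.2 = 0 then deriv (fun w => f (p.1, w)) 0 else p.2⁻¹ * f p)
          =ᶠ[𝓝 (z₀, 0)] fun p => (2 * Real.pi * Complex.I : ℂ)⁻¹ *
            ∮ v in C(0, R), (v - p.2)⁻¹ * (v⁻¹ * f (p.1, v)) := by
        filter_upwards [prod_mem_nhds (ball_mem_nhds z₀ hR) (ball_mem_nhds (0 : ℂ) hR)]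
          with ⟨z, w⟩ ⟨hz, hw⟩
        have hV : IsOpen {v | (z, v) ∈ O} := hO.preimage (by fun_prop)
        have hd : DifferentiableOn ℂ (dslope (fun w => f (z, w)) 0) {v | (z, v) ∈ O} := by
          refine (Complex.differentiableOn_dslope (hV.mem_nhds
            (hmem z hz 0 (mem_closedBall_self hR.le)))).2 ?_
          exact hf.comp (by fun_prop) fun v hv => hv
        have h1 := (hd.mono (hmem z hz)).circleIntegral_sub_inv_smul hw
        have h2 : (∮ v in C(0, R), (v - w)⁻¹ * (v⁻¹ * f (z, v))) =
            ∮ v in C(0, R), (v - w)⁻¹ • dslope (fun w => f (z, w)) 0 v := by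
          refine circleIntegral.integral_congr hR.le fun v hv => ?_
          have hv0 : v ≠ 0 := by
            rintro rfl
            simp at hv; exact hR.ne hv
          have hz0 := h0 z (hmem z hz 0 (mem_closedBall_self hR.le))
          simp [dslope_of_ne _ hv0, slope_def_field, hz0, div_eq_inv_mul]
        have hz0 := h0 z (hmem z hz 0 (mem_closedBall_self hR.le))
        simp only
        rw [h2, h1, smul_eq_mul, inv_mul_cancel_left₀ (by simp [Complex.I_ne_zero, Real.pi_ne_zero])]
        split_ifs with hw0
        · rw [hw0, dslope_same]
        · rw [dslope_of_ne _ hw0, slope_def_field, hz0, div_eq_inv_mul, sub_zero, sub_zero]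
      refine DifferentiableAt.congr_of_eventuallyEq (DifferentiableAt.const_mul ?_ _) heq
      have hO' : IsOpen {q : (E × ℂ) × ℂ | q.2 - q.1.2 ≠ 0 ∧ q.2 ≠ 0 ∧ (q.1.1, q.2) ∈ O} :=
        (isOpen_ne_fun (by fun_prop) continuous_const).inter
          ((isOpen_ne_fun continuous_snd continuous_const).inter (hO.preimage (by fun_prop)))
      refine differentiableAt_circleIntegral (f := fun q : (E × ℂ) × ℂ =>
        (q.2 - q.1.2)⁻¹ * (q.2⁻¹ * f (q.1.1, q.2))) hO' ?_ ?_
      · intro q hq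
        have h1 := (hf _ hq.2.2).differentiableAt (hO.mem_nhds hq.2.2)
        have h2 : DifferentiableAt ℂ (fun q : (E × ℂ) × ℂ => (q.1.1, q.2)) q := by fun_prop
        have h3 : DifferentiableAt ℂ (fun q : (E × ℂ) × ℂ => (q.2 - q.1.2)⁻¹) q :=
          DifferentiableAt.fun_inv (by fun_prop) hq.1
        have h4 : DifferentiableAt ℂ (fun q : (E × ℂ) × ℂ => (q.2)⁻¹) q :=
          DifferentiableAt.fun_inv (by fun_prop) hq.2.1
        exact (h3.mul (h4.mul (DifferentiableAt.comp q h1 h2))).differentiableWithinAt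
      · intro v hv
        rw [abs_of_pos hR] at hv
        have hv0 : v ≠ 0 := by
          rintro rfl
          simp at hv; exact hR.ne hv
        exact ⟨by simpa using hv0, hv0, hmem z₀ (mem_ball_self hR) v (sphere_subset_closedBall hv)⟩
    · have heq : (fun p : E × ℂ => if p.2 = 0 then deriv (fun w => f (p.1, w)) 0 else p.2⁻¹ * f p)
          =ᶠ[𝓝 (z₀, w₀)] fun p => p.2⁻¹ * f p := by
        have : ∀ᶠ p : E × ℂ in 𝓝 (z₀, w₀), p.2 ≠ 0 := continuousAt_snd.eventually_ne hw
        filter_upwards [this] with p hp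
        rw [if_neg hp]
      refine DifferentiableAt.congr_of_eventuallyEq ?_ heq
      exact (DifferentiableAt.fun_inv (by fun_prop) hw).mul
        ((hf _ hp).differentiableAt (hO.mem_nhds hp))
  · rintro ⟨z, w⟩ hp
    simp only
    split_ifs with hw
    · subst hw
      simp [h0 z hp]
    · rw [mul_inv_cancel_left₀ hw]

/-- The implicit function theorem makes `s = 0` a graph over the first variable; the other members
of `Φ` have accumulating zeros on it and so vanish along it. -/
theorem exists_graph_of_deriv_ne_zero {O : Set (ℂ × ℂ)} (hO : IsOpen O) {Φ : Set (ℂ × ℂ → ℂ)}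
    (hΦ : ∀ h ∈ Φ, DifferentiableOn ℂ h O) {s : ℂ × ℂ → ℂ} (hs : s ∈ Φ) {p : ℂ × ℂ} (hp : p ∈ O)
    (hacc : AccPt p (𝓟 {q | q ∈ O ∧ ∀ h ∈ Φ, h q = 0}))
    (hd : deriv (fun b => s (p.1, b)) p.2 ≠ 0) :
    ∃ (a₀ : ℂ) (r : ℝ) (β : ℂ → ℂ), 0 < r ∧ DifferentiableOn ℂ β (ball a₀ r) ∧
      ∀ a ∈ ball a₀ r, (a, β a) ∈ O ∧ ∀ h ∈ Φ, h (a, β a) = 0 := by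
  rw [accPt_iff_frequently_nhdsNE] at hacc
  have hacc' : ∃ᶠ q in 𝓝 p, q ∈ O ∧ ∀ h ∈ Φ, h q = 0 := hacc.filter_mono nhdsWithin_le_nhds
  have hcont : ∀ h ∈ Φ, ContinuousAt h p := fun h hh =>
    (hΦ h hh).continuousOn.continuousAt (hO.mem_nhds hp)
  have hsp : s p = 0 := by
    by_contra hne
    exact hacc' ((hcont s hs).eventually_ne hne |>.mono fun q hq h => hq (h.2 s hs))
  have hcd : ContDiffAt ℂ 1 s p :=
    (contDiffOn_one_of_differentiableOn (hΦ s hs) hO).contDiffAt (hO.mem_nhds hp)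
  have hdiff : DifferentiableAt ℂ s p := hcd.differentiableAt (by simp)
  have hinv : (fderiv ℂ s p ∘L .inr ℂ ℂ ℂ).IsInvertible := by
    have h1 : HasDerivAt (fun b => s (p.1, b)) (fderiv ℂ s p (0, 1)) p.2 := by
      have h2 : HasDerivAt (fun b : ℂ => (p.1, b)) ((0 : ℂ), (1 : ℂ)) p.2 :=
        (hasDerivAt_const _ _).prodMk (hasDerivAt_id _)
      exact HasFDerivAt.comp_hasDerivAt p.2 hdiff.hasFDerivAt h2
    have h3 : fderiv ℂ s p (0, 1) ≠ 0 := by rwa [← h1.deriv]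
    refine ⟨ContinuousLinearEquiv.unitsEquivAut ℂ (Units.mk0 _ h3), ?_⟩
    ext
    simp
  set β := hcd.implicitFunction one_ne_zero hinv with hβ
  have hβp : β p.1 = p.2 := hcd.implicitFunction_apply_self one_ne_zero hinv
  have hβd : ∀ᶠ a in 𝓝 p.1, DifferentiableAt ℂ β a :=
    ((hcd.contDiffAt_implicitFunction one_ne_zero hinv).eventually (by simp)).mono fun a ha =>
      ha.differentiableAt (by simp)
  have hβc : ContinuousAt (fun a => (a, β a)) p.1 :=
    continuousAt_id.prodMk hβd.self_of_nhds.continuousAt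
  have hβO : ∀ᶠ a in 𝓝 p.1, (a, β a) ∈ O := hβc.eventually_mem (by
    rw [hβp]; exact hO.mem_nhds hp)
  obtain ⟨r, hr, hball⟩ := Metric.mem_nhds_iff.1 (hβd.and hβO)
  refine ⟨p.1, r, β, hr, fun a ha => (hball ha).1.differentiableWithinAt, fun a ha =>
    ⟨(hball ha).2, fun h hh => ?_⟩⟩
  have hdh : DifferentiableOn ℂ (fun a => h (a, β a)) (ball p.1 r) := by
    intro a ha
    have h1 := (hΦ h hh _ (hball ha).2).differentiableAt (hO.mem_nhds (hball ha).2)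
    have h2 : DifferentiableAt ℂ (fun a => (a, β a)) a :=
      differentiableAt_id.prodMk (hball ha).1
    exact (DifferentiableAt.comp a h1 h2).differentiableWithinAt
  refine (hdh.analyticOnNhd isOpen_ball).eqOn_zero_of_preconnected_of_frequently_eq_zero
    (convex_ball _ _).isPreconnected (mem_ball_self hr) ?_ ha
  have hgraph : ∀ᶠ q in 𝓝[≠] p, s q = 0 → β q.1 = q.2 :=
    nhdsWithin_le_nhds ((hcd.eventually_apply_eq_iff_implicitFunction one_ne_zero hinv).mono
      fun q hq h0 => hq.1 (h0.trans hsp.symm))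
  have hfreq := hacc.and_eventually (hgraph.and self_mem_nhdsWithin)
  have htend : Tendsto Prod.fst (𝓝 p) (𝓝 p.1) := continuous_fst.tendsto p
  rw [frequently_nhdsWithin_iff]
  refine htend.frequently ((frequently_nhdsWithin_iff.1 hfreq).mono ?_)
  rintro q ⟨⟨⟨-, hq⟩, hgq, hne⟩, -⟩
  have hb := hgq (hq s hs)
  have hqe : (q.1, β q.1) = q := by rw [hb]
  refine ⟨by rw [hqe]; exact hq h hh, fun h1 => hne ?_⟩
  have h1' : q.1 = p.1 := h1
  rw [← hqe, h1', hβp]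
  rfl

/-- An analytic set in `ℂ²` of positive codimension which accumulates at one of its points contains
the graph of a holomorphic function. -/
theorem exists_graph_of_accPt (m : ℕ) : ∀ {O : Set (ℂ × ℂ)}, IsOpen O → ∀ {Φ : Set (ℂ × ℂ → ℂ)},
    (∀ h ∈ Φ, DifferentiableOn ℂ h O) → ∀ {s : ℂ × ℂ → ℂ}, s ∈ Φ → ∀ {p : ℂ × ℂ}, p ∈ O →
    AccPt p (𝓟 {q | q ∈ O ∧ ∀ h ∈ Φ, h q = 0}) → analyticOrderAt (fun b => s (p.1, b)) p.2 = m →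
    ∃ (a₀ : ℂ) (r : ℝ) (β : ℂ → ℂ), 0 < r ∧ DifferentiableOn ℂ β (ball a₀ r) ∧
      ∀ a ∈ ball a₀ r, (a, β a) ∈ O ∧ ∀ h ∈ Φ, h (a, β a) = 0 := by
  induction m with
  | zero =>
    intro O hO Φ hΦ s hs p hp hacc hm
    exfalso
    have hV : IsOpen {b | (p.1, b) ∈ O} := hO.preimage (by fun_prop)
    have han : AnalyticAt ℂ (fun b => s (p.1, b)) p.2 := by
      refine DifferentiableOn.analyticAt (s := {b | (p.1, b) ∈ O}) ?_ (hV.mem_nhds hp)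
      exact (hΦ s hs).comp (by fun_prop) fun w hw => hw
    have hne : s p ≠ 0 := (han.analyticOrderAt_eq_zero.1 hm)
    rw [accPt_iff_frequently_nhdsNE] at hacc
    exact (hacc.filter_mono nhdsWithin_le_nhds) (((hΦ s hs).continuousOn.continuousAt
      (hO.mem_nhds hp)).eventually_ne hne |>.mono fun q hq h => hq (h.2 s hs))
  | succ m ih =>
    intro O hO Φ hΦ s hs p hp hacc hm
    have hV : IsOpen {b | (p.1, b) ∈ O} := hO.preimage (by fun_prop)
    have han : AnalyticAt ℂ (fun b => s (p.1, b)) p.2 := by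
      refine DifferentiableOn.analyticAt (s := {b | (p.1, b) ∈ O}) ?_ (hV.mem_nhds hp)
      exact (hΦ s hs).comp (by fun_prop) fun w hw => hw
    have hm' := analyticOrderAt_deriv_of_pos han (n := m) (by simpa using hm)
    -- Differentiating lowers the vanishing order by one. If adjoining `s'` keeps `p` an
    -- accumulation point, induction applies. Otherwise `s' ≠ 0` at all common zeros other than `p`
    -- near `p`, and the implicit function theorem can be used at such a zero.
    set s' : ℂ × ℂ → ℂ := fun q => deriv (fun b => s (q.1, b)) q.2 with hs'
    have hs'd : DifferentiableOn ℂ s' O := differentiableOn_deriv_snd hO (hΦ s hs)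
    by_cases hacc' : AccPt p (𝓟 {q | q ∈ O ∧ ∀ h ∈ insert s' Φ, h q = 0})
    · obtain ⟨a₀, r, β, hr, hβ, h⟩ := ih hO (Φ := insert s' Φ)
        (fun h hh => hh.elim (fun e => e ▸ hs'd) (hΦ h)) (mem_insert s' Φ) hp hacc' hm'
      exact ⟨a₀, r, β, hr, hβ, fun a ha => ⟨(h a ha).1, fun g hg => (h a ha).2 g (Or.inr hg)⟩⟩
    rw [accPt_iff_frequently_nhdsNE, not_frequently, eventually_nhdsWithin_iff,
      _root_.eventually_nhds_iff] at hacc'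
    obtain ⟨U, hU, hUo, hpU⟩ := hacc'
    have hOU : IsOpen (O ∩ U) := hO.inter hUo
    have hne : ∀ᶠ w in 𝓝[≠] p.2, s (p.1, w) ≠ 0 := by
      refine han.eventually_eq_zero_or_eventually_ne_zero.resolve_left fun h => ?_
      rw [← analyticOrderAt_eq_top, hm] at h
      exact ENat.natCast_ne_top _ h
    obtain ⟨ρ, hρ, δ, hδ, hsub, hsph, hcen⟩ := exists_polydisc hOU
      ((hΦ s hs).continuousOn.mono inter_subset_left) ⟨hp, hpU⟩ hne
    obtain ⟨Ψ, hΨ, helim⟩ := exists_elimination hOU ((hΦ s hs).mono inter_subset_left)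
      (Ω := ball p.1 δ) isOpen_ball (convex_ball _ _).isPreconnected hρ hsub hsph Φ
      fun h hh => (hΦ h hh).mono inter_subset_left
    -- The only common zero over `p.1` in the disc is `p`, so the projections of the accumulating
    -- zeros accumulate at `p.1` as well.
    have hΨ0 : ∀ N ∈ Ψ, ∀ a ∈ ball p.1 δ, N a = 0 := by
      intro N hN a ha
      refine ((hΨ N hN).analyticOnNhd isOpen_ball).eqOn_zero_of_preconnected_of_frequently_eq_zero
        (convex_ball _ _).isPreconnected (mem_ball_self hδ) ?_ ha
      rw [accPt_iff_frequently_nhdsNE, frequently_nhdsWithin_iff] at hacc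
      have hnear : ∀ᶠ q in 𝓝 p, q.1 ∈ ball p.1 δ ∧ q.2 ∈ ball p.2 ρ :=
        prod_mem_nhds (ball_mem_nhds _ hδ) (ball_mem_nhds _ hρ)
      rw [frequently_nhdsWithin_iff]
      refine (continuous_fst.tendsto p).frequently ((hacc.and_eventually hnear).mono ?_)
      rintro q ⟨⟨⟨-, hq⟩, hqp⟩, hq1, hq2⟩
      refine ⟨(helim q.1 hq1).1 ⟨q.2, hq2, hq s hs, hq⟩ N hN, fun h1 => ?_⟩
      have h1' : q.1 = p.1 := h1
      have h2 : q.2 ≠ p.2 := fun h2 => hqp (Prod.ext h1' h2)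
      refine hcen q.2 (ball_subset_closedBall hq2) h2 ?_
      rw [← h1']; exact hq s hs
    have hex : ∀ a ∈ ball p.1 δ, ∃ w ∈ ball p.2 ρ, ∀ h ∈ Φ, h (a, w) = 0 := by
      intro a ha
      obtain ⟨w, hw, -, h⟩ := (helim a ha).2 fun N hN => hΨ0 N hN a ha
      exact ⟨w, hw, h⟩
    -- A closed disc of base points away from `p.1`: zeros exist over all of them, so they
    -- accumulate at some point other than `p`.
    set a₁ : ℂ := p.1 + (δ / 2 : ℝ) with ha₁
    have hK : ∀ a ∈ closedBall a₁ (δ / 4), a ∈ ball p.1 δ ∧ a ≠ p.1 := by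
      intro a ha
      have h1 : dist a₁ p.1 = δ / 2 := by
        rw [ha₁, dist_eq_norm, add_sub_cancel_left, Complex.norm_real, Real.norm_eq_abs,
          abs_of_pos (by positivity)]
      rw [mem_closedBall] at ha
      constructor
      · rw [mem_ball]
        have := dist_triangle a a₁ p.1
        linarith
      · rintro rfl
        rw [dist_comm] at ha
        linarith
    have hinf : {q : ℂ × ℂ | q.1 ∈ closedBall a₁ (δ / 4) ∧ q.2 ∈ closedBall p.2 ρ ∧
        ∀ h ∈ Φ, h q = 0}.Infinite := by
      refine Set.Infinite.of_image Prod.fst ((infinite_of_mem_nhds a₁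
        (closedBall_mem_nhds a₁ (by positivity : 0 < δ / 4))).mono ?_)
      intro a ha
      obtain ⟨w, hw, h⟩ := hex a (hK a ha).1
      exact ⟨(a, w), ⟨ha, ball_subset_closedBall hw, h⟩, rfl⟩
    obtain ⟨z, hz, hzacc⟩ := hinf.exists_accPt_of_subset_isCompact
      ((isCompact_closedBall a₁ (δ / 4)).prod (isCompact_closedBall p.2 ρ))
      fun q hq => ⟨hq.1, hq.2.1⟩
    have hzO := hsub z.1 (hK z.1 hz.1).1 z.2 hz.2
    have hzacc' : AccPt z (𝓟 {q | q ∈ O ∧ ∀ h ∈ Φ, h q = 0}) :=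
      hzacc.mono (principal_mono.2 fun q hq =>
        ⟨(hsub q.1 (hK q.1 hq.1).1 q.2 hq.2.1).1, hq.2.2⟩)
    have hz0 : ∀ h ∈ Φ, h z = 0 := by
      intro h hh
      by_contra hne
      rw [accPt_iff_frequently_nhdsNE] at hzacc
      exact (hzacc.filter_mono nhdsWithin_le_nhds) (((hΦ h hh).continuousOn.continuousAt
        (hO.mem_nhds hzO.1)).eventually_ne hne |>.mono fun q hq hq' => hq (hq'.2.2 h hh))
    refine exists_graph_of_deriv_ne_zero hO hΦ hs hzO.1 hzacc' fun h0 => ?_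
    refine hU z hzO.2 (fun h => (hK z.1 hz.1).2 (congrArg Prod.fst h)) ⟨hzO.1, fun h hh => ?_⟩
    exact hh.elim (fun e => e ▸ h0) (hz0 h)

end LocalAnalytic

/-! ### Non-isolated points in the fibres of a modification -/

section FiberIsolated

open Metric Filter

theorem exists_linear_coordinates {v : C2} (hv : v ≠ 0) :
    ∃ L : (ℂ × ℂ) ≃L[ℂ] C2, ∀ b : ℂ, L (0, b) = b • v := by
  obtain ⟨A, hA⟩ := SeparatingDual.exists_continuousLinearEquiv_apply_eq (R := ℂ) (V := C2)
    (x := ((0, 1) : C2)) (y := v) (by simp) hv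
  refine ⟨A, fun b => ?_⟩
  rw [← hA, ← map_smul]
  simp

/-- If `f` does not vanish at a point of a ball, then it has finite vanishing order at the center
along the line through that point. -/
theorem eventually_ne_zero_on_line {f : C2 → ℂ} {x₀ x₁ : C2} {r : ℝ}
    (hf : DifferentiableOn ℂ f (ball x₀ r)) (hx₁ : x₁ ∈ ball x₀ r) (hne : f x₁ ≠ 0) :
    ∀ᶠ b : ℂ in 𝓝[≠] 0, f (x₀ + b • (x₁ - x₀)) ≠ 0 := by
  have hr : 0 < r := dist_nonneg.trans_lt hx₁
  set l : ℂ → C2 := fun b => x₀ + b • (x₁ - x₀) with hl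
  have hld : Differentiable ℂ l := by fun_prop
  have hV : IsOpen (l ⁻¹' ball x₀ r) := isOpen_ball.preimage hld.continuous
  have hV' : l ⁻¹' ball x₀ r = {b | ‖b‖ * ‖x₁ - x₀‖ < r} := by
    ext b
    simp [hl, dist_eq_norm, norm_smul]
  have hconv : Convex ℝ (l ⁻¹' ball x₀ r) := by
    rw [hV']
    intro a ha b hb s t hs ht hst
    have h1 : ‖s • a + t • b‖ ≤ s * ‖a‖ + t * ‖b‖ := by
      refine (norm_add_le _ _).trans ?_
      rw [norm_smul, norm_smul, Real.norm_of_nonneg hs, Real.norm_of_nonneg ht]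
    have ha' : ‖a‖ * ‖x₁ - x₀‖ < r := ha
    have hb' : ‖b‖ * ‖x₁ - x₀‖ < r := hb
    change ‖s • a + t • b‖ * ‖x₁ - x₀‖ < r
    have h2 : ‖s • a + t • b‖ * ‖x₁ - x₀‖ ≤ (s * ‖a‖ + t * ‖b‖) * ‖x₁ - x₀‖ :=
      mul_le_mul_of_nonneg_right h1 (norm_nonneg _)
    have h3 : s * (‖a‖ * ‖x₁ - x₀‖) + t * (‖b‖ * ‖x₁ - x₀‖) < r := by
      have hc := (convex_Iio r) (mem_Iio.2 ha') (mem_Iio.2 hb') hs ht hst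
      simpa using hc
    nlinarith
  have han : AnalyticOnNhd ℂ (f ∘ l) (l ⁻¹' ball x₀ r) :=
    (hf.comp hld.differentiableOn (mapsTo_preimage _ _)).analyticOnNhd hV
  have h0 : (0 : ℂ) ∈ l ⁻¹' ball x₀ r := by simp [hl, hr]
  have h1 : (1 : ℂ) ∈ l ⁻¹' ball x₀ r := by simpa [hl] using hx₁
  refine (han 0 h0).eventually_eq_zero_or_eventually_ne_zero.resolve_left fun h => hne ?_
  have := han.eqOn_zero_of_preconnected_of_eventuallyEq_zero hconv.isPreconnected h0 h h1
  simpa [hl] using this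

/-- A holomorphic function whose zeros accumulate at every point of the hypersurface `u = 0` is
divisible by all powers of `u`, provided that the same is true for its quotients. -/
theorem eventually_zero_of_frequently_zero {E : Type*} [NormedAddCommGroup E] [NormedSpace ℂ E]
    {f : E × ℂ → ℂ} {O : Set (E × ℂ)} (hO : IsOpen O) (hf : DifferentiableOn ℂ f O)
    (hz : ∀ z, (z, (0 : ℂ)) ∈ O → ∃ᶠ p in 𝓝 (z, (0 : ℂ)), f p = 0 ∧ p.2 ≠ 0) {z : E}
    (hzO : (z, (0 : ℂ)) ∈ O) : ∀ᶠ u in 𝓝 (0 : ℂ), f (z, u) = 0 := by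
  have key : ∀ m : ℕ, ∃ g : E × ℂ → ℂ, DifferentiableOn ℂ g O ∧ ∀ p ∈ O, f p = p.2 ^ m * g p := by
    intro m
    induction m with
    | zero => exact ⟨f, hf, by simp⟩
    | succ m ih =>
      obtain ⟨g, hg, hfg⟩ := ih
      obtain ⟨g', hg', hgg'⟩ := exists_eq_snd_mul hO hg fun z hzO => by
        by_contra hne
        have h1 := (hg.continuousOn.continuousAt (hO.mem_nhds hzO)).eventually_ne hne
        refine hz z hzO ?_
        filter_upwards [h1, hO.mem_nhds hzO] with p hp hpO ⟨h0, h2⟩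
        rw [hfg p hpO] at h0
        exact hp ((mul_eq_zero.1 h0).resolve_left (pow_ne_zero _ h2))
      exact ⟨g', hg', fun p hp => by rw [hfg p hp, hgg' p hp, pow_succ, mul_assoc]⟩
  have hV : IsOpen {u : ℂ | (z, u) ∈ O} := hO.preimage (by fun_prop)
  have hslice : ∀ g : E × ℂ → ℂ, DifferentiableOn ℂ g O → AnalyticAt ℂ (fun u => g (z, u)) 0 :=
    fun g hg => DifferentiableOn.analyticAt (s := {u : ℂ | (z, u) ∈ O})
      (hg.comp (by fun_prop) fun u hu => hu) (hV.mem_nhds hzO)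
  rw [← analyticOrderAt_eq_top, ENat.eq_top_iff_forall_ge]
  intro m
  obtain ⟨g, hg, hfg⟩ := key m
  rw [natCast_le_analyticOrderAt (hslice f hf)]
  refine ⟨fun u => g (z, u), hslice g hg, ?_⟩
  filter_upwards [hV.mem_nhds hzO] with u hu
  rw [hfg _ hu]
  simp

/-- Suppose non-isolated fibre points accumulate at `(η₀, ξ₀)` from other fibres. Eliminating one
direction of `η` shows that their base points lie in an analytic set `T ⊆ S`, so `T` contains a
holomorphic curve. Since `Γ` is the closure of its part off `S`, the eliminants also have zeros
arbitrarily close to that curve but off it. This forces them to vanish on an open set, which would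
then lie in `S`. -/
theorem eventually_isolated_fiber {O : Set (C2 × C2)} (hO : IsOpen O) {ι : Type*}
    {F : ι → C2 × C2 → ℂ} (hF : ∀ i, DifferentiableOn ℂ (F i) O) {Γ : Set (C2 × C2)}
    (hΓ : ∀ p ∈ O, p ∈ Γ ↔ ∀ i, F i p = 0) {S : Set C2} (hS : interior S = ∅)
    (hcl : ∀ p ∈ O, p ∈ Γ → p ∈ closure {q | q ∈ Γ ∧ q.2 ∉ S})
    (hinj : ∀ p ∈ O, ∀ q ∈ O, p ∈ Γ → q ∈ Γ → p.2 ∉ S → p.2 = q.2 → p = q)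
    {η₀ ξ₀ : C2} (h₀ : (η₀, ξ₀) ∈ O) (hprop : ∃ᶠ η in 𝓝 η₀, (η, ξ₀) ∉ Γ) :
    ∀ᶠ p in 𝓝 (η₀, ξ₀), p ∈ Γ → p.2 ≠ ξ₀ → ∀ᶠ η in 𝓝[≠] p.1, (η, p.2) ∉ Γ := by
  by_contra hcon
  have hfreq : ∃ᶠ p in 𝓝 (η₀, ξ₀), p ∈ Γ ∧ p.2 ≠ ξ₀ ∧ ∃ᶠ η in 𝓝[≠] p.1, (η, p.2) ∈ Γ := by
    refine (Filter.not_eventually.1 hcon).mono fun p hp => ?_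
    simp only [Classical.not_imp, Filter.not_eventually, not_not] at hp
    exact hp
  have hFc : ∀ i, ∀ p ∈ O, ContinuousAt (F i) p := fun i p hp =>
    (hF i).continuousOn.continuousAt (hO.mem_nhds hp)
  have h₀Γ : (η₀, ξ₀) ∈ Γ := by
    rw [hΓ _ h₀]
    by_contra hne
    push Not at hne
    obtain ⟨i, hi⟩ := hne
    refine hfreq ?_
    filter_upwards [(hFc i _ h₀).eventually_ne hi, hO.mem_nhds h₀] with p hp hpO hp'
    exact hp ((hΓ p hpO).1 hp'.1 i)
  obtain ⟨r, hr, hball⟩ := Metric.mem_nhds_iff.1 (hO.mem_nhds h₀)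
  have hballO : ∀ η ∈ ball η₀ r, (η, ξ₀) ∈ O := fun η hη => hball (by
    rw [mem_ball, Prod.dist_eq]; simpa [hr] using hη)
  obtain ⟨η₁, hη₁Γ, hη₁⟩ := (hprop.and_eventually (ball_mem_nhds η₀ hr)).exists
  obtain ⟨i, hi⟩ : ∃ i, F i (η₁, ξ₀) ≠ 0 := by
    rw [hΓ _ (hballO η₁ hη₁)] at hη₁Γ
    push Not at hη₁Γ
    exact hη₁Γ
  -- The direction of elimination: `F i` does not vanish identically along it over `ξ₀`, so it has
  -- finitely many roots there.
  have hv : η₁ - η₀ ≠ 0 := by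
    rw [sub_ne_zero]
    rintro rfl
    exact hη₁Γ h₀Γ
  obtain ⟨L, hL⟩ := exists_linear_coordinates hv
  set A : (ℂ × C2) × ℂ → C2 × C2 := fun q => (η₀ + L (q.1.1, q.2), q.1.2) with hA
  have hAd : Differentiable ℂ A := by fun_prop
  have hO₁ : IsOpen (A ⁻¹' O) := hO.preimage hAd.continuous
  have hFA : ∀ j, DifferentiableOn ℂ (F j ∘ A) (A ⁻¹' O) := fun j =>
    (hF j).comp hAd.differentiableOn (mapsTo_preimage _ _)
  have hA0 : A ((0, ξ₀), 0) = (η₀, ξ₀) := by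
    simp only [hA]
    rw [hL]; simp
  have hne0 : ∀ᶠ w in 𝓝[≠] (0 : ℂ), (F i ∘ A) ((0, ξ₀), w) ≠ 0 := by
    have h1 : DifferentiableOn ℂ (fun η => F i (η, ξ₀)) (ball η₀ r) :=
      (hF i).comp (by fun_prop) hballO
    have h2 := eventually_ne_zero_on_line h1 hη₁ hi
    filter_upwards [h2] with w hw
    simpa only [hA, Function.comp, hL] using hw
  obtain ⟨ρ, hρ, δ, hδ, hsub, hsph, -⟩ := exists_polydisc (p := (((0 : ℂ), ξ₀), (0 : ℂ))) hO₁
    (hFA i).continuousOn (by rw [mem_preimage, hA0]; exact h₀) hne0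
  simp only at hsub hsph
  obtain ⟨Ψ, hΨ, helim⟩ := exists_elimination hO₁ (hFA i) (Ω := ball ((0 : ℂ), ξ₀) δ) isOpen_ball
    (convex_ball _ _).isPreconnected hρ hsub hsph (range fun j => F j ∘ A) (by
      rintro _ ⟨j, rfl⟩; exact hFA j)
  have helim' : ∀ c ∈ ball (0 : ℂ) δ, ∀ ξ ∈ ball ξ₀ δ,
      (∃ w ∈ ball (0 : ℂ) ρ, A ((c, ξ), w) ∈ O ∧ A ((c, ξ), w) ∈ Γ) ↔ ∀ N ∈ Ψ, N (c, ξ) = 0 := by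
    intro c hc ξ hξ
    have hcξ : (c, ξ) ∈ ball ((0 : ℂ), ξ₀) δ := by
      rw [mem_ball, Prod.dist_eq]; exact max_lt hc hξ
    rw [← helim (c, ξ) hcξ]
    constructor
    · rintro ⟨w, hw, hwO, hwΓ⟩
      have := (hΓ _ hwO).1 hwΓ
      refine ⟨w, hw, this i, ?_⟩
      rintro _ ⟨j, rfl⟩
      exact this j
    · rintro ⟨w, hw, -, h⟩
      have hwO := hsub _ hcξ w (ball_subset_closedBall hw)
      exact ⟨w, hw, hwO, (hΓ _ hwO).2 fun j => h _ ⟨j, rfl⟩⟩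
  have hΨξ : ∀ N ∈ Ψ, ∀ ξ ∈ ball ξ₀ δ, DifferentiableOn ℂ (fun c => N (c, ξ)) (ball 0 δ) :=
    fun N hN ξ hξ => (hΨ N hN).comp (by fun_prop) fun c hc => by
      rw [mem_ball, Prod.dist_eq]; exact max_lt hc hξ
  have hΨc : ∀ N ∈ Ψ, ∀ c ∈ ball (0 : ℂ) δ, DifferentiableOn ℂ (fun ξ => N (c, ξ)) (ball ξ₀ δ) :=
    fun N hN c hc => (hΨ N hN).comp (by fun_prop) fun ξ hξ => by
      rw [mem_ball, Prod.dist_eq]; exact max_lt hc hξ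
  -- coordinates of points near the base point
  set B : C2 × C2 → (ℂ × C2) × ℂ := fun p =>
    (((L.symm (p.1 - η₀)).1, p.2), (L.symm (p.1 - η₀)).2) with hB
  have hAB : ∀ p, A (B p) = p := by
    intro p
    simp only [hA, hB, Prod.mk.eta, L.apply_symm_apply, add_sub_cancel]
  have hBA : ∀ q, B (A q) = q := by
    intro q
    simp [hA, hB]
  have hBc : Continuous B := by fun_prop
  have hnear : ∀ᶠ p in 𝓝 (η₀, ξ₀), (B p).1.1 ∈ ball (0 : ℂ) δ ∧ p.2 ∈ ball ξ₀ δ ∧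
      (B p).2 ∈ ball (0 : ℂ) ρ := by
    have h1 : Tendsto B (𝓝 (η₀, ξ₀)) (𝓝 ((0, ξ₀), 0)) := by
      have := hBc.tendsto (A ((0, ξ₀), 0))
      rwa [hBA, hA0] at this
    have h2 := h1.eventually (prod_mem_nhds (prod_mem_nhds (ball_mem_nhds (0 : ℂ) hδ)
      (ball_mem_nhds ξ₀ hδ)) (ball_mem_nhds (0 : ℂ) hρ))
    filter_upwards [h2] with p hp using ⟨hp.1.1, hp.1.2, hp.2⟩
  -- The base points whose fibre projects onto the whole disc of the remaining coordinate `c`.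
  set T : Set C2 := {ξ | ξ ∈ ball ξ₀ δ ∧ ∀ N ∈ Ψ, ∀ c ∈ ball (0 : ℂ) δ, N (c, ξ) = 0} with hT
  have hbad : ∀ p, p ∈ Γ → (B p).1.1 ∈ ball (0 : ℂ) δ → p.2 ∈ ball ξ₀ δ →
      (B p).2 ∈ ball (0 : ℂ) ρ → (∃ᶠ η in 𝓝[≠] p.1, (η, p.2) ∈ Γ) → p.2 ∈ T := by
    intro p hpΓ hc hξ hw hfr
    refine ⟨hξ, fun N hN c' hc' => ?_⟩
    refine ((hΨξ N hN p.2 hξ).analyticOnNhd isOpen_ball).eqOn_zero_of_preconnected_of_frequently_eq_zero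
      (convex_ball _ _).isPreconnected hc ?_ hc'
    have h1 : ∀ᶠ η in 𝓝 p.1, (B (η, p.2)).1.1 ∈ ball (0 : ℂ) δ ∧ (B (η, p.2)).2 ∈ ball (0 : ℂ) ρ :=
      ((continuous_fst.comp (continuous_fst.comp (hBc.comp (by fun_prop :
        Continuous fun η => (η, p.2))))).continuousAt.eventually_mem (isOpen_ball.mem_nhds hc)).and
      ((continuous_snd.comp (hBc.comp (by fun_prop :
        Continuous fun η => (η, p.2)))).continuousAt.eventually_mem (isOpen_ball.mem_nhds hw))
    have hcξ : ((B p).1.1, p.2) ∈ ball ((0 : ℂ), ξ₀) δ := by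
      rw [mem_ball, Prod.dist_eq]; exact max_lt hc hξ
    -- the zeros of the first equation over the same base point are isolated
    have hiso : ∀ᶠ w in 𝓝[≠] (B p).2, (F i ∘ A) (((B p).1.1, p.2), w) ≠ 0 := by
      have hfin := finite_zeros_closedBall (f := fun w => (F i ∘ A) (((B p).1.1, p.2), w))
        (V := {w | (((B p).1.1, p.2), w) ∈ A ⁻¹' O}) (c := 0) (ρ := ρ)
        (hO₁.preimage (by fun_prop)) ((hFA i).comp (by fun_prop) fun w hw => hw)
        (hsub _ hcξ) (z₁ := (ρ : ℂ)) (by simp [abs_of_pos hρ])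
        (hsph _ hcξ _ (by simp [abs_of_pos hρ]))
      have h2 := (hfin.subset (sdiff_subset (t := {(B p).2}))).isClosed.isOpen_compl.mem_nhds
        (x := (B p).2) (by simp)
      rw [eventually_nhdsWithin_iff]
      filter_upwards [h2, isOpen_ball.mem_nhds hw] with w hw1 hw2 hw3 hw4
      exact hw1 ⟨⟨ball_subset_closedBall hw2, hw4⟩, hw3⟩
    rw [frequently_nhdsWithin_iff] at hfr ⊢
    have hcont1 : Tendsto (fun η => (B (η, p.2)).1.1) (𝓝 p.1) (𝓝 (B p).1.1) := by
      have : Continuous (fun η => (B (η, p.2)).1.1) := by fun_prop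
      exact this.tendsto p.1
    have hcont2 : Tendsto (fun η => (B (η, p.2)).2) (𝓝 p.1) (𝓝 (B p).2) := by
      have : Continuous (fun η => (B (η, p.2)).2) := by fun_prop
      exact this.tendsto p.1
    rw [eventually_nhdsWithin_iff] at hiso
    refine hcont1.frequently ((hfr.and_eventually (h1.and (hcont2.eventually hiso))).mono ?_)
    rintro η ⟨⟨hηΓ, hηne⟩, ⟨hηc, hηw⟩, hηiso⟩
    have hmem : A (((B (η, p.2)).1.1, p.2), (B (η, p.2)).2) = (η, p.2) := hAB (η, p.2)
    have hmemO : A (((B (η, p.2)).1.1, p.2), (B (η, p.2)).2) ∈ O :=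
      hsub ((B (η, p.2)).1.1, p.2) (by rw [mem_ball, Prod.dist_eq]; exact max_lt hηc hξ) _
        (ball_subset_closedBall hηw)
    refine ⟨(helim' _ hηc _ hξ).1 ⟨_, hηw, hmemO, by rwa [hmem]⟩ N hN, fun heq => ?_⟩
    have heq' : (B (η, p.2)).1.1 = (B p).1.1 := heq
    have hw' : (B (η, p.2)).2 ≠ (B p).2 := by
      intro h
      apply hηne
      have : B (η, p.2) = B p := Prod.ext (Prod.ext heq' rfl) h
      have := congrArg A this
      rw [hAB, hAB] at this
      exact congrArg Prod.fst this
    refine hηiso hw' ?_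
    rw [← heq', Function.comp_apply, hmem]
    rw [hmem] at hmemO
    exact (hΓ _ hmemO).1 hηΓ i
  -- A fibre over `T` has points with two different `c`-coordinates, here 0 and `δ / 2`, while a
  -- fibre off `S` has at most one point in `O`.
  have hTS : T ⊆ S := by
    rintro ξ ⟨hξ, hξT⟩
    by_contra hξS
    have hδ2 : ((δ / 2 : ℝ) : ℂ) ∈ ball (0 : ℂ) δ := by
      rw [mem_ball, dist_zero_right, Complex.norm_real, Real.norm_eq_abs, abs_of_pos (by positivity)]
      linarith
    obtain ⟨w₁, -, h1O, h1⟩ := (helim' 0 (mem_ball_self hδ) ξ hξ).2 fun N hN =>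
      hξT N hN 0 (mem_ball_self hδ)
    obtain ⟨w₂, -, h2O, h2⟩ := (helim' _ hδ2 ξ hξ).2 fun N hN => hξT N hN _ hδ2
    have := hinj _ h1O _ h2O h1 h2 hξS rfl
    have := congrArg (fun q => (B q).1.1) this
    simp only [hBA] at this
    have h3 : (δ / 2 : ℝ) = 0 := by exact_mod_cast this.symm
    linarith
  have hTacc : ∃ᶠ ξ in 𝓝[≠] ξ₀, ξ ∈ T := by
    rw [frequently_nhdsWithin_iff]
    refine ((continuous_snd.tendsto (η₀, ξ₀)).frequently
      ((hfreq.and_eventually hnear).mono ?_))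
    rintro p ⟨⟨hpΓ, hpne, hpfr⟩, hc, hξ, hw⟩
    exact ⟨hbad p hpΓ hc hξ hw hpfr, hpne⟩
  have hξT : ξ₀ ∈ T := by
    refine ⟨mem_ball_self hδ, fun N hN c hc => ?_⟩
    by_contra hne
    have h1 := ((hΨc N hN c hc).continuousOn.continuousAt (ball_mem_nhds ξ₀ hδ)).eventually_ne hne
    exact (hTacc.filter_mono nhdsWithin_le_nhds) (h1.mono fun ξ hξ hξT => hξ (hξT.2 N hN c hc))
  -- points outside `S` are dense
  have hdense : ∀ U : Set C2, IsOpen U → U.Nonempty → ∃ ξ ∈ U, ξ ∉ S := by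
    intro U hU hUn
    by_contra hcon
    push Not at hcon
    have : U ⊆ interior S := interior_maximal hcon hU
    rw [hS] at this
    exact hUn.ne_empty (subset_empty_iff.1 this)
  obtain ⟨ξ₁, hξ₁, hξ₁S⟩ := hdense (ball ξ₀ δ) isOpen_ball ⟨ξ₀, mem_ball_self hδ⟩
  obtain ⟨N₁, hN₁, c₁, hc₁, hN₁ne⟩ : ∃ N ∈ Ψ, ∃ c ∈ ball (0 : ℂ) δ, N (c, ξ₁) ≠ 0 := by
    by_contra hcon
    push Not at hcon
    exact hξ₁S (hTS ⟨hξ₁, hcon⟩)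
  -- Coordinates in the base with last axis towards `ξ₁`: along it the equation `N₁ (c₁, ·)` of `T`
  -- has finite order at `ξ₀`.
  have hv' : ξ₁ - ξ₀ ≠ 0 := by
    rw [sub_ne_zero]
    rintro rfl
    exact hN₁ne (hξT.2 N₁ hN₁ c₁ hc₁)
  obtain ⟨L', hL'⟩ := exists_linear_coordinates hv'
  set X : ℂ × ℂ → C2 := fun q => ξ₀ + L' q with hX
  have hXd : Differentiable ℂ X := by fun_prop
  have hO₂ : IsOpen (X ⁻¹' ball ξ₀ δ) := isOpen_ball.preimage hXd.continuous
  set Φ : Set (ℂ × ℂ → ℂ) := {g | ∃ N ∈ Ψ, ∃ c ∈ ball (0 : ℂ) δ, g = fun q => N (c, X q)} with hΦ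
  have hX0 : X (0, 0) = ξ₀ := by simp only [hX]; rw [hL']; simp
  have hacc : AccPt ((0 : ℂ), (0 : ℂ)) (𝓟 {q | q ∈ X ⁻¹' ball ξ₀ δ ∧ ∀ h ∈ Φ, h q = 0}) := by
    rw [accPt_iff_frequently_nhdsNE, frequently_nhdsWithin_iff]
    rw [frequently_nhdsWithin_iff] at hTacc
    have htend : Tendsto (fun ξ => L'.symm (ξ - ξ₀)) (𝓝 ξ₀) (𝓝 ((0 : ℂ), (0 : ℂ))) := by
      have : Continuous (fun ξ => L'.symm (ξ - ξ₀)) := by fun_prop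
      have := this.tendsto ξ₀
      rwa [sub_self, map_zero] at this
    refine htend.frequently (hTacc.mono ?_)
    rintro ξ ⟨hξ, hξne⟩
    have hXξ : X (L'.symm (ξ - ξ₀)) = ξ := by simp [hX]
    refine ⟨⟨by rw [mem_preimage, hXξ]; exact hξ.1, ?_⟩, fun h => hξne ?_⟩
    · rintro _ ⟨N, hN, c, hc, rfl⟩
      simp only [hXξ]
      exact hξ.2 N hN c hc
    · have h' : L'.symm (ξ - ξ₀) = (0, 0) := h
      rw [← hXξ, h', hX0]
      rfl
  set s : ℂ × ℂ → ℂ := fun q => N₁ (c₁, X q) with hs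
  have hsne : ∀ᶠ b in 𝓝[≠] (0 : ℂ), s (0, b) ≠ 0 := by
    filter_upwards [eventually_ne_zero_on_line (hΨc N₁ hN₁ c₁ hc₁) hξ₁ hN₁ne] with b hb
    simpa only [hs, hX, hL'] using hb
  have horder : ∃ m : ℕ, analyticOrderAt (fun b => s ((0 : ℂ), b)) 0 = m := by
    refine ENat.ne_top_iff_exists.1 (fun h => ?_) |>.imp fun m hm => hm.symm
    rw [analyticOrderAt_eq_top] at h
    obtain ⟨b, hb1, hb2⟩ := ((h.filter_mono nhdsWithin_le_nhds).and hsne).exists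
    exact hb2 hb1
  obtain ⟨m, hm⟩ := horder
  obtain ⟨a₀, r', β, hr', hβ, hgraph⟩ := exists_graph_of_accPt m hO₂ (Φ := Φ) (by
      rintro _ ⟨N, hN, c, hc, rfl⟩
      exact (hΨc N hN c hc).comp hXd.differentiableOn (mapsTo_preimage _ _))
    (s := s) ⟨N₁, hN₁, c₁, hc₁, rfl⟩ (p := (0, 0)) (by
      rw [mem_preimage, hX0]; exact mem_ball_self hδ) hacc hm
  have hgT : ∀ a ∈ ball a₀ r', X (a, β a) ∈ T := fun a ha =>
    ⟨(hgraph a ha).1, fun N hN c hc => (hgraph a ha).2 _ ⟨N, hN, c, hc, rfl⟩⟩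
  -- all eliminants vanish near the graph
  set Y : (ℂ × ℂ) × ℂ → ℂ × C2 := fun q => (q.1.1, X (q.1.2, β q.1.2 + q.2)) with hY
  set D : Set ((ℂ × ℂ) × ℂ) := {q | q.1.2 ∈ ball a₀ r'} with hD
  have hDo : IsOpen D := isOpen_ball.preimage (by fun_prop)
  have hβd : ∀ q ∈ D, DifferentiableAt ℂ (fun q : (ℂ × ℂ) × ℂ => β q.1.2) q := by
    intro q hq
    have h1 : DifferentiableAt ℂ (fun q : (ℂ × ℂ) × ℂ => q.1.2) q := by fun_prop
    exact DifferentiableAt.comp q ((hβ _ hq).differentiableAt (isOpen_ball.mem_nhds hq)) h1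
  have hYd : DifferentiableOn ℂ Y D := by
    intro q hq
    have h1 := hβd q hq
    have h2 : DifferentiableAt ℂ (fun q : (ℂ × ℂ) × ℂ => (q.1.2, β q.1.2 + q.2)) q :=
      DifferentiableAt.prodMk (by fun_prop) (h1.add differentiableAt_snd)
    have h3 : DifferentiableAt ℂ (fun q : (ℂ × ℂ) × ℂ => X (q.1.2, β q.1.2 + q.2)) q :=
      (hXd _).comp q h2
    have h4 : DifferentiableAt ℂ (fun q : (ℂ × ℂ) × ℂ => q.1.1) q := by fun_prop
    exact (h4.prodMk h3).differentiableWithinAt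
  have hO₃ : IsOpen (D ∩ Y ⁻¹' ball ((0 : ℂ), ξ₀) δ) :=
    hYd.continuousOn.isOpen_inter_preimage hDo isOpen_ball
  -- In the coordinates `((c, a), u)` the curve in `T` is `u = 0`. Over each of its points lies a
  -- point of `Γ`, a limit of points of `Γ` off `S ⊇ T`; these have `u ≠ 0`, and all eliminants
  -- vanish there.
  have hvan : ∀ N ∈ Ψ, ∀ c ∈ ball (0 : ℂ) δ, ∀ a ∈ ball a₀ r',
      ∀ᶠ u in 𝓝 (0 : ℂ), N (Y ((c, a), u)) = 0 := by
    intro N hN c hc a ha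
    refine eventually_zero_of_frequently_zero (f := N ∘ Y) hO₃
      ((hΨ N hN).comp (hYd.mono inter_subset_left) fun q hq => hq.2) ?_ (z := (c, a)) ?_
    · rintro ⟨c, a⟩ ⟨ha, hca⟩
      have ha' : a ∈ ball a₀ r' := ha
      have hY0 : Y ((c, a), 0) = (c, X (a, β a)) := by simp [hY]
      rw [mem_preimage, hY0, mem_ball, Prod.dist_eq, max_lt_iff] at hca
      have hc : c ∈ ball (0 : ℂ) δ := hca.1
      have hTa := hgT a ha'
      obtain ⟨w, hw, hwO, hwΓ⟩ := (helim' c hc _ hTa.1).2 fun N hN => hTa.2 N hN c hc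
      have hclos := hcl _ hwO hwΓ
      rw [mem_closure_iff_frequently] at hclos
      set p₀ := A ((c, X (a, β a)), w) with hp₀
      -- coordinates adapted to the graph
      let G : C2 × C2 → (ℂ × ℂ) × ℂ := fun q =>
        (((B q).1.1, (L'.symm (q.2 - ξ₀)).1),
          (L'.symm (q.2 - ξ₀)).2 - β (L'.symm (q.2 - ξ₀)).1)
      have hp2 : L'.symm (p₀.2 - ξ₀) = (a, β a) := by simp [hp₀, hA, hX]
      have hGp : G p₀ = ((c, a), 0) := by
        simp only [G, hp2]
        rw [hp₀, hBA]
        simp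
      have hGc : ContinuousAt G p₀ := by
        have h1 : ContinuousAt (fun q : C2 × C2 => (L'.symm (q.2 - ξ₀)).1) p₀ := by fun_prop
        have h2 : ContinuousAt (fun q : C2 × C2 => β (L'.symm (q.2 - ξ₀)).1) p₀ := by
          refine ContinuousAt.comp (f := fun q : C2 × C2 => (L'.symm (q.2 - ξ₀)).1) (g := β) ?_ h1
          rw [hp2]
          exact hβ.continuousOn.continuousAt (isOpen_ball.mem_nhds ha')
        have h3 : ContinuousAt (fun q : C2 × C2 => (L'.symm (q.2 - ξ₀)).2) p₀ := by fun_prop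
        have h4 : ContinuousAt (fun q : C2 × C2 => (B q).1.1) p₀ := by fun_prop
        exact (h4.prodMk h1).prodMk (h3.sub h2)
      have hBp : B p₀ = ((c, X (a, β a)), w) := hBA _
      have hev : ∀ᶠ q in 𝓝 p₀, q ∈ O ∧ (B q).1.1 ∈ ball (0 : ℂ) δ ∧ q.2 ∈ ball ξ₀ δ ∧
          (B q).2 ∈ ball (0 : ℂ) ρ ∧ (L'.symm (q.2 - ξ₀)).1 ∈ ball a₀ r' := by
        have h1 : ContinuousAt (fun q : C2 × C2 => (L'.symm (q.2 - ξ₀)).1) p₀ := by fun_prop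
        have h4 : ContinuousAt (fun q : C2 × C2 => (B q).1.1) p₀ := by fun_prop
        have h5 : ContinuousAt (fun q : C2 × C2 => (B q).2) p₀ := by fun_prop
        refine (hO.eventually_mem hwO).and ((h4.eventually_mem (isOpen_ball.mem_nhds ?_)).and
          ((continuousAt_snd.eventually_mem (isOpen_ball.mem_nhds ?_)).and
          ((h5.eventually_mem (isOpen_ball.mem_nhds ?_)).and
          (h1.eventually_mem (isOpen_ball.mem_nhds ?_)))))
        · rw [hBp]; exact hc
        · exact hTa.1
        · rw [hBp]; exact hw
        · rw [hp2]; exact ha'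
      have htend : Tendsto G (𝓝 p₀) (𝓝 ((c, a), 0)) := by rw [← hGp]; exact hGc
      refine htend.frequently ((hclos.and_eventually hev).mono ?_)
      rintro q ⟨⟨hqΓ, hqS⟩, hqO, hqc, hqξ, hqw, hqa⟩
      have hXq : X (L'.symm (q.2 - ξ₀)) = q.2 := by simp [hX]
      have hYG : Y (G q) = ((B q).1.1, q.2) := by
        simp only [hY, G, add_sub_cancel]
        rw [Prod.mk.eta, hXq]
      refine ⟨?_, fun h0 => hqS (hTS ?_)⟩
      · rw [Function.comp_apply, hYG]
        refine (helim' _ hqc _ hqξ).1 ⟨(B q).2, hqw, ?_⟩ N hN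
        have : A (((B q).1.1, q.2), (B q).2) = q := hAB q
        rw [this]; exact ⟨hqO, hqΓ⟩
      · have h1 : (L'.symm (q.2 - ξ₀)).2 = β (L'.symm (q.2 - ξ₀)).1 := sub_eq_zero.1 h0
        have h2 := hgT _ hqa
        rwa [← h1, Prod.mk.eta, hXq] at h2
    · refine ⟨ha, ?_⟩
      have hY0 : Y ((c, a), 0) = (c, X (a, β a)) := by simp [hY]
      rw [mem_preimage, hY0, mem_ball, Prod.dist_eq]
      exact max_lt hc (hgraph a ha).1
  -- hence they vanish on an open set, which has to be contained in `S`
  set U : Set C2 := {ξ | ξ ∈ ball ξ₀ δ ∧ (L'.symm (ξ - ξ₀)).1 ∈ ball a₀ r'} with hU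
  have hUo : IsOpen U := isOpen_ball.inter (isOpen_ball.preimage (by fun_prop))
  obtain ⟨ξ, ⟨hξ, hξa⟩, hξS⟩ := hdense U hUo
    ⟨X (a₀, β a₀), (hgraph a₀ (mem_ball_self hr')).1, by simp [hX, hr']⟩
  refine hξS (hTS ⟨hξ, fun N hN c hc => ?_⟩)
  set a := (L'.symm (ξ - ξ₀)).1 with ha
  have hline : DifferentiableOn ℂ (fun b : ℂ => N (c, X (a, b))) {b | X (a, b) ∈ ball ξ₀ δ} :=
    (hΨc N hN c hc).comp (hXd.comp (by fun_prop)).differentiableOn fun b hb => hb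
  have hlo : IsOpen {b | X (a, b) ∈ ball ξ₀ δ} := isOpen_ball.preimage (by fun_prop)
  have hlc : Convex ℝ {b | X (a, b) ∈ ball ξ₀ δ} := by
    intro b hb b' hb' t t' ht ht' htt
    have : X (a, t • b + t' • b') = t • X (a, b) + t' • X (a, b') := by
      have h1 : ((a, t • b + t' • b') : ℂ × ℂ) = t • (a, b) + t' • (a, b') := by
        ext
        · simp [← add_mul, ← Complex.ofReal_add, htt]
        · simp
      have h2 : ξ₀ = t • ξ₀ + t' • ξ₀ := by rw [← add_smul, htt, one_smul]
      have h3 : ∀ (t : ℝ) (x : ℂ × ℂ), L' (t • x) = t • L' x := fun t x => by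
        have := L'.map_smul (t : ℂ) x
        rwa [Complex.coe_smul, Complex.coe_smul] at this
      simp only [hX]
      rw [h1, map_add, h3, h3, smul_add, smul_add]
      nth_rw 1 [h2]
      abel
    change X (a, t • b + t' • b') ∈ ball ξ₀ δ
    rw [this]
    exact convex_ball ξ₀ δ hb hb' ht ht' htt
  -- The identity theorem along the line of fixed `a` carries the vanishing from the curve to the
  -- whole slice of the ball.
  have hz := (hline.analyticOnNhd hlo).eqOn_zero_of_preconnected_of_eventuallyEq_zero
    hlc.isPreconnected (z₀ := β a) (hgraph a hξa).1 (by
      have htr : Tendsto (fun b => b - β a) (𝓝 (β a)) (𝓝 0) := by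
        have : Continuous (fun b => b - β a) := by fun_prop
        simpa using this.tendsto (β a)
      filter_upwards [htr.eventually (hvan N hN c hc a hξa)] with b hb
      simpa [hY] using hb) (x := (L'.symm (ξ - ξ₀)).2) (by
      change X (a, (L'.symm (ξ - ξ₀)).2) ∈ ball ξ₀ δ
      rw [ha, Prod.mk.eta]
      simpa [hX] using hξ)
  have hXξ : X (a, (L'.symm (ξ - ξ₀)).2) = ξ := by
    rw [ha, Prod.mk.eta]; simp [hX]
  have hz' : N (c, X (a, (L'.symm (ξ - ξ₀)).2)) = 0 := hz
  rwa [hXξ] at hz'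

end FiberIsolated

/-! ### Riemann's extension theorem -/

section RiemannExtension

open Metric Filter

/-- The zeros of `s` in the disc are finitely many, so the one-variable theorem on removable
singularities fills them in one by one. -/
theorem exists_extension_disc {s f : ℂ → ℂ} {V : Set ℂ} (hV : IsOpen V) (hs : DifferentiableOn ℂ s V)
    {c : ℂ} {ρ : ℝ} (hρ : 0 < ρ) (hsub : closedBall c ρ ⊆ V) (hsph : ∀ w ∈ sphere c ρ, s w ≠ 0)
    (hf : DifferentiableOn ℂ f {w ∈ V | s w ≠ 0}) {M : ℝ} (hM : ∀ w ∈ V, s w ≠ 0 → ‖f w‖ ≤ M) :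
    ∃ g : ℂ → ℂ, DifferentiableOn ℂ g (closedBall c ρ) ∧ ∀ w, s w ≠ 0 → g w = f w := by
  refine ⟨fun v => if s v = 0 then limUnder (𝓝[≠] v) f else f v, ?_, fun w hw => if_neg hw⟩
  have hpt : c + ρ ∈ sphere c ρ := by simp [abs_of_pos hρ]
  have hfin := finite_zeros_closedBall hV hs hsub (sphere_subset_closedBall hpt) (hsph _ hpt)
  have hO : IsOpen {w ∈ V | s w ≠ 0} := hs.continuousOn.isOpen_inter_preimage hV isOpen_ne
  intro v hv
  refine DifferentiableAt.differentiableWithinAt ?_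
  by_cases h0 : s v = 0
  · have hvb : v ∈ ball c ρ := by
      refine lt_of_le_of_ne hv fun h => hsph v h h0
    have hev : ∀ᶠ w in 𝓝[≠] v, s w ≠ 0 := by
      have h1 : ∀ᶠ w in 𝓝[≠] v, w ∉ {z ∈ closedBall c ρ | s z = 0} \ {v} :=
        nhdsWithin_le_nhds ((hfin.subset sdiff_subset).isClosed.isOpen_compl.mem_nhds
          (by simp))
      filter_upwards [h1, self_mem_nhdsWithin, nhdsWithin_le_nhds (isOpen_ball.mem_nhds hvb)]
        with w hw1 hw2 hw3 hw4
      exact hw1 ⟨⟨ball_subset_closedBall hw3, hw4⟩, hw2⟩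
    obtain ⟨ε, hε, hε'⟩ := Metric.mem_nhdsWithin_iff.1
      (hev.and (nhdsWithin_le_nhds (hV.mem_nhds (hsub hv))))
    have hsubd : ball v ε \ {v} ⊆ {w ∈ V | s w ≠ 0} := fun w hw =>
      ⟨(hε' hw).2, (hε' hw).1⟩
    have h2 := Complex.differentiableOn_update_limUnder_of_bddAbove (f := f)
      (ball_mem_nhds v hε) (hf.mono hsubd) ⟨M, by
        rintro _ ⟨w, hw, rfl⟩
        exact hM w (hsubd hw).1 (hsubd hw).2⟩
    refine (h2.differentiableAt (ball_mem_nhds v hε)).congr_of_eventuallyEq ?_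
    filter_upwards [ball_mem_nhds v hε] with w hw
    by_cases hwv : w = v
    · subst hwv
      simp [h0]
    · rw [Function.update_of_ne hwv, if_neg (hsubd ⟨hw, hwv⟩).2]
  · have hmem : v ∈ {w ∈ V | s w ≠ 0} := ⟨hsub hv, h0⟩
    refine (hf.differentiableAt (hO.mem_nhds hmem)).congr_of_eventuallyEq ?_
    filter_upwards [hO.mem_nhds hmem] with w hw
    exact if_neg hw.2

/-- The extension is the Cauchy integral over the boundary circle, where `s ≠ 0`. It is holomorphic
in all variables, and on each slice it reproduces the one-variable extension. -/
theorem exists_extension_polydisc {E : Type*} [NormedAddCommGroup E] [NormedSpace ℂ E]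
    {s f : E × ℂ → ℂ} {O : Set (E × ℂ)} (hO : IsOpen O) (hs : DifferentiableOn ℂ s O)
    {Ω : Set E} {c : ℂ} {ρ : ℝ} (hρ : 0 < ρ)
    (hsub : ∀ z ∈ Ω, ∀ w ∈ closedBall c ρ, (z, w) ∈ O)
    (hsph : ∀ z ∈ Ω, ∀ w ∈ sphere c ρ, s (z, w) ≠ 0)
    (hf : DifferentiableOn ℂ f {p ∈ O | s p ≠ 0}) {M : ℝ} (hM : ∀ p ∈ O, s p ≠ 0 → ‖f p‖ ≤ M) :
    ∃ g : E × ℂ → ℂ, DifferentiableOn ℂ g (Ω ×ˢ ball c ρ) ∧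
      ∀ p ∈ Ω ×ˢ ball c ρ, s p ≠ 0 → g p = f p := by
  have hOs : IsOpen {p ∈ O | s p ≠ 0} := hs.continuousOn.isOpen_inter_preimage hO isOpen_ne
  refine ⟨fun p => (2 * Real.pi * Complex.I : ℂ)⁻¹ * ∮ v in C(c, ρ), (v - p.2)⁻¹ * f (p.1, v),
    ?_, ?_⟩
  · rintro p ⟨hp1, hp2⟩
    refine DifferentiableAt.differentiableWithinAt (DifferentiableAt.const_mul ?_ _)
    have hO' : IsOpen {q : (E × ℂ) × ℂ | q.2 - q.1.2 ≠ 0 ∧ (q.1.1, q.2) ∈ {p ∈ O | s p ≠ 0}} :=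
      (isOpen_ne_fun (by fun_prop) continuous_const).inter (hOs.preimage (by fun_prop))
    refine differentiableAt_circleIntegral (f := fun q : (E × ℂ) × ℂ =>
      (q.2 - q.1.2)⁻¹ * f (q.1.1, q.2)) hO' ?_ ?_
    · intro q hq
      have h1 := (hf _ hq.2).differentiableAt (hOs.mem_nhds hq.2)
      have h2 : DifferentiableAt ℂ (fun q : (E × ℂ) × ℂ => (q.1.1, q.2)) q := by fun_prop
      have h3 : DifferentiableAt ℂ (fun q : (E × ℂ) × ℂ => (q.2 - q.1.2)⁻¹) q :=
        DifferentiableAt.fun_inv (by fun_prop) hq.1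
      exact (h3.mul (DifferentiableAt.comp q h1 h2)).differentiableWithinAt
    · intro v hv
      rw [abs_of_pos hρ] at hv
      refine ⟨?_, hsub _ hp1 _ (sphere_subset_closedBall hv), hsph _ hp1 _ hv⟩
      change v - p.2 ≠ 0
      rw [sub_ne_zero]
      rintro rfl
      rw [mem_sphere] at hv
      exact (mem_ball.1 hp2).ne hv
  · rintro ⟨z, w⟩ ⟨hz, hw⟩ hsw
    have hz : z ∈ Ω := hz
    have hw : w ∈ ball c ρ := hw
    have hV : IsOpen {v | (z, v) ∈ O} := hO.preimage (by fun_prop)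
    obtain ⟨g, hg, hgf⟩ := exists_extension_disc (s := fun v => s (z, v)) (f := fun v => f (z, v))
      hV (hs.comp (by fun_prop) fun v hv => hv) hρ (hsub z hz) (hsph z hz)
      (hf.comp (by fun_prop) fun v hv => hv) (M := M) fun v hv hv0 => hM _ hv hv0
    have h1 := hg.circleIntegral_sub_inv_smul hw
    have h2 : (∮ v in C(c, ρ), (v - w)⁻¹ * f (z, v)) = ∮ v in C(c, ρ), (v - w)⁻¹ • g v := by
      refine circleIntegral.integral_congr hρ.le fun v hv => ?_
      simp only [smul_eq_mul]
      rw [hgf v (hsph z hz v hv)]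
    simp only
    rw [h2, h1, smul_eq_mul, inv_mul_cancel_left₀ (by simp [Complex.I_ne_zero, Real.pi_ne_zero])]
    exact hgf w hsw

/-- The neighbourhood `W` is chosen before `f`, so that several functions extend to the same set,
and it is convex so that the identity theorem applies on it. -/
theorem exists_extension_nhds {s : C2 → ℂ} {ξ₀ : C2} {r : ℝ}
    (hs : DifferentiableOn ℂ s (ball ξ₀ r)) {ξ₁ : C2} (hξ₁ : ξ₁ ∈ ball ξ₀ r) (hne : s ξ₁ ≠ 0) :
    ∃ W : Set C2, IsOpen W ∧ Convex ℝ W ∧ ξ₀ ∈ W ∧ W ⊆ ball ξ₀ r ∧ ∀ (f : C2 → ℂ) (M : ℝ),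
      DifferentiableOn ℂ f {ξ ∈ ball ξ₀ r | s ξ ≠ 0} →
      (∀ ξ ∈ ball ξ₀ r, s ξ ≠ 0 → ‖f ξ‖ ≤ M) →
      ∃ g : C2 → ℂ, DifferentiableOn ℂ g W ∧ ∀ ξ ∈ W, s ξ ≠ 0 → g ξ = f ξ := by
  -- A second point is needed to define a direction; if `s ξ₀ ≠ 0`, any nearby point serves.
  wlog hne' : ξ₁ ≠ ξ₀ generalizing ξ₁
  · obtain ⟨ξ₂, ⟨h1, h2⟩, h3⟩ : ∃ ξ₂, (s ξ₂ ≠ 0 ∧ ξ₂ ∈ ball ξ₀ r) ∧ ξ₂ ≠ ξ₀ := by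
      have hc := (hs.continuousOn.continuousAt (isOpen_ball.mem_nhds hξ₁)).eventually_ne hne
      have h := (hc.and (isOpen_ball.eventually_mem hξ₁)).filter_mono
        (nhdsWithin_le_nhds (s := {ξ₁}ᶜ))
      obtain ⟨ξ₂, h1, h2⟩ := (h.and self_mem_nhdsWithin).exists
      push Not at hne'
      exact ⟨ξ₂, h1, hne' ▸ h2⟩
    exact this h2 h1 h3
  obtain ⟨L, hL⟩ := exists_linear_coordinates (sub_ne_zero.2 hne')
  set X : ℂ × ℂ → C2 := fun q => ξ₀ + L q with hX
  have hXd : Differentiable ℂ X := by fun_prop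
  have hX0 : X (0, 0) = ξ₀ := by simp only [hX]; rw [hL]; simp
  have hXi : ∀ ξ, X (L.symm (ξ - ξ₀)) = ξ := fun ξ => by simp [hX]
  have hO : IsOpen (X ⁻¹' ball ξ₀ r) := isOpen_ball.preimage hXd.continuous
  have hr : 0 < r := pos_of_mem_ball hξ₁
  have hsX : DifferentiableOn ℂ (s ∘ X) (X ⁻¹' ball ξ₀ r) :=
    hs.comp hXd.differentiableOn (mapsTo_preimage _ _)
  obtain ⟨ρ, hρ, δ, hδ, hsub, hsph, -⟩ := exists_polydisc hO hsX.continuousOn (p := (0, 0))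
    (by rw [mem_preimage, hX0]; exact mem_ball_self hr) (by
      filter_upwards [eventually_ne_zero_on_line hs hξ₁ hne] with b hb
      simpa only [Function.comp_apply, hX, hL] using hb)
  refine ⟨{ξ | L.symm (ξ - ξ₀) ∈ ball (0 : ℂ) δ ×ˢ ball (0 : ℂ) ρ}, ?_, ?_, ?_, ?_, ?_⟩
  · exact (isOpen_ball.prod isOpen_ball).preimage (by fun_prop)
  · have h1 : Convex ℝ (ball (0 : ℂ) δ ×ˢ ball (0 : ℂ) ρ) := (convex_ball _ _).prod (convex_ball _ _)
    have h2 := (h1.linear_image ((L : (ℂ × ℂ) →ₗ[ℂ] C2).restrictScalars ℝ)).translate ξ₀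
    have h3 : {ξ | L.symm (ξ - ξ₀) ∈ ball (0 : ℂ) δ ×ˢ ball (0 : ℂ) ρ} = (fun x => ξ₀ + x) ''
        (((L : (ℂ × ℂ) →ₗ[ℂ] C2).restrictScalars ℝ) '' ball (0 : ℂ) δ ×ˢ ball (0 : ℂ) ρ) := by
      ext ξ
      constructor
      · intro h
        exact ⟨ξ - ξ₀, ⟨_, h, L.apply_symm_apply _⟩, by simp⟩
      · rintro ⟨_, ⟨q, hq, rfl⟩, rfl⟩
        have : L.symm (ξ₀ + L q - ξ₀) = q := by simp
        rw [← this] at hq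
        exact hq
    rw [h3]
    exact h2
  · have : L.symm (ξ₀ - ξ₀) ∈ ball (0 : ℂ) δ ×ˢ ball (0 : ℂ) ρ := by simp [hδ, hρ]
    exact this
  · intro ξ hξ
    have := hsub _ hξ.1 _ (ball_subset_closedBall hξ.2)
    rwa [mem_preimage, Prod.mk.eta, hXi] at this
  · intro f M hf hM
    obtain ⟨g, hg, hgf⟩ := exists_extension_polydisc hO hsX hρ hsub hsph
      (f := f ∘ X) (M := M) (hf.comp hXd.differentiableOn fun q hq => hq)
      fun p hp h => hM _ hp h
    refine ⟨fun ξ => g (L.symm (ξ - ξ₀)), ?_, ?_⟩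
    · exact hg.comp (by fun_prop) fun ξ hξ => hξ
    · intro ξ hξ h
      have := hgf _ hξ (by rwa [Function.comp_apply, hXi])
      rwa [Function.comp_apply, hXi] at this

end RiemannExtension

/-! ### Holomorphic graphs over manifolds -/

section Graph

open Filter

variable {N : Type*} [TopologicalSpace N] [ChartedSpace C2 N] [IsManifold 𝓘(ℂ, C2) ω N]
  {M : Type*} [TopologicalSpace M] [ChartedSpace C2 M] [IsManifold 𝓘(ℂ, C2) ω M]

theorem IsAnalyticSubset.isClosed {E : Type*} [NormedAddCommGroup E] [NormedSpace ℂ E] {H : Type*}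
    [TopologicalSpace H] {I : ModelWithCorners ℂ E H} {M : Type*} [TopologicalSpace M]
    [ChartedSpace H M] {S : Set M} (hS : IsAnalyticSubset I S) : IsClosed S := by
  rw [← isOpen_compl_iff, isOpen_iff_mem_nhds]
  intro x hx
  obtain ⟨U, hU, hxU, k, f, hf, hSU⟩ := hS x
  obtain ⟨i, hi⟩ : ∃ i, f i x ≠ 0 := by
    by_contra h
    push Not at h
    have : x ∈ S ∩ U := hSU ▸ ⟨hxU, h⟩
    exact hx this.1
  have hc := ((hf i x hxU).mdifferentiableAt (hU.mem_nhds hxU)).continuousAt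
  filter_upwards [hU.mem_nhds hxU, hc.eventually_ne hi] with z hz hz' hzS
  have : z ∈ {x ∈ U | ∀ i, f i x = 0} := hSU ▸ ⟨hzS, hz⟩
  exact hz' (this.2 i)

/-- A sphere around `y₀` misses the fibre over `x₀`, hence all nearby fibres. So off `S` the map `φ`
either stays inside the ball or outside it, and in the first case its coordinates are bounded and
extend across `S`. A single isolated point of the fibre thus controls the whole of `Γ` over `W`. -/
theorem exists_nhds_graph_of_isolated [T2Space N] {Γ : Set (N × M)} (hΓ : IsClosed Γ) {S : Set M}
    (hS : IsAnalyticSubset 𝓘(ℂ, C2) S) (hSint : interior S = ∅)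
    (hcl : Γ ⊆ closure (Γ \ Prod.snd ⁻¹' S)) {φ : M → N}
    (hφ : MDifferentiableOn 𝓘(ℂ, C2) 𝓘(ℂ, C2) φ Sᶜ)
    (hφΓ : ∀ x ∉ S, ∀ y, (y, x) ∈ Γ ↔ y = φ x) {y₀ : N} {x₀ : M} (h₀ : (y₀, x₀) ∈ Γ)
    (hiso : ∀ᶠ y in 𝓝[≠] y₀, (y, x₀) ∉ Γ) :
    ∃ W : Set M, IsOpen W ∧ x₀ ∈ W ∧ ∃ ψ : M → N, MDifferentiableOn 𝓘(ℂ, C2) 𝓘(ℂ, C2) ψ W ∧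
      ∀ x ∈ W, ∀ y, (y, x) ∈ Γ ↔ y = ψ x := by
  have : IsManifold 𝓘(ℂ, C2) 1 N := IsManifold.of_le (n := ω) le_top
  have : IsManifold 𝓘(ℂ, C2) 1 M := IsManifold.of_le (n := ω) le_top
  set ey := chartAt C2 y₀ with hey
  set ex := chartAt C2 x₀ with hex
  have hy₀ : y₀ ∈ ey.source := mem_chart_source C2 y₀
  have hx₀ : x₀ ∈ ex.source := mem_chart_source C2 x₀
  have hSc : IsOpen Sᶜ := hS.isClosed.isOpen_compl
  -- an isolating ball
  obtain ⟨ε, hε, hεt, hεiso⟩ : ∃ ε > 0, Metric.closedBall (ey y₀) ε ⊆ ey.target ∧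
      ∀ η ∈ Metric.closedBall (ey y₀) ε, η ≠ ey y₀ → (ey.symm η, x₀) ∉ Γ := by
    have h1 : ∀ᶠ η in 𝓝 (ey y₀), η ≠ ey y₀ → (ey.symm η, x₀) ∉ Γ := by
      have hc : Tendsto ey.symm (𝓝 (ey y₀)) (𝓝 y₀) := ey.tendsto_symm hy₀
      filter_upwards [hc.eventually (eventually_nhdsWithin_iff.1 hiso),
        ey.open_target.mem_nhds (ey.map_source hy₀)] with η h1 h2 h3
      refine h1 fun h => h3 ?_
      have h' : ey.symm η = y₀ := h
      rw [← h', ey.right_inv h2]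
    obtain ⟨ε, hε, h⟩ := Metric.nhds_basis_closedBall.mem_iff.1
      (h1.and (ey.open_target.mem_nhds (ey.map_source hy₀)))
    exact ⟨ε, hε, fun η hη => (h hη).2, fun η hη => (h hη).1⟩
  set V : Set N := ey.source ∩ ey ⁻¹' Metric.ball (ey y₀) ε with hV
  have hVo : IsOpen V := ey.isOpen_inter_preimage Metric.isOpen_ball
  have hVK : ∀ y ∈ V, y ∈ ey.symm '' Metric.closedBall (ey y₀) ε := fun y hy =>
    ⟨ey y, Metric.ball_subset_closedBall hy.2, ey.left_inv hy.1⟩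
  have hcont : ContinuousOn ey.symm (Metric.closedBall (ey y₀) ε) := ey.continuousOn_symm.mono hεt
  have hK : IsCompact (ey.symm '' Metric.closedBall (ey y₀) ε) :=
    (isCompact_closedBall _ _).image_of_continuousOn hcont
  have htube : ∀ᶠ x in 𝓝 x₀, ∀ y ∈ ey.symm '' Metric.sphere (ey y₀) ε, (y, x) ∉ Γ := by
    refine ((isCompact_sphere _ _).image_of_continuousOn (hcont.mono
      Metric.sphere_subset_closedBall)).eventually_forall_of_forall_eventually ?_
    rintro _ ⟨η, hη, rfl⟩
    have hne : (ey.symm η, x₀) ∉ Γ := hεiso η (Metric.sphere_subset_closedBall hη) (by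
      rintro rfl
      simp at hη
      exact hε.ne hη)
    have hsw : Tendsto Prod.swap (𝓝 (x₀, ey.symm η)) (𝓝 (ey.symm η, x₀)) :=
      continuous_swap.tendsto _
    exact hsw.eventually (hΓ.isOpen_compl.mem_nhds hne)
  obtain ⟨U, hU, hxU, k, F, hF, hSU⟩ := hS x₀
  -- a coordinate ball around `x₀`
  obtain ⟨r, hr, hrt⟩ : ∃ r > 0, ∀ ξ ∈ Metric.ball (ex x₀) r, ξ ∈ ex.target ∧ ex.symm ξ ∈ U ∧
      ∀ y ∈ ey.symm '' Metric.sphere (ey y₀) ε, (y, ex.symm ξ) ∉ Γ := by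
    have hc : Tendsto ex.symm (𝓝 (ex x₀)) (𝓝 x₀) := ex.tendsto_symm hx₀
    exact Metric.mem_nhds_iff.1 ((ex.open_target.eventually_mem (ex.map_source hx₀)).and
      (hc.eventually ((hU.eventually_mem hxU).and htube)))
  have hexs : MDifferentiableOn 𝓘(ℂ, C2) 𝓘(ℂ, C2) ex.symm (Metric.ball (ex x₀) r) :=
    (mdifferentiableOn_atlas_symm (chart_mem_atlas C2 x₀)).mono fun ξ hξ => (hrt ξ hξ).1
  obtain ⟨ξ₁, hξ₁, hξ₁S⟩ : ∃ ξ₁ ∈ Metric.ball (ex x₀) r, ex.symm ξ₁ ∉ S := by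
    by_contra h
    push Not at h
    have h1 : IsOpen (ex.symm '' Metric.ball (ex x₀) r) :=
      ex.symm.isOpen_image_of_subset_source Metric.isOpen_ball fun ξ hξ => (hrt ξ hξ).1
    have h2 : ex.symm '' Metric.ball (ex x₀) r ⊆ interior S :=
      interior_maximal (by rintro _ ⟨ξ, hξ, rfl⟩; exact h ξ hξ) h1
    rw [hSint] at h2
    exact h2 ⟨ex x₀, Metric.mem_ball_self hr, rfl⟩
  obtain ⟨j, hj⟩ : ∃ j, F j (ex.symm ξ₁) ≠ 0 := by
    by_contra h
    push Not at h
    have : ex.symm ξ₁ ∈ S ∩ U := hSU ▸ ⟨(hrt ξ₁ hξ₁).2.1, h⟩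
    exact hξ₁S this.1
  set s : C2 → ℂ := fun ξ => F j (ex.symm ξ) with hsdef
  have hs : DifferentiableOn ℂ s (Metric.ball (ex x₀) r) :=
    mdifferentiableOn_iff_differentiableOn.1 ((hF j).comp hexs fun ξ hξ => (hrt ξ hξ).2.1)
  have hsS : ∀ ξ ∈ Metric.ball (ex x₀) r, s ξ ≠ 0 → ex.symm ξ ∉ S := fun ξ hξ h hS => by
    have : ex.symm ξ ∈ {x ∈ U | ∀ i, F i x = 0} := hSU ▸ ⟨hS, (hrt ξ hξ).2.1⟩
    exact h (this.2 j)
  obtain ⟨W, hW, hWc, hxW, hWr, hext⟩ := exists_extension_nhds hs hξ₁ hj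
  have hD : IsOpen {ξ ∈ Metric.ball (ex x₀) r | s ξ ≠ 0} :=
    hs.continuousOn.isOpen_inter_preimage Metric.isOpen_ball isOpen_ne
  have hdense : ∀ ξ ∈ Metric.ball (ex x₀) r, ∃ᶠ ξ' in 𝓝 ξ, s ξ' ≠ 0 := by
    intro ξ hξ h
    have h' : ∀ᶠ ξ' in 𝓝 ξ, s ξ' = 0 := h.mono fun ξ' h => not_not.1 h
    exact hj (eqOn_zero_of_convex Metric.isOpen_ball (convex_ball _ _) hs hξ h' hξ₁)
  -- the map `φ` in coordinates
  set φ' : C2 → N := fun ξ => φ (ex.symm ξ) with hφ'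
  have hφd : ∀ ξ ∈ Metric.ball (ex x₀) r, ex.symm ξ ∉ S →
      MDifferentiableAt 𝓘(ℂ, C2) 𝓘(ℂ, C2) φ' ξ := by
    intro ξ hξ hξS
    exact MDifferentiableAt.comp (I' := 𝓘(ℂ, C2)) ξ
      ((hφ _ hξS).mdifferentiableAt (hSc.mem_nhds hξS))
      ((hexs ξ hξ).mdifferentiableAt (Metric.isOpen_ball.mem_nhds hξ))
  have hφK : ∀ ξ ∈ Metric.ball (ex x₀) r, ex.symm ξ ∉ S →
      φ' ξ ∈ ey.symm '' Metric.closedBall (ey y₀) ε → φ' ξ ∈ V := by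
    rintro ξ hξ hξS ⟨η, hη, hη'⟩
    have h1 : (φ' ξ, ex.symm ξ) ∈ Γ := (hφΓ _ hξS _).2 rfl
    have h2 : η ∉ Metric.sphere (ey y₀) ε := fun h =>
      (hrt ξ hξ).2.2 _ ⟨η, h, hη'⟩ h1
    rw [← hη']
    refine ⟨ey.map_target (hεt hη), ?_⟩
    rw [mem_preimage, ey.right_inv (hεt hη)]
    exact lt_of_le_of_ne hη h2
  -- Whether `φ'` lies in `V` is locally constant: no value lies on the image of the sphere, so
  -- being in the open `V` amounts to being in the image of the closed ball.
  have hloc : ∀ ξ ∈ {ξ ∈ Metric.ball (ex x₀) r | s ξ ≠ 0},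
      (φ' ξ ∈ V ∧ ∀ᶠ ξ' in 𝓝 ξ, φ' ξ' ∈ V) ∨ (φ' ξ ∉ V ∧ ∀ᶠ ξ' in 𝓝 ξ, φ' ξ' ∉ V) := by
    rintro ξ ⟨hξ, hsξ⟩
    have hξS := hsS ξ hξ hsξ
    have hc := (hφd ξ hξ hξS).continuousAt
    by_cases h : φ' ξ ∈ V
    · exact Or.inl ⟨h, hc.eventually_mem (hVo.mem_nhds h)⟩
    · refine Or.inr ⟨h, ?_⟩
      have h1 : φ' ξ ∉ ey.symm '' Metric.closedBall (ey y₀) ε := fun h' => h (hφK ξ hξ hξS h')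
      filter_upwards [hc.eventually_mem (hK.isClosed.isOpen_compl.mem_nhds h1)] with ξ' h2 h3
      exact h2 (hVK _ h3)
  classical
  have hdiff : ∀ u : C2 → ℂ, Differentiable ℂ u → DifferentiableOn ℂ
      (fun ξ => if φ' ξ ∈ V then u (ey (φ' ξ)) else 0) {ξ ∈ Metric.ball (ex x₀) r | s ξ ≠ 0} := by
    intro u hu ξ hξ
    refine DifferentiableAt.differentiableWithinAt ?_
    rcases hloc ξ hξ with ⟨h1, h2⟩ | ⟨h1, h2⟩
    · have h3 : MDifferentiableAt 𝓘(ℂ, C2) 𝓘(ℂ, C2) (fun ξ => ey (φ' ξ)) ξ :=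
        MDifferentiableAt.comp (I' := 𝓘(ℂ, C2)) ξ
          (mdifferentiableAt_atlas (chart_mem_atlas C2 y₀) h1.1) (hφd ξ hξ.1 (hsS ξ hξ.1 hξ.2))
      have h4 : DifferentiableAt ℂ (fun ξ => u (ey (φ' ξ))) ξ :=
        (hu _).comp ξ (mdifferentiableAt_iff_differentiableAt.1 h3)
      exact h4.congr_of_eventuallyEq (h2.mono fun ξ' h => if_pos h)
    · exact (differentiableAt_const (0 : ℂ)).congr_of_eventuallyEq (h2.mono fun ξ' h => if_neg h)
  have hbdd : ∀ u : C2 → ℂ, Continuous u → ∃ C : ℝ, ∀ ξ ∈ Metric.ball (ex x₀) r, s ξ ≠ 0 →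
      ‖(fun ξ => if φ' ξ ∈ V then u (ey (φ' ξ)) else 0) ξ‖ ≤ C := by
    intro u hu
    obtain ⟨C, hC⟩ := (isCompact_closedBall (ey y₀) ε).exists_bound_of_continuousOn hu.continuousOn
    refine ⟨max C 0, fun ξ _ _ => ?_⟩
    simp only
    split_ifs with h
    · exact (hC _ (Metric.ball_subset_closedBall h.2)).trans (le_max_left _ _)
    · simp
  have hextu : ∀ u : C2 → ℂ, Differentiable ℂ u → ∃ g : C2 → ℂ, DifferentiableOn ℂ g W ∧
      ∀ ξ ∈ W, s ξ ≠ 0 → g ξ = if φ' ξ ∈ V then u (ey (φ' ξ)) else 0 := by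
    intro u hu
    obtain ⟨C, hC⟩ := hbdd u hu.continuous
    exact hext _ C (hdiff u hu) hC
  -- points of `Γ` near `(y₀, x₀)`
  have hexc : Tendsto ex (𝓝 x₀) (𝓝 (ex x₀)) := ex.continuousAt hx₀
  obtain ⟨x₂, ⟨hx₂S, hx₂V⟩, hx₂s, hx₂W⟩ : ∃ x, (x ∉ S ∧ φ x ∈ V) ∧ x ∈ ex.source ∧ ex x ∈ W := by
    have h1 := mem_closure_iff_frequently.1 (hcl h₀)
    have hyV : y₀ ∈ V := ⟨hy₀, Metric.mem_ball_self hε⟩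
    have h2 : ∀ᶠ p : N × M in 𝓝 (y₀, x₀), p.1 ∈ V ∧ p.2 ∈ ex.source ∧ ex p.2 ∈ W :=
      (continuousAt_fst.eventually_mem (hVo.mem_nhds hyV)).and
        ((continuous_snd.tendsto (y₀, x₀)).eventually ((ex.open_source.eventually_mem hx₀).and
          (hexc.eventually_mem (hW.mem_nhds hxW))))
    obtain ⟨p, ⟨hp1, hp2⟩, hp3, hp4, hp5⟩ := (h1.and_eventually h2).exists
    have := (hφΓ p.2 hp2 p.1).1 hp1
    exact ⟨p.2, ⟨hp2, this ▸ hp3⟩, hp4, hp5⟩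
  -- The indicator of `φ' ξ ∈ V` extends holomorphically to the convex set `W`. It equals 1 on an
  -- open set because `(y₀, x₀)` is a limit of points of `Γ` off `S`; hence it is 1 throughout.
  have hVW : ∀ ξ ∈ W, s ξ ≠ 0 → φ' ξ ∈ V := by
    obtain ⟨g, hg, hgφ⟩ := hextu (fun _ => 1) (differentiable_const _)
    obtain ⟨ξ₃, ⟨hξ₃s, hξ₃W⟩, hξ₃V⟩ : ∃ ξ, (s ξ ≠ 0 ∧ ξ ∈ W) ∧ φ' ξ ∈ V := by
      have h1 : ContinuousAt φ' (ex x₂) := (hφd _ (hWr hx₂W) (by rwa [ex.left_inv hx₂s])).continuousAt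
      have h2 : φ' (ex x₂) ∈ V := by simpa only [hφ', ex.left_inv hx₂s] using hx₂V
      obtain ⟨ξ, h3, h4, h5⟩ := ((hdense _ (hWr hx₂W)).and_eventually ((hW.eventually_mem hx₂W).and
        (h1.eventually_mem (hVo.mem_nhds h2)))).exists
      exact ⟨ξ, ⟨h3, h4⟩, h5⟩
    have hd : DifferentiableOn ℂ (fun ξ => g ξ - 1) W := hg.sub_const 1
    have h0 : ∀ᶠ ξ in 𝓝 ξ₃, g ξ - 1 = 0 := by
      have h1 := (hloc ξ₃ ⟨hWr hξ₃W, hξ₃s⟩).resolve_right fun h => h.1 hξ₃V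
      filter_upwards [h1.2, hD.mem_nhds ⟨hWr hξ₃W, hξ₃s⟩, hW.mem_nhds hξ₃W] with ξ h2 h3 h4
      rw [hgφ ξ h4 h3.2, if_pos h2, sub_self]
    have h1 := eqOn_zero_of_convex hW hWc hd hξ₃W h0
    intro ξ hξ hsξ
    by_contra hV
    have h2 := h1 hξ
    simp only at h2
    rw [hgφ ξ hξ hsξ, if_neg hV] at h2
    simp at h2
  obtain ⟨g₁, hg₁, hg₁φ⟩ := hextu Prod.fst differentiable_fst
  obtain ⟨g₂, hg₂, hg₂φ⟩ := hextu Prod.snd differentiable_snd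
  set G : C2 → C2 := fun ξ => (g₁ ξ, g₂ ξ) with hG
  have hGd : DifferentiableOn ℂ G W := hg₁.prodMk hg₂
  have hGφ : ∀ ξ ∈ W, s ξ ≠ 0 → G ξ = ey (φ' ξ) := by
    intro ξ hξ hsξ
    simp only [hG]
    rw [hg₁φ ξ hξ hsξ, hg₂φ ξ hξ hsξ, if_pos (hVW ξ hξ hsξ), if_pos (hVW ξ hξ hsξ)]
  have hGB : ∀ ξ ∈ W, G ξ ∈ Metric.closedBall (ey y₀) ε := by
    intro ξ hξ
    have hc : ContinuousAt G ξ := hGd.continuousOn.continuousAt (hW.mem_nhds hξ)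
    refine Metric.isClosed_closedBall.mem_of_frequently_of_tendsto
      (((hdense ξ (hWr hξ)).and_eventually (hW.eventually_mem hξ)).mono ?_) hc
    rintro ξ' ⟨h1, h2⟩
    rw [hGφ ξ' h2 h1]
    exact Metric.ball_subset_closedBall (hVW ξ' h2 h1).2
  set ψ' : C2 → N := fun ξ => ey.symm (G ξ) with hψ'
  have hψ'd : MDifferentiableOn 𝓘(ℂ, C2) 𝓘(ℂ, C2) ψ' W :=
    (mdifferentiableOn_atlas_symm (chart_mem_atlas C2 y₀)).comp
      (mdifferentiableOn_iff_differentiableOn.2 hGd) fun ξ hξ => hεt (hGB ξ hξ)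
  have hψ'c : ∀ ξ ∈ W, ContinuousAt ψ' ξ := fun ξ hξ =>
    hψ'd.continuousOn.continuousAt (hW.mem_nhds hξ)
  have hψ's : ∀ ξ ∈ W, s ξ ≠ 0 → ψ' ξ = φ' ξ := by
    intro ξ hξ hsξ
    simp only [hψ']
    rw [hGφ ξ hξ hsξ, ey.left_inv (hVW ξ hξ hsξ).1]
  have hψ'φ : ∀ ξ ∈ W, ex.symm ξ ∉ S → ψ' ξ = φ' ξ := by
    intro ξ hξ hξS
    by_contra hne
    have h1 := (hψ'c ξ hξ).tendsto.prodMk_nhds (hφd ξ (hWr hξ) hξS).continuousAt.tendsto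
    have h2 := h1.eventually (isClosed_diagonal.isOpen_compl.mem_nhds (show (ψ' ξ, φ' ξ) ∈ (diagonal N)ᶜ
      from hne))
    obtain ⟨ξ', h3, h4, h5⟩ := ((hdense ξ (hWr hξ)).and_eventually
      (h2.and (hW.eventually_mem hξ))).exists
    exact h4 (hψ's ξ' h5 h3)
  have hexd := mdifferentiableOn_atlas (I := 𝓘(ℂ, C2)) (chart_mem_atlas C2 x₀)
  have hWM : IsOpen (ex.source ∩ ex ⁻¹' W) := ex.isOpen_inter_preimage hW
  have hψd : MDifferentiableOn 𝓘(ℂ, C2) 𝓘(ℂ, C2) (fun x => ψ' (ex x)) (ex.source ∩ ex ⁻¹' W) :=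
    hψ'd.comp (hexd.mono inter_subset_left) fun x hx => hx.2
  refine ⟨ex.source ∩ ex ⁻¹' W, hWM, ⟨hx₀, hxW⟩, fun x => ψ' (ex x), hψd, ?_⟩
  rintro x ⟨hxs, hxW⟩ y
  have hψx : ContinuousAt (fun x => ψ' (ex x)) x :=
    hψd.continuousOn.continuousAt (hWM.mem_nhds ⟨hxs, hxW⟩)
  constructor
  -- Off `S`, `Γ` is the graph of `ψ' ∘ ex`; both it and this graph are closed over the
  -- neighbourhood and have dense parts off `S`, so they agree on `S` too.
  · intro hyx
    by_contra hne
    have h1 : Tendsto (fun p : N × M => (p.1, ψ' (ex p.2))) (𝓝 (y, x)) (𝓝 (y, ψ' (ex x))) :=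
      continuousAt_fst.tendsto.prodMk_nhds (hψx.tendsto.comp continuousAt_snd.tendsto)
    have h2 := h1.eventually (isClosed_diagonal.isOpen_compl.mem_nhds
      (show (y, ψ' (ex x)) ∈ (diagonal N)ᶜ from hne))
    obtain ⟨p, ⟨hp1, hp2⟩, hp3, hp4⟩ := ((mem_closure_iff_frequently.1 (hcl hyx)).and_eventually
      (h2.and ((continuous_snd.tendsto (y, x)).eventually (hWM.eventually_mem ⟨hxs, hxW⟩)))).exists
    apply hp3
    change p.1 = ψ' (ex p.2)
    have hp2' : p.2 ∉ S := hp2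
    rw [hψ'φ _ hp4.2 (by rwa [ex.left_inv hp4.1])]
    simp only [hφ', ex.left_inv hp4.1]
    exact (hφΓ p.2 hp2' p.1).1 hp1
  · rintro rfl
    have h1 : Tendsto (fun x => (ψ' (ex x), x)) (𝓝 x) (𝓝 (ψ' (ex x), x)) :=
      hψx.tendsto.prodMk_nhds tendsto_id
    refine hΓ.mem_of_frequently_of_tendsto ?_ h1
    have hSx : ∃ᶠ x' in 𝓝 x, x' ∉ S := by
      refine mem_closure_iff_frequently.1 (?_ : x ∈ closure Sᶜ)
      rw [closure_compl, hSint, compl_empty]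
      trivial
    refine (hSx.and_eventually (hWM.eventually_mem ⟨hxs, hxW⟩)).mono ?_
    rintro x' ⟨hx'S, hx's, hx'W⟩
    refine (hφΓ x' hx'S _).2 ?_
    rw [hψ'φ _ hx'W (by rwa [ex.left_inv hx's])]
    simp only [hφ', ex.left_inv hx's]

end Graph

/-! ### Surfaces bimeromorphic to a compact surface -/

section Bimeromorphic

open Filter

section

variable {N : Type*} [TopologicalSpace N] [ChartedSpace C2 N]
  {M : Type*} [TopologicalSpace M] [ChartedSpace C2 M]

theorem isDominatingMap_comp {T U : Set M} (hT : IsClosed T) {φ : M → N}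
    (hφ : MDifferentiableOn 𝓘(ℂ, C2) 𝓘(ℂ, C2) φ Tᶜ)
    (hφU : ∀ x ∈ U, x ∉ T → Function.Bijective (mfderiv 𝓘(ℂ, C2) 𝓘(ℂ, C2) φ x)) {F : C2 → M}
    (hF : MDifferentiable 𝓘(ℂ, C2) 𝓘(ℂ, C2) F) (hFT : ∀ z, F z ∈ Tᶜ) {z : C2} (hz : F z ∈ U)
    (hFz : Function.Bijective (mfderiv 𝓘(ℂ, C2) 𝓘(ℂ, C2) F z)) :
    IsDominatingMap (φ ∘ F) := by
  have h : ∀ z, MDifferentiableAt 𝓘(ℂ, C2) 𝓘(ℂ, C2) φ (F z) := fun z =>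
    (hφ _ (hFT z)).mdifferentiableAt (hT.isOpen_compl.mem_nhds (hFT z))
  refine ⟨fun z => (h z).comp z (hF z), z, ?_⟩
  rw [mfderiv_comp (I' := 𝓘(ℂ, C2)) z (h z) (hF z)]
  exact (hφU _ hz (hFT z)).comp hFz

theorem bijective_mfderiv_of_leftInverse {φ : M → N} {ψ : N → M} {x : M}
    (hφ : MDifferentiableAt 𝓘(ℂ, C2) 𝓘(ℂ, C2) φ x)
    (hψ : MDifferentiableAt 𝓘(ℂ, C2) 𝓘(ℂ, C2) ψ (φ x)) (h : ∀ᶠ x' in 𝓝 x, ψ (φ x') = x') :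
    Function.Bijective (mfderiv 𝓘(ℂ, C2) 𝓘(ℂ, C2) φ x) := by
  have h1 : mfderiv 𝓘(ℂ, C2) 𝓘(ℂ, C2) (ψ ∘ φ) x = mfderiv 𝓘(ℂ, C2) 𝓘(ℂ, C2) (id : M → M) x :=
    Filter.EventuallyEq.mfderiv_eq h
  rw [mfderiv_comp (I' := 𝓘(ℂ, C2)) x hψ hφ, mfderiv_id] at h1
  have h2 : Function.Injective (mfderiv 𝓘(ℂ, C2) 𝓘(ℂ, C2) φ x) := by
    intro v w hvw
    have h3 := congrArg (fun A => A v) h1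
    have h4 := congrArg (fun A => A w) h1
    have h5 : mfderiv 𝓘(ℂ, C2) 𝓘(ℂ, C2) ψ (φ x) (mfderiv 𝓘(ℂ, C2) 𝓘(ℂ, C2) φ x v) = v := h3
    have h6 : mfderiv 𝓘(ℂ, C2) 𝓘(ℂ, C2) ψ (φ x) (mfderiv 𝓘(ℂ, C2) 𝓘(ℂ, C2) φ x w) = w := h4
    rw [← h5, ← h6, hvw]
  refine ⟨h2, ?_⟩
  let B : C2 →L[ℂ] C2 := mfderiv 𝓘(ℂ, C2) 𝓘(ℂ, C2) φ x
  have h3 : Function.Injective (B : C2 →ₗ[ℂ] C2) := h2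
  have h4 : Function.Surjective (B : C2 →ₗ[ℂ] C2) := LinearMap.injective_iff_surjective.1 h3
  exact h4

end

variable {N : Type*} [TopologicalSpace N] [ChartedSpace C2 N] [IsManifold 𝓘(ℂ, C2) ω N]
  {M : Type*} [TopologicalSpace M] [ChartedSpace C2 M] [IsManifold 𝓘(ℂ, C2) ω M]

/-- Manifold version of `eventually_isolated_fiber`. -/
theorem eventually_isolated_fiber_manifold {Γ : Set (N × M)}
    (hΓ : IsAnalyticSubset (𝓘(ℂ, C2).prod 𝓘(ℂ, C2)) Γ) {S : Set M} (hS : interior S = ∅)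
    (hcl : Γ ⊆ closure (Γ \ Prod.snd ⁻¹' S))
    (hinj : ∀ x ∉ S, ∀ y y', (y, x) ∈ Γ → (y', x) ∈ Γ → y = y') {y₀ : N} {x₀ : M}
    (hprop : ∃ᶠ y in 𝓝 y₀, (y, x₀) ∉ Γ) :
    ∀ᶠ p in 𝓝 (y₀, x₀), p ∈ Γ → p.2 ≠ x₀ → ∀ᶠ y in 𝓝[≠] p.1, (y, p.2) ∉ Γ := by
  have : IsManifold 𝓘(ℂ, C2) 1 N := IsManifold.of_le (n := ω) le_top
  have : IsManifold 𝓘(ℂ, C2) 1 M := IsManifold.of_le (n := ω) le_top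
  set ey := chartAt C2 y₀ with hey
  set ex := chartAt C2 x₀ with hex
  have hy₀ : y₀ ∈ ey.source := mem_chart_source C2 y₀
  have hx₀ : x₀ ∈ ex.source := mem_chart_source C2 x₀
  obtain ⟨U, hU, hpU, k, f, hf, hΓU⟩ := hΓ (y₀, x₀)
  set Q : C2 × C2 → N × M := Prod.map ey.symm ex.symm with hQ
  set P : N × M → C2 × C2 := Prod.map ey ex with hP
  have hQd : MDifferentiableOn (𝓘(ℂ, C2).prod 𝓘(ℂ, C2)) (𝓘(ℂ, C2).prod 𝓘(ℂ, C2)) Q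
      (ey.target ×ˢ ex.target) :=
    MDifferentiableOn.prodMap (mdifferentiableOn_atlas_symm (chart_mem_atlas C2 y₀))
      (mdifferentiableOn_atlas_symm (chart_mem_atlas C2 x₀))
  have htO : IsOpen (ey.target ×ˢ ex.target) := ey.open_target.prod ex.open_target
  set O : Set (C2 × C2) := ey.target ×ˢ ex.target ∩ Q ⁻¹' U with hO
  have hOo : IsOpen O := hQd.continuousOn.isOpen_inter_preimage htO hU
  have hPQ : ∀ q ∈ ey.target ×ˢ ex.target, P (Q q) = q := fun q hq =>
    Prod.ext (ey.right_inv hq.1) (ex.right_inv hq.2)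
  have hQP : ∀ p : N × M, p.1 ∈ ey.source → p.2 ∈ ex.source → Q (P p) = p := fun p h1 h2 =>
    Prod.ext (ey.left_inv h1) (ex.left_inv h2)
  have hPc : ∀ p : N × M, p.1 ∈ ey.source → p.2 ∈ ex.source → ContinuousAt P p := fun p h1 h2 =>
    ContinuousAt.prodMap (ey.continuousAt h1) (ex.continuousAt h2)
  have hF : ∀ i, DifferentiableOn ℂ (fun q => f i (Q q)) O := by
    intro i
    have h1 : MDifferentiableOn (𝓘(ℂ, C2).prod 𝓘(ℂ, C2)) 𝓘(ℂ, ℂ) (f i ∘ Q) O :=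
      (hf i).comp (hQd.mono inter_subset_left) fun q hq => hq.2
    rw [← modelWithCornersSelf_prod, chartedSpaceSelf_prod] at h1
    exact mdifferentiableOn_iff_differentiableOn.1 h1
  set S' : Set C2 := ex.target ∩ ex.symm ⁻¹' S with hS'
  have key := eventually_isolated_fiber hOo hF (Γ := Q ⁻¹' Γ) (S := S') (η₀ := ey y₀)
    (ξ₀ := ex x₀) ?_ ?_ ?_ ?_ ?_ ?_
  · have hPt : Tendsto P (𝓝 (y₀, x₀)) (𝓝 (ey y₀, ex x₀)) := hPc (y₀, x₀) hy₀ hx₀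
    have hs : ∀ᶠ p : N × M in 𝓝 (y₀, x₀), p.1 ∈ ey.source ∧ p.2 ∈ ex.source :=
      prod_mem_nhds (ey.open_source.mem_nhds hy₀) (ex.open_source.mem_nhds hx₀)
    filter_upwards [hPt.eventually key, hs] with p hp ⟨hp1, hp2⟩ hpΓ hpx
    have h1 := hp (by rwa [mem_preimage, hQP p hp1 hp2]) fun h => hpx (ex.injOn hp2 hx₀ h)
    rw [eventually_nhdsWithin_iff] at h1 ⊢
    filter_upwards [(ey.continuousAt hp1).eventually h1, ey.open_source.mem_nhds hp1]
      with y hy hys hyp hyΓ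
    refine hy (fun h => hyp (ey.injOn hys hp1 h)) ?_
    have : Q (P (y, p.2)) ∈ Γ := by rwa [hQP (y, p.2) hys hp2]
    exact this
  · intro q hq
    constructor
    · intro h i
      have : Q q ∈ {x ∈ U | ∀ i, f i x = 0} := hΓU ▸ ⟨h, hq.2⟩
      exact this.2 i
    · intro h
      have : Q q ∈ Γ ∩ U := hΓU ▸ ⟨hq.2, h⟩
      exact this.1
  · rw [← subset_empty_iff]
    intro ξ hξ
    have h1 : interior S' ⊆ S' := interior_subset
    have h2 : IsOpen (ex.symm '' interior S') :=
      ex.symm.isOpen_image_of_subset_source isOpen_interior fun ξ hξ => (h1 hξ).1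
    have h3 : ex.symm '' interior S' ⊆ interior S :=
      interior_maximal (by rintro _ ⟨ξ, hξ, rfl⟩; exact (h1 hξ).2) h2
    rw [hS] at h3
    exact h3 ⟨ξ, hξ, rfl⟩
  · intro q hq hqΓ
    rw [mem_closure_iff_frequently]
    have h1 := mem_closure_iff_frequently.1 (hcl hqΓ)
    have hq1 : (Q q).1 ∈ ey.source := ey.map_target hq.1.1
    have hq2 : (Q q).2 ∈ ex.source := ex.map_target hq.1.2
    have hs : ∀ᶠ p : N × M in 𝓝 (Q q), p.1 ∈ ey.source ∧ p.2 ∈ ex.source :=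
      prod_mem_nhds (ey.open_source.mem_nhds hq1) (ex.open_source.mem_nhds hq2)
    have hPt : Tendsto P (𝓝 (Q q)) (𝓝 q) := by
      have := hPc (Q q) hq1 hq2
      rwa [ContinuousAt, hPQ q hq.1] at this
    refine hPt.frequently ((h1.and_eventually hs).mono ?_)
    rintro p ⟨⟨hp1, hp2⟩, hp3, hp4⟩
    refine ⟨by rwa [mem_preimage, hQP p hp3 hp4], fun h => hp2 ?_⟩
    have := h.2
    change ex.symm (ex p.2) ∈ S at this
    rwa [ex.left_inv hp4] at this
  · intro p hp q hq hpΓ hqΓ hpS hpq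
    have h1 : ex.symm p.2 ∉ S := fun h => hpS ⟨hp.1.2, h⟩
    refine Prod.ext (ey.symm.injOn hp.1.1 hq.1.1 (hinj _ h1 _ _ hpΓ ?_)) hpq
    rw [hpq]
    exact hqΓ
  · refine ⟨⟨ey.map_source hy₀, ex.map_source hx₀⟩, ?_⟩
    have : Q (P (y₀, x₀)) ∈ U := by rwa [hQP (y₀, x₀) hy₀ hx₀]
    exact this
  · have hPt : Tendsto ey (𝓝 y₀) (𝓝 (ey y₀)) := ey.continuousAt hy₀
    refine hPt.frequently ((hprop.and_eventually (ey.open_source.eventually_mem hy₀)).mono ?_)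
    rintro y ⟨hy1, hy2⟩ h
    have : Q (P (y, x₀)) ∈ Γ := h
    rw [hQP (y, x₀) hy2 hx₀] at this
    exact hy1 this

/-- The inverse correspondence from `M` to `N` is a holomorphic map off a finite set `T`, so it can
be composed with the map supplied by `hdom T`. The clause about dense open `U` ensures that the
differential is tested where the correspondence is locally biholomorphic. -/
theorem dominableByC2_of_isBimeromorphic [T2Space N] [T2Space M] [CompactSpace M]
    (hdom : ∀ T : Set M, T.Finite → ∃ F : C2 → M, MDifferentiable 𝓘(ℂ, C2) 𝓘(ℂ, C2) F ∧
      (∀ z, F z ∈ Tᶜ) ∧ ∀ U : Set M, IsOpen U → Dense U →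
        ∃ z, F z ∈ U ∧ Function.Bijective (mfderiv 𝓘(ℂ, C2) 𝓘(ℂ, C2) F z))
    (hNM : IsBimeromorphic 𝓘(ℂ, C2) 𝓘(ℂ, C2) N M) : DominableByC2 (univ : Set N) := by
  obtain ⟨Γ, hΓ, ⟨hp₁, hs₁, S', hS', hS'int, hcl', g', hg', hg'Γ, -, hg'inv⟩,
    ⟨hp₂, hs₂, S, hS, hSint, hcl, g, hg, hgΓ, hg1, hginv⟩⟩ := hNM
  have hΓc : IsClosed Γ := hΓ.isClosed
  have : CompactSpace Γ := by
    have := hp₂.isCompact_preimage isCompact_univ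
    rw [preimage_univ] at this
    exact isCompact_univ_iff.1 this
  have : CompactSpace N := by
    rw [← isCompact_univ_iff]
    have h1 := isCompact_univ.image (hp₁.continuous)
    convert h1
    refine (eq_univ_of_forall fun y => ?_).symm
    obtain ⟨p, hp, hpy⟩ := hs₁ (mem_univ y)
    exact ⟨⟨p, hp⟩, trivial, hpy⟩
  set φ : M → N := fun x => (g x).1 with hφdef
  set ψ : N → M := fun y => (g' y).2 with hψdef
  have hφ : MDifferentiableOn 𝓘(ℂ, C2) 𝓘(ℂ, C2) φ Sᶜ := fun x hx =>
    (mdifferentiableAt_fst (I := 𝓘(ℂ, C2)) (I' := 𝓘(ℂ, C2))).comp_mdifferentiableWithinAt x (hg x hx)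
  have hψ : MDifferentiableOn 𝓘(ℂ, C2) 𝓘(ℂ, C2) ψ S'ᶜ := fun x hx =>
    (mdifferentiableAt_snd (I := 𝓘(ℂ, C2)) (I' := 𝓘(ℂ, C2))).comp_mdifferentiableWithinAt x (hg' x hx)
  have hφΓ : ∀ x ∉ S, ∀ y, (y, x) ∈ Γ ↔ y = φ x := by
    intro x hx y
    constructor
    · intro h
      exact (congrArg Prod.fst (hginv _ h hx)).symm
    · rintro rfl
      have h1 := hgΓ hx
      have h2 := hg1 x hx
      have : (φ x, x) = g x := Prod.ext rfl h2.symm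
      rwa [this]
  have hψΓ : ∀ y ∉ S', ∀ x, (y, x) ∈ Γ → x = ψ y := by
    intro y hy x h
    exact (congrArg Prod.snd (hg'inv _ h hy)).symm
  have hSc : IsOpen Sᶜ := hS.isClosed.isOpen_compl
  have hS'c : IsOpen S'ᶜ := hS'.isClosed.isOpen_compl
  have hSd : Dense Sᶜ := interior_eq_empty_iff_dense_compl.1 hSint
  have hS'd : Dense S'ᶜ := interior_eq_empty_iff_dense_compl.1 hS'int
  -- fibres over `S` are nowhere dense
  have hprop : ∀ x ∈ S, ∀ y, ∃ᶠ y' in 𝓝 y, (y', x) ∉ Γ := by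
    intro x hx y
    rw [frequently_iff]
    intro A hA
    obtain ⟨B, hBA, hB, hyB⟩ := mem_nhds_iff.1 hA
    obtain ⟨y₁, hy₁B, hy₁S⟩ := hS'd.inter_open_nonempty B hB ⟨y, hyB⟩
    obtain ⟨p, hp, hpy⟩ := hs₁ (mem_univ y₁)
    have h1 : ∀ᶠ q : N × M in 𝓝 p, q.1 ∈ B ∧ q.1 ∈ S'ᶜ :=
      continuousAt_fst.eventually_mem ((hB.inter hS'c).mem_nhds (by rw [hpy]; exact ⟨hy₁B, hy₁S⟩))
    obtain ⟨q, ⟨hq1, hq2⟩, hq3, hq4⟩ :=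
      ((mem_closure_iff_frequently.1 (hcl hp)).and_eventually h1).exists
    refine ⟨q.1, hBA hq3, fun h => hq2 ?_⟩
    have h2 := hψΓ q.1 hq4 x h
    have h3 := hψΓ q.1 hq4 q.2 hq1
    change q.2 ∈ S
    rwa [h3, ← h2]
  -- the points over which `Γ` is locally a graph
  set good : M → Prop := fun x => ∃ W : Set M, IsOpen W ∧ x ∈ W ∧ ∃ ψ : M → N,
    MDifferentiableOn 𝓘(ℂ, C2) 𝓘(ℂ, C2) ψ W ∧ ∀ x ∈ W, ∀ y, (y, x) ∈ Γ ↔ y = ψ x with hgood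
  set T : Set M := {x | ¬ good x} with hT
  have hgT : ∀ x, x ∉ T ↔ good x := fun x => not_not
  have hTc : IsClosed T := by
    rw [← isOpen_compl_iff, isOpen_iff_mem_nhds]
    intro x hx
    obtain ⟨W, hW, hxW, ψ, h⟩ := (hgT x).1 hx
    filter_upwards [hW.mem_nhds hxW] with x' hx'
    exact (hgT x').2 ⟨W, hW, hx', ψ, h⟩
  have hTS : T ⊆ S := by
    intro x hx
    by_contra hxS
    exact hx ⟨Sᶜ, hSc, hxS, φ, hφ, hφΓ⟩
  -- At an accumulation point `x₀` of `T`, compactness of `N` makes the isolation of fibre points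
  -- uniform over the whole fibre. So every `x ≠ x₀` near `x₀` has an isolated fibre point and is
  -- good.
  have hTfin : T.Finite := by
    by_contra hinf
    obtain ⟨x₀, hx₀⟩ := Set.Infinite.exists_accPt_principal hinf
    have hx₀S : x₀ ∈ S := hTS (isClosed_iff_accPt.1 hTc x₀ hx₀)
    have h1 : ∀ᶠ x in 𝓝 x₀, ∀ y ∈ (univ : Set N), (y, x) ∈ Γ → x ≠ x₀ →
        ∀ᶠ y' in 𝓝[≠] y, (y', x) ∉ Γ := by
      refine isCompact_univ.eventually_forall_of_forall_eventually fun y _ => ?_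
      have hsw : Tendsto Prod.swap (𝓝 (x₀, y)) (𝓝 (y, x₀)) := continuous_swap.tendsto _
      exact hsw.eventually (eventually_isolated_fiber_manifold hΓ hSint hcl
        (fun x hx y y' h h' => ((hφΓ x hx y).1 h).trans ((hφΓ x hx y').1 h').symm)
        (hprop x₀ hx₀S y))
    rw [accPt_iff_frequently] at hx₀
    obtain ⟨x, ⟨hxne, hxT⟩, hx⟩ := (hx₀.and_eventually h1).exists
    obtain ⟨⟨y, x'⟩, hp, rfl⟩ := hs₂ (mem_univ x)
    exact hxT (exists_nhds_graph_of_isolated hΓc hS hSint hcl hφ hφΓ hp (hx y trivial hp hxne))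
  -- the extended map
  have hex : ∀ x, ∃ y, x ∉ T → ∀ y', (y', x) ∈ Γ ↔ y' = y := by
    intro x
    by_cases hx : x ∈ T
    · exact ⟨φ x, fun h => absurd hx h⟩
    · obtain ⟨W, -, hxW, ψ, -, h⟩ := (hgT x).1 hx
      exact ⟨ψ x, fun _ => h x hxW⟩
  choose Φ hΦ using hex
  have hΦd : MDifferentiableOn 𝓘(ℂ, C2) 𝓘(ℂ, C2) Φ Tᶜ := by
    intro x hx
    obtain ⟨W, hW, hxW, χ, hχ, h⟩ := (hgT x).1 hx
    have h1 : Φ =ᶠ[𝓝 x] χ := by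
      filter_upwards [hW.mem_nhds hxW, hTc.isOpen_compl.mem_nhds hx] with x' h1 h2
      exact (h x' h1 _).1 ((hΦ x' h2 _).2 rfl)
    exact (((hχ x hxW).mdifferentiableAt (hW.mem_nhds hxW)).congr_of_eventuallyEq
      h1).mdifferentiableWithinAt
  have hΦφ : ∀ x ∉ S, Φ x = φ x := fun x hx =>
    (hφΓ x hx _).1 ((hΦ x (fun h => hx (hTS h)) _).2 rfl)
  set U : Set M := Sᶜ ∩ φ ⁻¹' S'ᶜ with hU
  have hUo : IsOpen U := hφ.continuousOn.isOpen_inter_preimage hSc hS'c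
  -- `Γ` is the closure of its part off `S'`, so above any open set off `S` it contains points off
  -- both exceptional sets.
  have hUd : Dense U := by
    rw [dense_iff_inter_open]
    intro B hB hBn
    obtain ⟨x₁, hx₁B, hx₁S⟩ := hSd.inter_open_nonempty B hB hBn
    obtain ⟨p, hp, hpx⟩ := hs₂ (mem_univ x₁)
    have h1 : ∀ᶠ q : N × M in 𝓝 p, q.2 ∈ B ∧ q.2 ∈ Sᶜ :=
      continuousAt_snd.eventually_mem ((hB.inter hSc).mem_nhds (by rw [hpx]; exact ⟨hx₁B, hx₁S⟩))
    obtain ⟨q, ⟨hq1, hq2⟩, hq3, hq4⟩ :=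
      ((mem_closure_iff_frequently.1 (hcl' hp)).and_eventually h1).exists
    refine ⟨q.2, hq3, hq4, ?_⟩
    have := (hφΓ q.2 hq4 q.1).1 hq1
    rw [mem_preimage, ← this]
    exact hq2
  obtain ⟨F, hF, hFT, hFU⟩ := hdom T hTfin
  obtain ⟨z, hzU, hz⟩ := hFU U hUo hUd
  refine ⟨Φ ∘ F, isDominatingMap_comp hTc hΦd (U := U) ?_ hF hFT hzU hz, fun _ => trivial⟩
  intro x hxU hxT
  refine bijective_mfderiv_of_leftInverse (ψ := ψ)
    ((hΦd x hxT).mdifferentiableAt (hTc.isOpen_compl.mem_nhds hxT)) ?_ ?_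
  · rw [hΦφ x hxU.1]
    exact (hψ _ hxU.2).mdifferentiableAt (hS'c.mem_nhds hxU.2)
  · filter_upwards [hUo.mem_nhds hxU] with x' hx'
    rw [hΦφ x' hx'.1]
    exact (hψΓ _ hx'.2 _ ((hφΓ x' hx'.1 _).2 rfl)).symm

end Bimeromorphic

/-! ### Fatou–Bieberbach domains -/

section FatouBieberbach

open Metric Filter

variable {E : Type*} [NormedAddCommGroup E] [NormedSpace ℂ E]

/-- A higher-order Schwarz lemma: a bounded map with vanishing 1-jet is quadratically small. -/
theorem exists_norm_le_sq {R : E → E} (hR : Differentiable ℂ R) (h0 : R 0 = 0)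
    (h1 : HasFDerivAt R (0 : E →L[ℂ] E) 0) :
    ∃ C > 0, ∃ r > 0, ∀ v ∈ ball (0 : E) r, ‖R v‖ ≤ C * ‖v‖ ^ 2 := by
  obtain ⟨r, hr, hb⟩ : ∃ r > 0, MapsTo R (ball 0 r) (closedBall (R 0) 1) := by
    obtain ⟨r, hr, h⟩ := Metric.continuousAt_iff.1 hR.continuous.continuousAt 1 one_pos
    exact ⟨r, hr, fun v hv => (h hv).le⟩
  have ho : (R · - R 0) =o[𝓝 0] (fun w : E => ‖w - 0‖ ^ 1) := by
    have := h1.isLittleO.norm_right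
    simpa using this
  refine ⟨1 / r ^ 2, by positivity, r, hr, fun v hv => ?_⟩
  have := Complex.dist_le_mul_div_pow_of_mapsTo_ball_of_isLittleO hR.differentiableOn hb ho hv
  rw [h0, dist_zero_right, dist_zero_right] at this
  refine this.trans_eq ?_
  ring

/-- Linearization of a map with derivative `1 / 2` at a fixed point. -/
theorem exists_linearization [CompleteSpace E] {K : E → E} (hK : Differentiable ℂ K) (h0 : K 0 = 0)
    (h1 : HasFDerivAt K ((2⁻¹ : ℂ) • ContinuousLinearMap.id ℂ E) 0) :
    ∃ r > 0, ∃ Φ : E → E, DifferentiableOn ℂ Φ (ball 0 r) ∧ Φ 0 = 0 ∧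
      HasFDerivAt Φ (ContinuousLinearMap.id ℂ E) 0 ∧
      ∀ v ∈ ball (0 : E) r, Φ (K v) = (2⁻¹ : ℂ) • Φ v := by
  set R : E → E := fun v => K v - (2⁻¹ : ℂ) • v with hRdef
  have hR : Differentiable ℂ R := hK.sub (by fun_prop)
  have hR0 : R 0 = 0 := by simp [hRdef, h0]
  have hR1 : HasFDerivAt R (0 : E →L[ℂ] E) 0 := by
    have := h1.sub ((hasFDerivAt_id (𝕜 := ℂ) (0 : E)).const_smul (2⁻¹ : ℂ))
    rwa [sub_self] at this
  obtain ⟨C, hC, r₀, hr₀, hb⟩ := exists_norm_le_sq hR hR0 hR1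
  -- With `C * r ≤ 1 / 6` the contraction factor is `1/2 + 1/6 = 2/3`, and `2 * (2/3)² = 8/9 < 1`
  -- gives convergence of the series below.
  set r : ℝ := min r₀ (1 / (6 * C)) with hr
  have hrpos : 0 < r := by positivity
  have hrC : C * r ≤ 1 / 6 := by
    have : r ≤ 1 / (6 * C) := min_le_right _ _
    calc C * r ≤ C * (1 / (6 * C)) := by gcongr
      _ = 1 / 6 := by field_simp
  have hstep : ∀ v ∈ ball (0 : E) r, ‖K v‖ ≤ 2 / 3 * ‖v‖ := by
    intro v hv
    have h2 := hb v (ball_subset_ball (min_le_left _ _) hv)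
    rw [mem_ball_zero_iff] at hv
    have h3 : K v = R v + (2⁻¹ : ℂ) • v := by simp [hRdef]
    rw [h3]
    refine (norm_add_le _ _).trans ?_
    rw [norm_smul]
    have h4 : C * ‖v‖ ≤ 1 / 6 := le_trans (by gcongr) hrC
    have h5 : ‖R v‖ ≤ 1 / 6 * ‖v‖ := by
      refine h2.trans ?_
      rw [pow_two, ← mul_assoc]
      gcongr
    norm_num
    linarith
  have hiter : ∀ n, ∀ v ∈ ball (0 : E) r, ‖K^[n] v‖ ≤ (2 / 3) ^ n * ‖v‖ := by
    intro n
    induction n with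
    | zero => intro v _; simp
    | succ n ih =>
      intro v hv
      rw [Function.iterate_succ_apply']
      have h2 := ih v hv
      have h3 : ‖K^[n] v‖ ≤ ‖v‖ := h2.trans (mul_le_of_le_one_left (norm_nonneg _)
        (pow_le_one₀ (by norm_num) (by norm_num)))
      rw [mem_ball_zero_iff] at hv
      refine (hstep _ (by rw [mem_ball_zero_iff]; linarith)).trans ?_
      rw [pow_succ]
      nlinarith
  have hKn : ∀ n, Differentiable ℂ K^[n] := fun n => hK.iterate n
  have hKn0 : ∀ n, K^[n] 0 = 0 := fun n => Function.iterate_fixed h0 n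
  -- `f n v = 2 ^ (n + 1) K^[n + 1] v - 2 ^ n K^[n] v`, so `v + ∑ f n v` is the limit of `2 ^ n
  -- K^[n] v`.
  set f : ℕ → E → E := fun n v => (2 : ℂ) ^ (n + 1) • R (K^[n] v) with hf
  have hfd : ∀ n, Differentiable ℂ (f n) := fun n => (hR.comp (hKn n)).const_smul _
  have hfb : ∀ n, ∀ v ∈ ball (0 : E) r, ‖f n v‖ ≤ 2 * C * r ^ 2 * (8 / 9) ^ n := by
    intro n v hv
    have h2 := hiter n v hv
    rw [mem_ball_zero_iff] at hv
    have h3 : ‖K^[n] v‖ ≤ ‖v‖ := h2.trans (mul_le_of_le_one_left (norm_nonneg _)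
        (pow_le_one₀ (by norm_num) (by norm_num)))
    have h4 := hb (K^[n] v) (by
      rw [mem_ball_zero_iff]; exact (h3.trans_lt hv).trans_le (min_le_left _ _))
    have h5 : ‖K^[n] v‖ ≤ (2 / 3) ^ n * r := h2.trans (by gcongr)
    simp only [hf, norm_smul, norm_pow, Complex.norm_ofNat]
    calc (2 : ℝ) ^ (n + 1) * ‖R (K^[n] v)‖ ≤ 2 ^ (n + 1) * (C * ((2 / 3) ^ n * r) ^ 2) := by
          gcongr
          exact h4.trans (by gcongr)
      _ = 2 * C * r ^ 2 * (2 * (2 / 3) ^ 2) ^ n := by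
          rw [mul_pow, mul_pow, ← pow_mul, ← pow_mul]; ring
      _ = _ := by norm_num
  have hu : Summable fun n : ℕ => 2 * C * r ^ 2 * (8 / 9 : ℝ) ^ n :=
    (summable_geometric_of_lt_one (by norm_num) (by norm_num)).mul_left _
  have hr2 : 2 * (r / 2) = r := by ring
  have hsum : ∀ v ∈ ball (0 : E) r, Summable fun n => f n v := fun v hv =>
    Summable.of_norm_bounded hu fun n => hfb n v hv
  have hder : ∀ v ∈ ball (0 : E) (r / 2),
      HasFDerivAt (fun v => ∑' n, f n v) (∑' n, fderiv ℂ (f n) v) v := fun v hv =>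
    differentiableOn_tsum_of_summable_norm_ball hu (c := 0) (R := r / 2) (by positivity)
      (fun n => (hfd n).differentiableOn) (by rw [hr2]; exact hfb) hv
  refine ⟨r / 2, by positivity, fun v => v + ∑' n, f n v, ?_, ?_, ?_, ?_⟩
  · intro v hv
    exact (differentiableAt_id.add (hder v hv).differentiableAt).differentiableWithinAt
  · simp [hf, hKn0, hR0]
  · have h2 : ∀ n, fderiv ℂ (f n) 0 = 0 := by
      intro n
      have h3 : HasFDerivAt (fun v => R (K^[n] v)) ((0 : E →L[ℂ] E) ∘L fderiv ℂ K^[n] 0) 0 := by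
        refine HasFDerivAt.comp (0 : E) (g := R) (f := K^[n]) ?_ (hKn n 0).hasFDerivAt
        rw [hKn0]; exact hR1
      rw [ContinuousLinearMap.zero_comp] at h3
      have := (h3.const_smul ((2 : ℂ) ^ (n + 1))).fderiv
      rwa [smul_zero] at this
    have h3 : HasFDerivAt (fun v => v + ∑' n, f n v) _ 0 :=
      (hasFDerivAt_id (𝕜 := ℂ) (0 : E)).add (hder 0 (mem_ball_self (by positivity)))
    simpa [h2] using h3
  · intro v hv
    have hv' : v ∈ ball (0 : E) r := ball_subset_ball (by linarith) hv
    have hs := hsum v hv'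
    have h2 : ∑' n, f n v = f 0 v + ∑' n, f (n + 1) v := hs.tsum_eq_zero_add
    have h3 : ∑' n, f (n + 1) v = (2 : ℂ) • ∑' n, f n (K v) := by
      rw [← tsum_const_smul'']
      refine tsum_congr fun n => ?_
      simp only [hf, Function.iterate_succ_apply]
      rw [smul_smul, pow_succ' _ (n + 1)]
    have h4 : K v = R v + (2⁻¹ : ℂ) • v := by simp [hRdef]
    simp only
    rw [h2, h3, smul_add, smul_add, smul_smul]
    simp only [hf, zero_add, pow_one, Function.iterate_zero, id]
    rw [smul_smul]
    norm_num
    nth_rw 1 [h4]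
    norm_num
    abel

/-- The basin of an automorphism with derivative `1 / 2` at a fixed point is the image of an
injective holomorphic map. -/
theorem exists_injective_of_basin [CompleteSpace E] {K : E ≃ E} (hK : Differentiable ℂ K)
    (hK' : Differentiable ℂ K.symm) (h0 : K 0 = 0)
    (h1 : HasFDerivAt K ((2⁻¹ : ℂ) • ContinuousLinearMap.id ℂ E) 0) {B : Set E} (hB : IsOpen B)
    (h0B : (0 : E) ∈ B) (hKB : ∀ v, K v ∈ B → v ∈ B) :
    ∃ Ψ : E → E, Differentiable ℂ Ψ ∧ Function.Injective Ψ ∧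
      HasFDerivAt Ψ (ContinuousLinearMap.id ℂ E) 0 ∧ ∀ v, Ψ v ∈ B := by
  obtain ⟨r, hr, Φ, hΦ, hΦ0, hΦ1, hΦK⟩ := exists_linearization hK h0 h1
  have hcd : ContDiffAt ℂ 1 Φ 0 :=
    (contDiffOn_one_of_differentiableOn hΦ isOpen_ball).contDiffAt (ball_mem_nhds _ hr)
  have hΦ1' : HasFDerivAt Φ ((ContinuousLinearEquiv.refl ℂ E : E ≃L[ℂ] E) : E →L[ℂ] E) 0 := hΦ1
  set e := hcd.toOpenPartialHomeomorph Φ hΦ1' one_ne_zero with he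
  have hecoe : ∀ v, e v = Φ v := fun v => by
    rw [he, ContDiffAt.toOpenPartialHomeomorph_coe]
  have h0s : (0 : E) ∈ e.source := hcd.mem_toOpenPartialHomeomorph_source hΦ1' one_ne_zero
  have h0t : (0 : E) ∈ e.target := by
    have := e.map_source h0s
    rwa [hecoe, hΦ0] at this
  have hes0 : e.symm 0 = 0 := by
    have := e.left_inv h0s
    rwa [hecoe, hΦ0] at this
  have hesd : HasFDerivAt e.symm (ContinuousLinearMap.id ℂ E) 0 := by
    have := e.hasFDerivAt_symm (a := 0) (f' := ContinuousLinearEquiv.refl ℂ E) h0t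
      (by rw [hes0]; simpa only [hecoe] using hΦ1'.congr_of_eventuallyEq (Eventually.of_forall hecoe))
    exact this
  have hesev : ∀ᶠ u in 𝓝 (0 : E), DifferentiableAt ℂ e.symm u := by
    have h2 : ContDiffAt ℂ 1 e.symm (Φ 0) := hcd.to_localInverse hΦ1' one_ne_zero
    rw [hΦ0] at h2
    exact (h2.eventually (by simp)).mono fun u hu => hu.differentiableAt (by simp)
  have hc : ContinuousAt e.symm 0 := hesd.continuousAt
  obtain ⟨ρ, hρ, hρb⟩ : ∃ ρ > 0, ∀ u ∈ ball (0 : E) ρ, DifferentiableAt ℂ e.symm u ∧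
      u ∈ e.target ∧ e.symm u ∈ ball (0 : E) r ∧ e.symm u ∈ B ∧ K (e.symm u) ∈ e.source := by
    have h2 : ContinuousAt (fun u => K (e.symm u)) 0 :=
      ContinuousAt.comp hK.continuous.continuousAt hc
    exact Metric.mem_nhds_iff.1 (hesev.and ((e.open_target.eventually_mem h0t).and
      ((hc.eventually_mem (by rw [hes0]; exact ball_mem_nhds _ hr)).and
      ((hc.eventually_mem (by rw [hes0]; exact hB.mem_nhds h0B)).and
      (h2.eventually_mem (by rw [hes0, h0]; exact e.open_source.mem_nhds h0s))))))
  have hconj : ∀ u ∈ ball (0 : E) ρ, K (e.symm u) = e.symm ((2⁻¹ : ℂ) • u) := by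
    intro u hu
    obtain ⟨-, h2, h3, -, h4⟩ := hρb u hu
    have h5 : e (K (e.symm u)) = (2⁻¹ : ℂ) • u := by
      rw [hecoe, hΦK _ h3, ← hecoe, e.right_inv h2]
    rw [← h5, e.left_inv h4]
  -- The inverse linearization is globalized by shrinking `v` into its domain and undoing this with
  -- `K⁻¹`. By `hconj` the result does not depend on `k` once `k` is large.
  set H : ℕ → E → E := fun k v => K.symm^[k] (e.symm ((2⁻¹ : ℂ) ^ k • v)) with hH
  have hnorm : ∀ (k : ℕ) (v : E), ‖v‖ < ρ * 2 ^ k → (2⁻¹ : ℂ) ^ k • v ∈ ball (0 : E) ρ := by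
    intro k v hv
    rw [mem_ball_zero_iff, norm_smul, norm_pow, norm_inv, Complex.norm_ofNat, inv_pow,
      inv_mul_lt_iff₀ (by positivity)]
    linarith
  have hHs : ∀ (k : ℕ) (v : E), ‖v‖ < ρ * 2 ^ k → H (k + 1) v = H k v := by
    intro k v hv
    have h2 := hconj _ (hnorm k v hv)
    simp only [hH]
    rw [pow_succ', ← smul_smul, ← h2, Function.iterate_succ_apply, Equiv.symm_apply_apply]
  have hHa : ∀ (j k : ℕ) (v : E), ‖v‖ < ρ * 2 ^ k → H (k + j) v = H k v := by
    intro j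
    induction j with
    | zero => intro k v _; rfl
    | succ j ih =>
      intro k v hv
      rw [← add_assoc, hHs (k + j) v, ih k v hv]
      refine hv.trans_le ?_
      gcongr
      · norm_num
      · exact Nat.le_add_right k j
  have hHe : ∀ (j k : ℕ) (v : E), ‖v‖ < ρ * 2 ^ k → ‖v‖ < ρ * 2 ^ j → H j v = H k v := by
    intro j k v h2 h3
    rcases le_total j k with h | h
    · obtain ⟨i, rfl⟩ := Nat.exists_eq_add_of_le h
      exact (hHa i j v h3).symm
    · obtain ⟨i, rfl⟩ := Nat.exists_eq_add_of_le h
      exact hHa i k v h2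
  have hex : ∀ t : ℝ, ∃ k : ℕ, t < ρ * 2 ^ k := by
    intro t
    obtain ⟨k, hk⟩ := pow_unbounded_of_one_lt (t / ρ) (one_lt_two)
    exact ⟨k, by rwa [div_lt_iff₀ hρ, mul_comm] at hk⟩
  choose κ hκ using hex
  set Ψ : E → E := fun v => H (κ ‖v‖) v with hΨ
  have hΨH : ∀ (k : ℕ) (v : E), ‖v‖ < ρ * 2 ^ k → Ψ v = H k v := fun k v hv =>
    hHe _ _ v hv (hκ _)
  have hnear : ∀ (k : ℕ) (v : E), ‖v‖ < ρ * 2 ^ k → Ψ =ᶠ[𝓝 v] H k := by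
    intro k v hv
    have : ∀ᶠ w in 𝓝 v, ‖w‖ < ρ * 2 ^ k := continuous_norm.continuousAt.eventually_lt_const hv
    exact this.mono fun w hw => hΨH k w hw
  refine ⟨Ψ, ?_, ?_, ?_, ?_⟩
  · intro v
    refine DifferentiableAt.congr_of_eventuallyEq ?_ (hnear _ v (hκ ‖v‖))
    generalize hk : κ ‖v‖ = k
    have hkv := hκ ‖v‖
    rw [hk] at hkv
    have h2 : DifferentiableAt ℂ (fun w : E => (2⁻¹ : ℂ) ^ k • w) v := by fun_prop
    have h3 : DifferentiableAt ℂ (fun w : E => e.symm ((2⁻¹ : ℂ) ^ k • w)) v :=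
      DifferentiableAt.comp v (hρb _ (hnorm k v hkv)).1 h2
    exact DifferentiableAt.comp v ((hK'.iterate k) _) h3
  · intro v w hvw
    obtain ⟨k, hk⟩ : ∃ k, max ‖v‖ ‖w‖ < ρ * 2 ^ k := ⟨_, hκ _⟩
    have hv := (le_max_left _ _).trans_lt hk
    have hw := (le_max_right _ _).trans_lt hk
    rw [hΨH k v hv, hΨH k w hw] at hvw
    have h2 := (K.symm.injective.iterate k) hvw
    have h3 := e.symm.injOn (hρb _ (hnorm k v hv)).2.1 (hρb _ (hnorm k w hw)).2.1 h2
    exact smul_right_injective E (pow_ne_zero k (by norm_num : (2⁻¹ : ℂ) ≠ 0)) h3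
  · have h2 := hnear 0 0 (by simpa using hρ)
    refine HasFDerivAt.congr_of_eventuallyEq ?_ h2
    simpa [hH] using hesd
  · intro v
    have h2 : ∀ (k : ℕ) (u : E), u ∈ B → K.symm^[k] u ∈ B := by
      intro k
      induction k with
      | zero => intro u hu; exact hu
      | succ k ih =>
        intro u hu
        rw [Function.iterate_succ_apply]
        exact ih _ (hKB _ (by rwa [Equiv.apply_symm_apply]))
    exact h2 _ _ (hρb _ (hnorm _ v (hκ _))).2.2.2.1

/-- The shear `(z, w) ↦ (z e ^ (c w), w)`. -/
noncomputable def expShear (c : ℂ) : C2 ≃ C2 where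
  toFun q := (q.1 * Complex.exp (c * q.2), q.2)
  invFun q := (q.1 * Complex.exp (-(c * q.2)), q.2)
  left_inv q := by simp [mul_assoc, ← Complex.exp_add]
  right_inv q := by simp [mul_assoc, ← Complex.exp_add]

theorem differentiable_expShear (c : ℂ) : Differentiable ℂ (expShear c) := by
  change Differentiable ℂ fun q : C2 => (q.1 * Complex.exp (c * q.2), q.2)
  fun_prop

theorem differentiable_expShear_symm (c : ℂ) : Differentiable ℂ (expShear c).symm := by
  change Differentiable ℂ fun q : C2 => (q.1 * Complex.exp (-(c * q.2)), q.2)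
  fun_prop

theorem hasFDerivAt_expShear (c : ℂ) : HasFDerivAt (expShear c)
    ((ContinuousLinearMap.fst ℂ ℂ ℂ + c • ContinuousLinearMap.snd ℂ ℂ ℂ).prod
      (ContinuousLinearMap.snd ℂ ℂ ℂ)) (1, 0) := by
  have hfst : HasFDerivAt (fun q : C2 => q.1) (ContinuousLinearMap.fst ℂ ℂ ℂ) (1, 0) :=
    hasFDerivAt_fst
  have hsnd : HasFDerivAt (fun q : C2 => q.2) (ContinuousLinearMap.snd ℂ ℂ ℂ) (1, 0) :=
    hasFDerivAt_snd
  have h1 : HasFDerivAt (fun q : C2 => (q.1 * Complex.exp (c * q.2), q.2)) _ (1, 0) :=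
    (hfst.mul ((hsnd.const_mul c).cexp)).prodMk hsnd
  refine h1.congr_fderiv ?_
  ext <;> simp

/-- The affine map `(z, w) ↦ (z, a w + b (z - 1))`. -/
noncomputable def affineShear (a b : ℂ) (ha : a ≠ 0) : C2 ≃ C2 where
  toFun q := (q.1, a * q.2 + b * (q.1 - 1))
  invFun q := (q.1, a⁻¹ * (q.2 - b * (q.1 - 1)))
  left_inv q := by simp [ha]
  right_inv q := by simp [ha]

theorem differentiable_affineShear {a : ℂ} (b : ℂ) (ha : a ≠ 0) :
    Differentiable ℂ (affineShear a b ha) := by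
  change Differentiable ℂ fun q : C2 => (q.1, a * q.2 + b * (q.1 - 1))
  fun_prop

theorem differentiable_affineShear_symm {a : ℂ} (b : ℂ) (ha : a ≠ 0) :
    Differentiable ℂ (affineShear a b ha).symm := by
  change Differentiable ℂ fun q : C2 => (q.1, a⁻¹ * (q.2 - b * (q.1 - 1)))
  fun_prop

theorem hasFDerivAt_affineShear {a : ℂ} (b : ℂ) (ha : a ≠ 0) : HasFDerivAt (affineShear a b ha)
    ((ContinuousLinearMap.fst ℂ ℂ ℂ).prod
      (a • ContinuousLinearMap.snd ℂ ℂ ℂ + b • ContinuousLinearMap.fst ℂ ℂ ℂ)) (1, 0) := by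
  have hfst : HasFDerivAt (fun q : C2 => q.1) (ContinuousLinearMap.fst ℂ ℂ ℂ) (1, 0) :=
    hasFDerivAt_fst
  have hsnd : HasFDerivAt (fun q : C2 => q.2) (ContinuousLinearMap.snd ℂ ℂ ℂ) (1, 0) :=
    hasFDerivAt_snd
  have h1 : HasFDerivAt (fun q : C2 => (q.1, a * q.2 + b * (q.1 - 1))) _ (1, 0) :=
    hfst.prodMk ((hsnd.const_mul a).add ((hfst.sub_const 1).const_mul b))
  exact h1

/-- An injective holomorphic map from `ℂ²` to the complement of a complex line. -/
theorem exists_fatouBieberbach : ∃ Ψ : C2 → C2, Differentiable ℂ Ψ ∧ Function.Injective Ψ ∧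
    Function.Bijective (fderiv ℂ Ψ 0) ∧ ∀ v, (Ψ v).1 ≠ 0 := by
  have h4 : (4⁻¹ : ℂ) ≠ 0 := by norm_num
  have h2 : (1 : ℂ) ≠ 0 := one_ne_zero
  -- The constants come from a factorization of the matrix `1/2` into triangular matrices, the
  -- derivatives of these maps at `(1, 0)`. The exponential shears are used so that `z = 0` is
  -- preserved.
  set G : C2 ≃ C2 := (affineShear 4⁻¹ 4⁻¹ h4).trans ((expShear (-2)).trans
    ((affineShear 1 (-2⁻¹) h2).trans (expShear 1))) with hG
  have hGd : Differentiable ℂ G := (differentiable_expShear 1).comp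
    ((differentiable_affineShear _ h2).comp ((differentiable_expShear _).comp
      (differentiable_affineShear _ h4)))
  have hGd' : Differentiable ℂ G.symm := (differentiable_affineShear_symm _ h4).comp
    ((differentiable_expShear_symm _).comp ((differentiable_affineShear_symm _ h2).comp
      (differentiable_expShear_symm 1)))
  have he : ∀ c, expShear c (1, 0) = (1, 0) := fun c => by simp [expShear]
  have ha : ∀ {a : ℂ} (b : ℂ) (ha : a ≠ 0), affineShear a b ha (1, 0) = (1, 0) := fun b ha => by
    simp [affineShear]
  have hGp : G (1, 0) = (1, 0) := by simp [hG, he, ha]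
  have hGp' : HasFDerivAt G ((2⁻¹ : ℂ) • ContinuousLinearMap.id ℂ C2) (1, 0) := by
    have d1 := hasFDerivAt_affineShear 4⁻¹ h4
    have d2 := HasFDerivAt.comp (g := expShear (-2)) ((1, 0) : C2)
      (by rw [ha]; exact hasFDerivAt_expShear (-2)) d1
    have d3 := HasFDerivAt.comp (g := affineShear 1 (-2⁻¹) h2) ((1, 0) : C2)
      (by rw [Function.comp_apply, ha, he]; exact hasFDerivAt_affineShear (-2⁻¹) h2) d2
    have d4 := HasFDerivAt.comp (g := expShear 1) ((1, 0) : C2)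
      (by simp only [Function.comp_apply]; rw [ha, he, ha]; exact hasFDerivAt_expShear 1) d3
    refine HasFDerivAt.congr_fderiv (f := G) d4 ?_
    ext <;> simp <;> norm_num
  have hGz : ∀ q, (G q).1 ≠ 0 → q.1 ≠ 0 := by
    intro q hq h
    apply hq
    simp [hG, expShear, affineShear, h]
  set K : C2 ≃ C2 := (Equiv.addLeft ((1, 0) : C2)).trans (G.trans (Equiv.subRight ((1, 0) : C2)))
    with hK
  have hKv : ∀ v, K v = G ((1, 0) + v) - (1, 0) := fun v => rfl
  suffices h : ∃ Ψ : C2 → C2, Differentiable ℂ Ψ ∧ Function.Injective Ψ ∧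
      HasFDerivAt Ψ (ContinuousLinearMap.id ℂ C2) 0 ∧ ∀ v, Ψ v ∈ {v | ((1, 0) + v : C2).1 ≠ 0} by
    obtain ⟨Ψ, hΨ, hinj, hder, hmem⟩ := h
    refine ⟨fun v => (1, 0) + Ψ v, hΨ.const_add _, fun v w h => hinj (add_left_cancel h), ?_, hmem⟩
    rw [(hder.const_add (1, 0)).fderiv]
    exact Function.bijective_id
  refine exists_injective_of_basin (K := K) ?_ ?_ ?_ ?_ ?_ ?_ ?_
  · change Differentiable ℂ fun v => G ((1, 0) + v) - (1, 0)
    exact (hGd.comp (differentiable_id.const_add _)).sub_const _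
  · change Differentiable ℂ fun v => -(1, 0) + G.symm (v + (1, 0))
    exact (hGd'.comp (differentiable_id.add_const _)).const_add _
  · rw [hKv, add_zero, hGp, sub_self]
  · have h5 : HasFDerivAt (fun v => G ((1, 0) + v)) ((2⁻¹ : ℂ) • ContinuousLinearMap.id ℂ C2) 0 := by
      refine HasFDerivAt.comp (g := G) (f := fun v : C2 => (1, 0) + v) (0 : C2)
        (g' := (2⁻¹ : ℂ) • ContinuousLinearMap.id ℂ C2) ?_ ((hasFDerivAt_id (0 : C2)).const_add (1, 0))
      rw [add_zero]; exact hGp'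
    exact h5.sub_const _
  · exact isOpen_ne_fun (by fun_prop) continuous_const
  · simp
  · intro v hv
    have : (G ((1, 0) + v)).1 ≠ 0 := by
      have h5 : (((1, 0) : C2) + K v).1 ≠ 0 := hv
      rwa [hKv, add_sub_cancel] at h5
    exact hGz _ this

end FatouBieberbach

/-! ### Interpolation by entire functions -/

section Interpolation

open Metric Filter

/-- The Newton interpolation polynomial, multiplied by a high power of `v / w k`. This factor is 1
at `w k` and makes the term small on the disc of half the radius. -/
theorem exists_interpolation_term (w : ℕ → ℂ) (hw : Function.Injective w) (k : ℕ) (c : ℂ) :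
    ∃ T : ℂ → ℂ, Differentiable ℂ T ∧ (∀ j < k, T (w j) = 0) ∧ T (w k) = c ∧
      (1 < ‖w k‖ → ∀ v, ‖v‖ ≤ ‖w k‖ / 2 → ‖T v‖ ≤ (1 / 2) ^ k) := by
  set P : ℂ → ℂ := fun v => ∏ j ∈ Finset.range k, (v - w j) with hP
  have hPd : Differentiable ℂ P := by fun_prop
  have hPk : P (w k) ≠ 0 := Finset.prod_ne_zero_iff.2 fun j hj =>
    sub_ne_zero.2 fun h => (Finset.mem_range.1 hj).ne (hw h).symm
  have hPj : ∀ j < k, P (w j) = 0 := fun j hj =>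
    Finset.prod_eq_zero (Finset.mem_range.2 hj) (sub_self _)
  by_cases h1 : 1 < ‖w k‖
  · have hwk : w k ≠ 0 := by
      rintro h
      rw [h, norm_zero] at h1
      exact absurd h1 (by norm_num)
    obtain ⟨C, hC⟩ := (isCompact_closedBall (0 : ℂ) (‖w k‖ / 2)).exists_bound_of_continuousOn
      ((hPd.const_mul (c / P (w k))).continuous.continuousOn)
    obtain ⟨n, hn⟩ : ∃ n : ℕ, C * (1 / 2) ^ n ≤ (1 / 2) ^ k := by
      have h2 : Tendsto (fun n : ℕ => C * (1 / 2 : ℝ) ^ n) atTop (𝓝 (C * 0)) :=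
        (tendsto_pow_atTop_nhds_zero_of_lt_one (by norm_num) (by norm_num)).const_mul C
      rw [mul_zero] at h2
      exact (h2.eventually_le_const (by positivity)).exists
    refine ⟨fun v => c / P (w k) * P v * (v / w k) ^ n, by fun_prop, ?_, ?_, ?_⟩
    · intro j hj
      simp [hPj j hj]
    · simp only
      rw [div_mul_cancel₀ _ hPk, div_self hwk, one_pow, mul_one]
    · intro _ v hv
      have hCv := hC v (by simpa using hv)
      have h2 : ‖(v / w k) ^ n‖ ≤ (1 / 2) ^ n := by
        rw [norm_pow, norm_div]
        refine pow_le_pow_left₀ (by positivity) ?_ n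
        rw [div_le_iff₀ (by positivity)]
        linarith
      rw [norm_mul]
      calc _ ≤ C * (1 / 2) ^ n := mul_le_mul hCv h2 (norm_nonneg _) ((norm_nonneg _).trans hCv)
        _ ≤ _ := hn
  · refine ⟨fun v => c / P (w k) * P v, by fun_prop, ?_, ?_, fun h => absurd h h1⟩
    · intro j hj
      simp [hPj j hj]
    · simp only
      rw [div_mul_cancel₀ _ hPk]

theorem exists_entire_interpolation (w z : ℕ → ℂ) (hw : Function.Injective w)
    (hfin : ∀ R : ℝ, {k | ‖w k‖ ≤ R}.Finite) :
    ∃ h : ℂ → ℂ, Differentiable ℂ h ∧ ∀ k, h (w k) = z k := by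
  choose T hTd hT0 hTk hTb using exists_interpolation_term w hw
  -- Partial sums: each new term corrects the value at `w k` without disturbing the earlier nodes.
  let g : ℕ → ℂ → ℂ := fun k => Nat.rec (fun _ => 0) (fun k g v => g v + T k (z k - g (w k)) v) k
  have hg : ∀ k v, g (k + 1) v = g k v + T k (z k - g k (w k)) v := fun k v => rfl
  set f : ℕ → ℂ → ℂ := fun k => T k (z k - g k (w k)) with hf
  have hgf : ∀ k v, g k v = ∑ j ∈ Finset.range k, f j v := by
    intro k v
    induction k with
    | zero => simp [g]
    | succ k ih => rw [hg, Finset.sum_range_succ, ih]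
  refine ⟨fun v => ∑' k, f k v, ?_, ?_⟩
  · intro v₀
    set R : ℝ := ‖v₀‖ + 1 with hR
    have hRp : 0 ≤ R := by positivity
    have hbd : ∀ k, ∃ C, ∀ v ∈ closedBall (0 : ℂ) R, ‖f k v‖ ≤ C := fun k =>
      (isCompact_closedBall (0 : ℂ) R).exists_bound_of_continuousOn (hTd _ _).continuous.continuousOn
    choose C hC using hbd
    classical
    set u : ℕ → ℝ := fun k => if ‖w k‖ ≤ 2 * R + 1 then C k else (1 / 2) ^ k with hu
    have hus : Summable u := by
      refine Summable.congr_cofinite (f := fun k : ℕ => (1 / 2 : ℝ) ^ k)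
        (summable_geometric_of_lt_one (by norm_num) (by norm_num)) ?_
      filter_upwards [(hfin (2 * R + 1)).compl_mem_cofinite] with k hk
      exact (if_neg hk).symm
    refine (Complex.differentiableOn_tsum_of_summable_norm (U := ball 0 R) hus
      (fun k => (hTd _ _).differentiableOn) isOpen_ball ?_).differentiableAt
      (isOpen_ball.mem_nhds (by simp [hR]))
    intro k v hv
    simp only [hu]
    split_ifs with h
    · exact hC k v (ball_subset_closedBall hv)
    · push Not at h
      rw [mem_ball_zero_iff] at hv
      exact hTb k _ (by linarith) v (by linarith)
  · intro k
    have h1 : ∑' j, f j (w k) = ∑ j ∈ Finset.range (k + 1), f j (w k) := by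
      refine tsum_eq_sum fun j hj => hT0 _ _ _ ?_
      rw [Finset.mem_range] at hj
      omega
    simp only
    rw [h1, ← hgf, hg, hTk]
    ring

end Interpolation

/-! ### A function with large real part on a family of parallel lines -/

section Growth

/-- Simultaneous Dirichlet approximation by induction: a multiplier at most `n` settles the new
number, and the old ones, approximated to `ε / n`, stay within `ε`. -/
theorem exists_near_int {κ : Type*} (s : Finset κ) (t : κ → ℝ) :
    ∀ ε : ℝ, 0 < ε → ∃ N : ℕ, 0 < N ∧ ∀ j ∈ s, ∃ n : ℤ, |N * t j - n| ≤ ε := by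
  classical
  induction s using Finset.induction_on with
  | empty => intro ε _; exact ⟨1, one_pos, by simp⟩
  | insert a s ha ih =>
    intro ε hε
    obtain ⟨n, hn⟩ := exists_nat_gt (1 / ε)
    have hn0 : (0 : ℝ) < n := lt_trans (by positivity) hn
    obtain ⟨N, hN, hNs⟩ := ih (ε / n) (by positivity)
    obtain ⟨k, hk0, hkn, hk⟩ := Real.exists_nat_abs_mul_sub_round_le (N * t a)
      (Nat.cast_pos.1 hn0)
    refine ⟨k * N, Nat.mul_pos hk0 hN, fun j hj => ?_⟩
    rcases Finset.mem_insert.1 hj with rfl | hj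
    · refine ⟨round (k * (N * t j)), ?_⟩
      push_cast
      rw [mul_assoc]
      refine hk.trans ?_
      rw [div_le_iff₀ (by positivity)]
      rw [div_lt_iff₀ hε] at hn
      nlinarith
    · obtain ⟨i, hi⟩ := hNs j hj
      refine ⟨k * i, ?_⟩
      push_cast
      have : (k : ℝ) * N * t j - k * i = k * (N * t j - i) := by ring
      rw [this, abs_mul, Nat.abs_cast]
      calc (k : ℝ) * |N * t j - i| ≤ n * (ε / n) := by gcongr
        _ = ε := by field_simp

theorem half_le_cos_of_near_int {x : ℝ} {n : ℤ} (h : |x - n| ≤ 1 / 8) :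
    1 / 2 ≤ Real.cos (2 * Real.pi * x) := by
  have h1 : Real.cos (2 * Real.pi * x) = Real.cos |2 * Real.pi * (x - n)| := by
    rw [Real.cos_abs, mul_sub, ← Real.cos_sub_int_mul_two_pi (2 * Real.pi * x) n]
    congr 1
    ring
  rw [h1, ← Real.cos_pi_div_three]
  have h2 : |2 * Real.pi * (x - n)| ≤ Real.pi / 3 := by
    rw [abs_mul, abs_of_pos Real.two_pi_pos]
    have := Real.pi_pos
    nlinarith
  exact Real.cos_le_cos_of_nonneg_of_le_pi (abs_nonneg _) (by linarith [Real.pi_pos]) h2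

/-- With `z = x + iy` and `a = 2πN ≥ 4`, the real part is `y² - x² + cosh (ax) cos (ay)`, and `cosh
(ax) ≥ 4x²`. The cosine bound therefore yields the `2x²` required. -/
theorem norm_sq_le_re_cosh {N : ℕ} (hN : 0 < N) {z : ℂ}
    (hz : 1 / 2 ≤ Real.cos (2 * Real.pi * (N * z.im))) :
    ‖z‖ ^ 2 ≤ (-z ^ 2 + Complex.cosh (2 * Real.pi * N * z)).re := by
  set a : ℝ := 2 * Real.pi * N with ha
  have ha4 : 4 ≤ a := by
    have h1 : (1 : ℝ) ≤ N := by exact_mod_cast hN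
    have h2 := Real.pi_gt_three
    rw [ha]; nlinarith
  have h1 : (Complex.cosh (2 * Real.pi * N * z)).re = Real.cosh (a * z.re) * Real.cos (a * z.im) := by
    have h2 : (2 * Real.pi * N * z : ℂ) = ((a * z.re : ℝ) : ℂ) + ((a * z.im : ℝ) : ℂ) * Complex.I := by
      conv_lhs => rw [← Complex.re_add_im z]
      rw [ha]; push_cast; ring
    rw [h2, Complex.cosh_add, Complex.cosh_mul_I, Complex.sinh_mul_I, ← Complex.ofReal_cosh,
      ← Complex.ofReal_cos, ← Complex.ofReal_sinh, ← Complex.ofReal_sin]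
    simp only [Complex.add_re, Complex.mul_re, Complex.mul_im, Complex.ofReal_re, Complex.ofReal_im,
      Complex.I_re, Complex.I_im]
    ring
  have h2 : (-z ^ 2).re = z.im ^ 2 - z.re ^ 2 := by
    rw [pow_two, Complex.neg_re, Complex.mul_re]; ring
  have h3 : ‖z‖ ^ 2 = z.re ^ 2 + z.im ^ 2 := by
    rw [Complex.sq_norm, Complex.normSq_apply]; ring
  have h4 : 4 * z.re ^ 2 ≤ Real.cosh (a * z.re) := by
    rw [← Real.cosh_abs, Real.cosh_eq]
    have h5 := Real.quadratic_le_exp_of_nonneg (abs_nonneg (a * z.re))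
    have h6 := Real.exp_pos (-|a * z.re|)
    have h7 := abs_nonneg (a * z.re)
    have h8 : 16 * z.re ^ 2 ≤ |a * z.re| ^ 2 := by
      rw [sq_abs, mul_pow]
      have : 16 ≤ a ^ 2 := by nlinarith
      nlinarith [sq_nonneg z.re]
    nlinarith
  have h5 : 1 / 2 ≤ Real.cos (a * z.im) := by
    rw [ha]
    rwa [mul_assoc]
  have h6 : 4 * z.re ^ 2 * (1 / 2) ≤ Real.cosh (a * z.re) * Real.cos (a * z.im) :=
    mul_le_mul h4 h5 (by norm_num) (Real.cosh_pos _).le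
  rw [Complex.add_re, h1, h2, h3]
  linarith

end Growth

/-! ### Generic shears -/

section GenericShear

open Metric Filter MeasureTheory

/-- The bad `c` lie in a disc of radius `R e^{-|z|²}` about `-w`. It misses the unit disc when `|w|
> R + 1`; otherwise its area decays faster than any power of `‖(z, w)‖`. The factor 120 is `5!`,
from the exponential series. -/
theorem volume_inter_le {g z w : ℂ} (hg : ‖z‖ ^ 2 ≤ g.re) (R : ℕ) :
    volume.restrict (ball (0 : ℂ) 1) {c | ‖Complex.exp g * (w + c)‖ ≤ R} ≤
      ENNReal.ofReal (Real.pi * R ^ 2 * (120 * Real.exp (R + 3)) * (1 + ‖(z, w)‖)⁻¹ ^ 5) := by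
  have hsub : {c | ‖Complex.exp g * (w + c)‖ ≤ R} ⊆ closedBall (-w) (R * Real.exp (-‖z‖ ^ 2)) := by
    intro c hc
    have hc' : ‖Complex.exp g * (w + c)‖ ≤ R := hc
    rw [norm_mul, Complex.norm_exp] at hc'
    rw [mem_closedBall, dist_eq_norm, sub_neg_eq_add, add_comm c w]
    have h1 : Real.exp (‖z‖ ^ 2) * ‖w + c‖ ≤ R := le_trans (by gcongr) hc'
    rw [Real.exp_neg, ← div_eq_mul_inv, le_div_iff₀ (Real.exp_pos _)]
    linarith
  by_cases hw : ‖w‖ ≤ R + 1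
  · refine (Measure.restrict_apply_le _ _).trans ((measure_mono hsub).trans ?_)
    rw [Complex.volume_closedBall, ← ENNReal.ofReal_pow (by positivity)]
    have hpi : (NNReal.pi : ENNReal) = ENNReal.ofReal Real.pi := by
      rw [← NNReal.coe_real_pi, ENNReal.ofReal_coe_nnreal]
    rw [hpi, ← ENNReal.ofReal_mul (by positivity)]
    apply ENNReal.ofReal_le_ofReal
    set s := ‖z‖ with hs
    have hs0 : 0 ≤ s := norm_nonneg _
    have hx : 1 + ‖(z, w)‖ ≤ s + R + 2 := by
      rw [Prod.norm_def]
      have : max ‖z‖ ‖w‖ ≤ s + R + 1 := max_le (by linarith [hs, Nat.cast_nonneg (α := ℝ) R]) (by linarith)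
      linarith
    have h5 : (1 + ‖(z, w)‖) ^ 5 ≤ 120 * Real.exp (s + R + 2) := by
      have h6 := Real.pow_div_factorial_le_exp (x := s + R + 2) (by positivity) 5
      rw [div_le_iff₀ (by positivity)] at h6
      have h7 : ((Nat.factorial 5 : ℕ) : ℝ) = 120 := by norm_num [Nat.factorial]
      rw [h7] at h6
      calc (1 + ‖(z, w)‖) ^ 5 ≤ (s + R + 2) ^ 5 := by gcongr
        _ ≤ _ := by linarith
    have h8 : Real.exp (-s ^ 2) ^ 2 ≤ 120 * Real.exp (R + 3) * (1 + ‖(z, w)‖)⁻¹ ^ 5 := by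
      rw [inv_pow, ← div_eq_mul_inv, le_div_iff₀ (by positivity), ← Real.exp_nat_mul]
      calc Real.exp ((2 : ℕ) * (-s ^ 2)) * (1 + ‖(z, w)‖) ^ 5
          ≤ Real.exp ((2 : ℕ) * (-s ^ 2)) * (120 * Real.exp (s + R + 2)) := by gcongr
        _ = 120 * Real.exp ((2 : ℕ) * (-s ^ 2) + (s + R + 2)) := by
          rw [Real.exp_add ((2 : ℕ) * (-s ^ 2))]; ring
        _ ≤ 120 * Real.exp (R + 3) := by
          refine mul_le_mul_of_nonneg_left (Real.exp_le_exp.2 ?_) (by norm_num)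
          push_cast
          nlinarith [sq_nonneg (s - 1)]
    calc (R * Real.exp (-s ^ 2)) ^ 2 * Real.pi = Real.pi * R ^ 2 * Real.exp (-s ^ 2) ^ 2 := by ring
      _ ≤ Real.pi * R ^ 2 * (120 * Real.exp (R + 3) * (1 + ‖(z, w)‖)⁻¹ ^ 5) := by gcongr
      _ = _ := by ring
  · rw [Measure.restrict_apply' measurableSet_ball]
    have : {c | ‖Complex.exp g * (w + c)‖ ≤ R} ∩ ball (0 : ℂ) 1 = ∅ := by
      rw [eq_empty_iff_forall_notMem]
      rintro c ⟨hc, hc1⟩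
      have h1 := hsub hc
      rw [mem_closedBall, dist_eq_norm, sub_neg_eq_add] at h1
      rw [mem_ball_zero_iff] at hc1
      have h2 : R * Real.exp (-‖z‖ ^ 2) ≤ R :=
        mul_le_of_le_one_right (Nat.cast_nonneg _) (Real.exp_le_one_iff.2 (by nlinarith [norm_nonneg z]))
      have h3 : ‖w‖ ≤ ‖c + w‖ + ‖c‖ := by
        calc ‖w‖ = ‖(c + w) - c‖ := by rw [add_sub_cancel_left]
          _ ≤ _ := norm_sub_le _ _
      exact hw (by linarith)
    rw [this, measure_empty]
    exact zero_le

/-- Properness holds for almost every `c` by Borel–Cantelli. Each coincidence of two values is an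
affine equation in `c` with at most one solution, so countably many `c` are excluded. -/
theorem exists_generic_shear {ι : Type*} [Countable ι] (x : ι → C2) (g : ℂ → ℂ)
    (hg : ∀ i, ‖(x i).1‖ ^ 2 ≤ (g (x i).1).re)
    (hsum : Summable fun i => (1 + ‖x i‖)⁻¹ ^ 5) (hinj : Function.Injective fun i => (x i).2) :
    ∃ c : ℂ, (∀ R : ℝ, {i | ‖Complex.exp (g (x i).1) * ((x i).2 + c)‖ ≤ R}.Finite) ∧
      Function.Injective fun i => Complex.exp (g (x i).1) * ((x i).2 + c) := by
  set μ := volume.restrict (ball (0 : ℂ) 1) with hμ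
  have h1 : ∀ᵐ c ∂μ, ∀ R : ℕ, {i | ‖Complex.exp (g (x i).1) * ((x i).2 + c)‖ ≤ R}.Finite := by
    rw [ae_all_iff]
    intro R
    refine ae_finite_setOfPred_mem
      (s := fun i => {c | ‖Complex.exp (g (x i).1) * ((x i).2 + c)‖ ≤ R}) ?_
    refine ne_top_of_le_ne_top (hsum.mul_left
      (Real.pi * R ^ 2 * (120 * Real.exp (R + 3)))).tsum_ofReal_ne_top ?_
    exact ENNReal.tsum_le_tsum fun i => volume_inter_le (hg i) R
  have h2 : ∀ᵐ c ∂μ, ∀ i j, i ≠ j → Complex.exp (g (x i).1) * ((x i).2 + c) ≠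
      Complex.exp (g (x j).1) * ((x j).2 + c) := by
    rw [ae_all_iff]
    intro i
    rw [ae_all_iff]
    intro j
    by_cases hij : i = j
    · exact Eventually.of_forall fun c h => absurd hij h
    · have hs : {c | Complex.exp (g (x i).1) * ((x i).2 + c) =
          Complex.exp (g (x j).1) * ((x j).2 + c)}.Subsingleton := by
        intro c hc d hd
        have hc' : Complex.exp (g (x i).1) * ((x i).2 + c) =
          Complex.exp (g (x j).1) * ((x j).2 + c) := hc
        have hd' : Complex.exp (g (x i).1) * ((x i).2 + d) =
          Complex.exp (g (x j).1) * ((x j).2 + d) := hd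
        by_cases he : Complex.exp (g (x i).1) = Complex.exp (g (x j).1)
        · rw [he] at hc'
          exact absurd (hinj (add_right_cancel (mul_left_cancel₀ (Complex.exp_ne_zero _) hc'))) hij
        · have : (Complex.exp (g (x i).1) - Complex.exp (g (x j).1)) * (c - d) = 0 := by
            linear_combination hc' - hd'
          rcases mul_eq_zero.1 this with h | h
          · exact absurd (sub_eq_zero.1 h) he
          · exact sub_eq_zero.1 h
      have := hs.countable.ae_notMem μ
      filter_upwards [this] with c hc _ h
      exact hc h
  have : NeBot (ae μ) := by
    rw [ae_neBot, hμ, Ne, Measure.restrict_eq_zero]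
    exact (measure_ball_pos volume 0 one_pos).ne'
  obtain ⟨c, hc1, hc2⟩ := (h1.and h2).exists
  refine ⟨c, fun R => ?_, fun i j hij => ?_⟩
  · obtain ⟨n, hn⟩ := exists_nat_ge R
    exact (hc1 n).subset fun i hi => le_trans hi hn
  · by_contra h
    exact hc2 i j h hij

end GenericShear

/-! ### Tame sets -/

section Tame

open Filter Module

/-- Any form `η + d ζ`, with `η` independent of `ζ`, completes `ζ` to coordinates. Each pair of
points of `A` excludes at most one `d`. -/
theorem exists_linear_coordinates_injOn {A : Set C2} (hA : A.Countable) {ζ : C2 →L[ℂ] ℂ}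
    (hζ : ζ ≠ 0) : ∃ J : C2 ≃L[ℂ] C2, (∀ v, (J v).1 = ζ v) ∧ InjOn (fun v => (J v).2) A := by
  set a := ζ (1, 0) with ha
  set b := ζ (0, 1) with hb
  have hζv : ∀ v : C2, ζ v = v.1 * a + v.2 * b := by
    intro v
    have : v = v.1 • (1, 0) + v.2 • (0, 1) := by ext <;> simp
    conv_lhs => rw [this]
    rw [map_add, map_smul, map_smul]
    rfl
  set η : C2 →L[ℂ] ℂ := (starRingEnd ℂ a) • ContinuousLinearMap.snd ℂ ℂ ℂ -
    (starRingEnd ℂ b) • ContinuousLinearMap.fst ℂ ℂ ℂ with hη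
  have hηv : ∀ v : C2, η v = starRingEnd ℂ a * v.2 - starRingEnd ℂ b * v.1 := fun v => by
    simp [hη]
  have hker : ∀ v : C2, ζ v = 0 → η v = 0 → v = 0 := by
    intro v h1 h2
    rw [hζv] at h1
    rw [hηv] at h2
    have hD : a * starRingEnd ℂ a + b * starRingEnd ℂ b ≠ 0 := by
      intro h
      rw [Complex.mul_conj, Complex.mul_conj] at h
      have h3 : Complex.normSq a + Complex.normSq b = 0 := by exact_mod_cast h
      have h4 : a = 0 := Complex.normSq_eq_zero.1
        (by linarith [Complex.normSq_nonneg a, Complex.normSq_nonneg b])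
      have h5 : b = 0 := Complex.normSq_eq_zero.1
        (by linarith [Complex.normSq_nonneg a, Complex.normSq_nonneg b])
      apply hζ
      ext
      · simpa using h4
      · simpa using h5
    have e1 : (a * starRingEnd ℂ a + b * starRingEnd ℂ b) * v.1 = 0 := by
      linear_combination starRingEnd ℂ a * h1 - b * h2
    have e2 : (a * starRingEnd ℂ a + b * starRingEnd ℂ b) * v.2 = 0 := by
      linear_combination starRingEnd ℂ b * h1 + a * h2
    exact Prod.ext ((mul_eq_zero.1 e1).resolve_left hD) ((mul_eq_zero.1 e2).resolve_left hD)
  obtain ⟨d, hd⟩ : ∃ d : ℂ, d ∉ ⋃ x ∈ A, ⋃ y ∈ A,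
      {d : ℂ | x ≠ y ∧ η (x - y) + d * ζ (x - y) = 0} := by
    have hc : (⋃ x ∈ A, ⋃ y ∈ A, {d : ℂ | x ≠ y ∧ η (x - y) + d * ζ (x - y) = 0}).Countable := by
      refine hA.biUnion fun x _ => hA.biUnion fun y _ => Set.Subsingleton.countable ?_
      rintro d ⟨hxy, hd⟩ d' ⟨-, hd'⟩
      by_cases h0 : ζ (x - y) = 0
      · rw [h0, mul_zero, add_zero] at hd
        exact absurd (sub_eq_zero.1 (hker _ h0 hd)) hxy
      · have : (d - d') * ζ (x - y) = 0 := by linear_combination hd - hd'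
        exact sub_eq_zero.1 ((mul_eq_zero.1 this).resolve_right h0)
    exact (hc.dense_compl ℝ).nonempty
  set J₀ : C2 →L[ℂ] C2 := ζ.prod (η + d • ζ) with hJ₀
  have hJinj : Function.Injective J₀ := by
    rw [injective_iff_map_eq_zero]
    intro v hv
    have h1 : ζ v = 0 := congrArg Prod.fst hv
    have h2 : η v + d * ζ v = 0 := congrArg Prod.snd hv
    rw [h1, mul_zero, add_zero] at h2
    exact hker v h1 h2
  refine ⟨(LinearEquiv.ofInjectiveEndo (J₀ : C2 →ₗ[ℂ] C2) hJinj).toContinuousLinearEquiv,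
    fun v => rfl, fun x hx y hy hxy => ?_⟩
  by_contra hne
  apply hd
  simp only [mem_iUnion]
  refine ⟨x, hx, y, hy, hne, ?_⟩
  have hxy' : η x + d * ζ x = η y + d * ζ y := hxy
  rw [map_sub, map_sub]
  linear_combination hxy'

/-- The automorphism `(z, w) ↦ (z, e ^ g(z) (w + c))`. -/
noncomputable def multShear (g : ℂ → ℂ) (c : ℂ) : C2 ≃ C2 where
  toFun q := (q.1, Complex.exp (g q.1) * (q.2 + c))
  invFun q := (q.1, Complex.exp (-g q.1) * q.2 - c)
  left_inv q := by simp [← mul_assoc, ← Complex.exp_add]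
  right_inv q := by simp [← mul_assoc, ← Complex.exp_add]

/-- The automorphism `(z, w) ↦ (z - h(w), w)`. -/
def addShear (h : ℂ → ℂ) : C2 ≃ C2 where
  toFun q := (q.1 - h q.2, q.2)
  invFun q := (q.1 + h q.2, q.2)
  left_inv q := by simp
  right_inv q := by simp

/-- After the multiplicative shear the second coordinate enumerates `A` by a discrete sequence in
`ℂ`, so the first coordinate is an entire function of it on `A` and can be subtracted. -/
theorem exists_automorphism_of_growth {A : Set C2} (hA : A.Countable) (hAi : A.Infinite)
    (hsum : Summable fun x : A => (1 + ‖(x : C2)‖)⁻¹ ^ 5) {ζ : C2 →L[ℂ] ℂ} (hζ : ζ ≠ 0)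
    {g : ℂ → ℂ} (hgd : Differentiable ℂ g) (hg : ∀ x ∈ A, ‖ζ x‖ ^ 2 ≤ (g (ζ x)).re) :
    ∃ F : C2 ≃ C2, Differentiable ℂ F ∧ Differentiable ℂ F.symm ∧ ∀ x ∈ A, (F x).1 = 0 := by
  obtain ⟨J, hJ, hJA⟩ := exists_linear_coordinates_injOn hA hζ
  have : Countable A := hA.to_subtype
  have hsum' : Summable fun x : A => (1 + ‖J x‖)⁻¹ ^ 5 := by
    obtain ⟨M, hM, hMb⟩ : ∃ M : ℝ, 1 ≤ M ∧ ∀ x : C2, ‖x‖ ≤ M * ‖J x‖ := by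
      refine ⟨max 1 ‖(J.symm : C2 →L[ℂ] C2)‖, le_max_left _ _, fun x => ?_⟩
      have h1 := (J.symm : C2 →L[ℂ] C2).le_opNorm (J x)
      have h2 : (J.symm : C2 →L[ℂ] C2) (J x) = x := J.symm_apply_apply x
      rw [h2] at h1
      exact h1.trans (by gcongr; exact le_max_right _ _)
    refine Summable.of_nonneg_of_le (fun x => by positivity) (fun x => ?_) (hsum.mul_left (M ^ 5))
    rw [← mul_pow]
    refine pow_le_pow_left₀ (by positivity) ?_ 5
    rw [inv_le_iff_one_le_mul₀ (by positivity), mul_assoc, mul_comm, mul_assoc,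
      le_inv_mul_iff₀ (by positivity)]
    have := hMb x
    nlinarith [norm_nonneg (J x)]
  obtain ⟨c, hfin, hinj⟩ := exists_generic_shear (fun x : A => J x) g
    (fun x => by simp only [hJ]; exact hg x x.2) hsum' fun x y h => Subtype.ext (hJA x.2 y.2 h)
  have : Infinite A := hAi.to_subtype
  obtain ⟨hden⟩ := nonempty_denumerable A
  set e : ℕ ≃ A := (Denumerable.eqv A).symm with he
  obtain ⟨h, hh, hhA⟩ := exists_entire_interpolation
    (fun n => Complex.exp (g (J (e n)).1) * ((J (e n)).2 + c)) (fun n => (J (e n)).1)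
    (hinj.comp e.injective) fun R => (hfin R).preimage e.injective.injOn
  refine ⟨(J.toEquiv.trans (multShear g c)).trans (addShear h), ?_, ?_, ?_⟩
  · have h1 : Differentiable ℂ (multShear g c) := by
      change Differentiable ℂ fun q : C2 => (q.1, Complex.exp (g q.1) * (q.2 + c))
      fun_prop
    have h2 : Differentiable ℂ (addShear h) := by
      change Differentiable ℂ fun q : C2 => (q.1 - h q.2, q.2)
      fun_prop
    exact h2.comp (h1.comp J.differentiable)
  · have h1 : Differentiable ℂ (multShear g c).symm := by
      change Differentiable ℂ fun q : C2 => (q.1, Complex.exp (-g q.1) * q.2 - c)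
      fun_prop
    have h2 : Differentiable ℂ (addShear h).symm := by
      change Differentiable ℂ fun q : C2 => (q.1 + h q.2, q.2)
      fun_prop
    exact J.symm.differentiable.comp (h1.comp h2)
  · intro x hx
    have h1 := hhA (e.symm ⟨x, hx⟩)
    simp only [Equiv.apply_symm_apply] at h1
    change (J x).1 - h (Complex.exp (g (J x).1) * ((J x).2 + c)) = 0
    rw [h1, sub_self]

/-- A discrete subgroup is a lattice in its real span; a lattice basis there is extended to a real
basis of the whole space. This reduces arbitrary rank to full rank. -/
theorem exists_basis_of_discrete {E : Type*} [NormedAddCommGroup E] [NormedSpace ℝ E]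
    [FiniteDimensional ℝ E] (L : Submodule ℤ E) [DiscreteTopology L] :
    ∃ (s : Set E) (b : Basis s ℝ E), L ≤ Submodule.span ℤ (Set.range b) := by
  let E' := Submodule.span ℝ (L : Set E)
  let L' : Submodule ℤ E' := ZLattice.comap ℝ L E'.subtype
  have inst : DiscreteTopology L' :=
    ZLattice.comap_discreteTopology _ _ (by fun_prop) Subtype.val_injective
  have inst : IsZLattice ℝ L' :=
    ⟨Submodule.map_injective_of_injective E'.subtype_injective (by simp [E', L'])⟩
  let b₀ := (Free.chooseBasis ℤ L').ofZLatticeBasis ℝ L'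
  have hli : LinearIndependent ℝ (E'.subtype ∘ b₀) :=
    b₀.linearIndependent.map' _ (Submodule.ker_subtype E')
  refine ⟨_, Basis.extend hli.linearIndepOn_id, fun x hx => ?_⟩
  rw [Basis.range_extend]
  refine Submodule.span_mono (Basis.subset_extend hli.linearIndepOn_id) ?_
  have h1 : (⟨x, Submodule.subset_span hx⟩ : E') ∈ Submodule.span ℤ (Set.range b₀) := by
    rw [Basis.ofZLatticeBasis_span]
    exact hx
  rw [Set.range_comp]
  have h2 := Submodule.mem_map_of_mem (f := (E'.subtype).restrictScalars ℤ) h1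
  rw [Submodule.map_span] at h2
  exact h2

theorem repr_mem_int_of_mem_span {E ι : Type*} [AddCommGroup E] [Module ℝ E]
    (b : Basis ι ℝ E) (i : ι) {x : E} (hx : x ∈ Submodule.span ℤ (Set.range b)) :
    ∃ n : ℤ, b.repr x i = n := by
  induction hx using Submodule.span_induction with
  | mem x hx =>
    obtain ⟨j, rfl⟩ := hx
    rw [Basis.repr_self]
    by_cases h : j = i
    · exact ⟨1, by simp [h]⟩
    · exact ⟨0, by simp [Finsupp.single_eq_of_ne' h]⟩
  | zero => exact ⟨0, by simp⟩
  | add x y _ _ hx hy =>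
    obtain ⟨m, hm⟩ := hx
    obtain ⟨n, hn⟩ := hy
    exact ⟨m + n, by simp [hm, hn]⟩
  | smul a x _ hx =>
    obtain ⟨m, hm⟩ := hx
    refine ⟨a * m, ?_⟩
    rw [← Int.cast_smul_eq_zsmul ℝ, map_smul]
    simp [hm]

theorem isClosed_isDiscrete_of_finite {E : Type*} [NormedAddCommGroup E] {A : Set E}
    (hA : ∀ R : ℝ, {x ∈ A | ‖x‖ ≤ R}.Finite) : IsClosed A ∧ IsDiscrete A := by
  rw [isClosed_and_discrete_iff]
  intro x
  rw [disjoint_principal_right]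
  have h1 : ({y ∈ A | ‖y‖ ≤ ‖x‖ + 1} \ {x})ᶜ ∈ 𝓝 x :=
    ((hA (‖x‖ + 1)).subset sdiff_subset).isClosed.isOpen_compl.mem_nhds (by simp)
  have h2 : ∀ᶠ y in 𝓝 x, ‖y‖ < ‖x‖ + 1 :=
    continuous_norm.continuousAt.eventually_lt_const (lt_add_one _)
  filter_upwards [nhdsWithin_le_nhds h1, nhdsWithin_le_nhds h2, self_mem_nhdsWithin]
    with y hy1 hy2 hy3 hyA
  exact hy1 ⟨⟨hyA, hy2.le⟩, hy3⟩

theorem isTame_iUnion_translates (Λ : AddSubgroup C2) [DiscreteTopology Λ] (m : ℕ) (q : Fin m → C2) :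
    IsClosed (⋃ j, (fun v => v + q j) '' (Λ : Set C2)) ∧
    IsDiscrete (⋃ j, (fun v => v + q j) '' (Λ : Set C2)) ∧
    ∃ F : C2 ≃ C2, Differentiable ℂ F ∧ Differentiable ℂ F.symm ∧
      ∀ x ∈ ⋃ j, (fun v => v + q j) '' (Λ : Set C2), (F x).1 = 0 := by
  have hd : DiscreteTopology (AddSubgroup.toIntSubmodule Λ) := ‹DiscreteTopology Λ›
  obtain ⟨s, b, hb⟩ := exists_basis_of_discrete (AddSubgroup.toIntSubmodule Λ)
  have hsf : Finite s := Module.Finite.finite_basis b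
  set L := Submodule.span ℤ (Set.range b) with hL
  have hrank : Module.finrank ℤ L < 5 := by
    rw [ZLattice.rank ℝ L]
    have : Module.finrank ℝ C2 = 4 := by simp [C2]
    omega
  obtain ⟨i₀⟩ : Nonempty s := b.index_nonempty
  -- The extra translate by 0 keeps `A` infinite even when `m = 0`.
  set q' : Option (Fin m) → C2 := fun j => j.elim 0 q with hq'
  set x : Option (Fin m) × L → C2 := fun p => p.2 + q' p.1 with hx
  set A : Set C2 := Set.range x with hA
  have hsub : (⋃ j, (fun v => v + q j) '' (Λ : Set C2)) ⊆ A := by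
    intro v hv
    obtain ⟨j, u, hu, rfl⟩ := mem_iUnion.1 hv
    exact ⟨(some j, ⟨u, hb hu⟩), rfl⟩
  have hAc : A.Countable := countable_range x
  have hsumx : Summable fun p => (1 + ‖x p‖)⁻¹ ^ 5 := by
    rw [summable_prod_of_nonneg fun p => by positivity]
    refine ⟨fun j => ?_, .of_finite⟩
    refine Summable.of_norm_bounded_eventually
      (ZLattice.summable_norm_sub_inv_pow L 5 hrank (-q' j)) ?_
    have hfin : {u : L | (u : C2) - -q' j = 0}.Finite := by
      refine Set.Subsingleton.finite ?_
      intro u hu v hv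
      have hu' : (u : C2) - -q' j = 0 := hu
      have hv' : (v : C2) - -q' j = 0 := hv
      exact Subtype.ext (sub_left_injective (hu'.trans hv'.symm))
    filter_upwards [hfin.compl_mem_cofinite] with u hu
    have hu' : (u : C2) - -q' j ≠ 0 := hu
    rw [Real.norm_of_nonneg (by positivity)]
    have hpos : 0 < ‖(u : C2) - -q' j‖ := norm_pos_iff.2 hu'
    gcongr
    simp only [hx, sub_neg_eq_add]
    linarith
  have hsumA : Summable fun v : A => (1 + ‖(v : C2)‖)⁻¹ ^ 5 := by
    have hsec : ∀ v : A, ∃ p, x p = v := fun v => v.2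
    choose σ hσ using hsec
    have hσi : Function.Injective σ := fun v w h => Subtype.ext (by rw [← hσ v, ← hσ w, h])
    have := hsumx.comp_injective hσi
    refine this.congr fun v => ?_
    simp only [Function.comp_apply, hσ]
  have hAfin : ∀ R : ℝ, {v ∈ A | ‖v‖ ≤ R}.Finite := by
    intro R
    have h1 : ∀ᶠ v : A in cofinite, (1 + ‖(v : C2)‖)⁻¹ ^ 5 < (1 + |R|)⁻¹ ^ 5 :=
      hsumA.tendsto_cofinite_zero.eventually_lt_const (by positivity)
    rw [eventually_cofinite] at h1
    refine (h1.image Subtype.val).subset ?_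
    rintro v ⟨hv, hvR⟩
    refine ⟨⟨v, hv⟩, not_lt.2 ?_, rfl⟩
    have : ‖v‖ ≤ |R| := hvR.trans (le_abs_self R)
    gcongr
  have hAi : A.Infinite := by
    have hinj : Function.Injective fun n : ℕ => (n : ℝ) • b i₀ := fun m n h =>
      Nat.cast_injective (smul_left_injective ℝ (M := C2) (b.ne_zero i₀) h)
    refine (Set.infinite_range_of_injective hinj).mono ?_
    rintro _ ⟨n, rfl⟩
    refine ⟨(none, ⟨(n : ℤ) • b i₀, L.smul_mem n (Submodule.subset_span ⟨i₀, rfl⟩)⟩), ?_⟩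
    simp [hx, hq', Nat.cast_smul_eq_nsmul]
  -- the linear coordinate adapted to the lattice
  set ℓ : C2 →L[ℝ] ℝ := LinearMap.toContinuousLinearMap (b.coord i₀) with hℓ
  -- The complex extension of `ℓ` has real part `ℓ`; the factor `I` moves it to the imaginary part.
  set ζ : C2 →L[ℂ] ℂ := Complex.I • StrongDual.extendRCLike (𝕜 := ℂ) ℓ with hζ
  have hζim : ∀ v, (ζ v).im = b.repr v i₀ := by
    intro v
    have h1 : (ζ v).im = ((StrongDual.extendRCLike (𝕜 := ℂ) ℓ) v).re := by
      simp [hζ]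
    rw [h1]
    exact StrongDual.re_extendRCLike_apply (𝕜 := ℂ) ℓ v
  have hζ0 : ζ ≠ 0 := by
    intro h
    have := hζim (b i₀)
    rw [h] at this
    simp at this
  obtain ⟨N, hN, hNt⟩ := exists_near_int Finset.univ (fun j => b.repr (q' j) i₀) (1 / 8) (by norm_num)
  have hg : ∀ v ∈ A, ‖ζ v‖ ^ 2 ≤ (-(ζ v) ^ 2 + Complex.cosh (2 * Real.pi * N * ζ v)).re := by
    rintro _ ⟨⟨j, u⟩, rfl⟩
    refine norm_sq_le_re_cosh hN ?_
    obtain ⟨n, hn⟩ := hNt j (Finset.mem_univ j)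
    obtain ⟨k, hk⟩ := repr_mem_int_of_mem_span b i₀ u.2
    refine half_le_cos_of_near_int (n := N * k + n) ?_
    rw [hζim]
    simp only [hx, map_add, Finsupp.add_apply]
    rw [hk]
    convert hn using 2
    push_cast
    ring
  obtain ⟨F, hF, hF', hFA⟩ := exists_automorphism_of_growth hAc hAi hsumA hζ0
    (g := fun z => -z ^ 2 + Complex.cosh (2 * Real.pi * N * z)) (by fun_prop) hg
  have hcd := isClosed_isDiscrete_of_finite fun R =>
    (hAfin R).subset fun v (hv : v ∈ {x ∈ ⋃ j, (fun v => v + q j) '' (Λ : Set C2) | ‖x‖ ≤ R}) =>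
      (⟨hsub hv.1, hv.2⟩ : v ∈ {v ∈ A | ‖v‖ ≤ R})
  exact ⟨hcd.1, hcd.2, F, hF, hF', fun x hx => hFA x (hsub hx)⟩

end Tame

/-! ### Complex tori -/

section Torus

open Filter Module

theorem exists_avoiding_translates (Λ : AddSubgroup C2) [DiscreteTopology Λ] (m : ℕ)
    (q : Fin m → C2) : ∃ H : C2 → C2, Differentiable ℂ H ∧ Function.Injective H ∧
      Function.Bijective (fderiv ℂ H 0) ∧ ∀ z, H z ∉ ⋃ j, (fun v => v + q j) '' (Λ : Set C2) := by
  obtain ⟨-, -, F, hF, hF', hFA⟩ := isTame_iUnion_translates Λ m q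
  obtain ⟨Ψ, hΨ, hinj, hder, hne⟩ := exists_fatouBieberbach
  -- `F` sends the translates into the line that `Ψ` avoids, so `F.symm ∘ Ψ` avoids the translates.
  refine ⟨fun z => F.symm (Ψ z), hF'.comp hΨ, F.symm.injective.comp hinj, ?_, fun z hz => ?_⟩
  · have h1 : fderiv ℂ (F.symm ∘ Ψ) 0 = (fderiv ℂ F.symm (Ψ 0)).comp (fderiv ℂ Ψ 0) :=
      fderiv_comp 0 (hF' _) (hΨ _)
    have h2 : (fderiv ℂ F (F.symm (Ψ 0))).comp (fderiv ℂ F.symm (Ψ 0)) =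
        ContinuousLinearMap.id ℂ C2 := by
      rw [← fderiv_comp _ (hF _) (hF' _), Equiv.self_comp_symm, fderiv_id]
    have h3 : Function.Injective (fderiv ℂ F.symm (Ψ 0)) := by
      intro v w h
      have h4 := congrArg (fun A => A v) h2
      have h5 := congrArg (fun A => A w) h2
      simp only [ContinuousLinearMap.comp_apply, ContinuousLinearMap.id_apply] at h4 h5
      rw [← h4, ← h5, h]
    have h4 : Function.Surjective (fderiv ℂ F.symm (Ψ 0) : C2 →ₗ[ℂ] C2) :=
      LinearMap.injective_iff_surjective.1 h3
    change Function.Bijective (fderiv ℂ (F.symm ∘ Ψ) 0)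
    rw [h1]
    have h5 : Function.Bijective (fderiv ℂ F.symm (Ψ 0)) := ⟨h3, h4⟩
    exact h5.comp hder
  · have := hFA _ hz
    rw [Equiv.apply_symm_apply] at this
    exact hne z this

/-- The inverse function theorem and openness of invertibility, in the form needed to reach a given
dense set at a point of nonsingular differential. -/
theorem eventually_bijective_fderiv {H : C2 → C2} (hH : Differentiable ℂ H)
    (h0 : Function.Bijective (fderiv ℂ H 0)) :
    map H (𝓝 0) = 𝓝 (H 0) ∧ ∀ᶠ z in 𝓝 0, Function.Bijective (fderiv ℂ H z) := by
  have hcd : ContDiff ℂ 1 H := by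
    rw [← contDiffOn_univ]
    exact contDiffOn_one_of_differentiableOn hH.differentiableOn isOpen_univ
  set A : C2 ≃L[ℂ] C2 := ContinuousLinearEquiv.ofBijective (fderiv ℂ H 0)
    (LinearMap.ker_eq_bot.2 h0.1) (LinearMap.range_eq_top.2 h0.2) with hA
  have hAH : (A : C2 →L[ℂ] C2) = fderiv ℂ H 0 := by ext <;> rfl
  constructor
  · refine HasStrictFDerivAt.map_nhds_eq_of_equiv (f' := A) ?_
    rw [hAH]
    exact hcd.contDiffAt.hasStrictFDerivAt one_ne_zero
  · have h1 : ContinuousAt (fderiv ℂ H) 0 := (hcd.continuous_fderiv one_ne_zero).continuousAt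
    have h2 : range ((↑) : (C2 ≃L[ℂ] C2) → C2 →L[ℂ] C2) ∈ 𝓝 (fderiv ℂ H 0) := by
      rw [← hAH]
      exact ContinuousLinearEquiv.nhds A
    filter_upwards [h1.eventually_mem h2] with z hz
    obtain ⟨B, hB⟩ := hz
    rw [← hB]
    exact B.bijective

variable (Λ : AddSubgroup C2) [DiscreteTopology Λ]

theorem bijective_mfderiv_mk (x : C2) :
    MDifferentiableAt 𝓘(ℂ, C2) 𝓘(ℂ, C2) (QuotientAddGroup.mk : C2 → C2 ⧸ Λ) x ∧
      Function.Bijective (mfderiv 𝓘(ℂ, C2) 𝓘(ℂ, C2) (QuotientAddGroup.mk : C2 → C2 ⧸ Λ) x) := by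
  have : IsManifold 𝓘(ℂ, C2) 1 (C2 ⧸ Λ) := IsManifold.of_le (n := ω) le_top
  set p : C2 ⧸ Λ := QuotientAddGroup.mk x with hp
  set e := chartAt C2 p with he
  have hps : p ∈ e.source := mem_chart_source C2 p
  have hes : ∀ y, e.symm y = (QuotientAddGroup.mk y : C2 ⧸ Λ) :=
    torusChart_rightInverse Λ e (chart_mem_atlas C2 p)
  -- Near `x` the projection is a chart inverse composed with translation by this lattice vector.
  set u : C2 := e p - x with hu
  have hxu : x + u = e p := by simp [hu]
  have huΛ : u ∈ Λ := by
    have h1 : (QuotientAddGroup.mk (e p) : C2 ⧸ Λ) = QuotientAddGroup.mk x := by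
      rw [← hes, e.left_inv hps]
    have h2 := QuotientAddGroup.eq.1 h1.symm
    rwa [neg_add_eq_sub] at h2
  have hmk : ∀ y, (QuotientAddGroup.mk y : C2 ⧸ Λ) = e.symm (y + u) := by
    intro y
    rw [hes]
    exact QuotientAddGroup.eq.2 (by simpa using huΛ)
  have hd : MDifferentiableAt 𝓘(ℂ, C2) 𝓘(ℂ, C2) (QuotientAddGroup.mk : C2 → C2 ⧸ Λ) x := by
    have h1 : (QuotientAddGroup.mk : C2 → C2 ⧸ Λ) = e.symm ∘ fun y => y + u := funext hmk
    rw [h1]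
    refine MDifferentiableAt.comp (I' := 𝓘(ℂ, C2)) x (mdifferentiableAt_atlas_symm
      (chart_mem_atlas C2 p) ?_) ?_
    · rw [hxu]; exact e.map_source hps
    · exact mdifferentiableAt_iff_differentiableAt.2 (by fun_prop)
  refine ⟨hd, bijective_mfderiv_of_leftInverse (ψ := (fun y => y - u) ∘ e) hd ?_ ?_⟩
  · refine MDifferentiableAt.comp (I' := 𝓘(ℂ, C2)) _ ?_ (mdifferentiableAt_atlas
      (chart_mem_atlas C2 p) hps)
    exact mdifferentiableAt_iff_differentiableAt.2 (by fun_prop)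
  · have h1 : ∀ᶠ y in 𝓝 x, y + u ∈ e.target := by
      have : ContinuousAt (fun y => y + u) x := by fun_prop
      exact this.eventually_mem (e.open_target.mem_nhds (by rw [hxu]; exact e.map_source hps))
    filter_upwards [h1] with y hy
    rw [Function.comp_apply, hmk, e.right_inv hy, add_sub_cancel_right]

theorem exists_dominating_compl_finite (T : Set (C2 ⧸ Λ)) (hT : T.Finite) :
    ∃ F : C2 → C2 ⧸ Λ, MDifferentiable 𝓘(ℂ, C2) 𝓘(ℂ, C2) F ∧ (∀ z, F z ∈ Tᶜ) ∧
      ∀ U : Set (C2 ⧸ Λ), IsOpen U → Dense U →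
        ∃ z, F z ∈ U ∧ Function.Bijective (mfderiv 𝓘(ℂ, C2) 𝓘(ℂ, C2) F z) := by
  obtain ⟨m, t, rfl⟩ : ∃ (m : ℕ) (t : Fin m → C2 ⧸ Λ), T = range t := by
    have := hT.fintype
    exact ⟨Fintype.card T, fun j => ((Fintype.equivFin T).symm j : C2 ⧸ Λ), by
      rw [Set.range_comp' Subtype.val, Equiv.range_eq_univ, image_univ, Subtype.range_coe]⟩
  have hq : ∀ j, ∃ q : C2, (QuotientAddGroup.mk q : C2 ⧸ Λ) = t j := fun j =>
    QuotientAddGroup.mk_surjective (t j)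
  choose q hq using hq
  obtain ⟨H, hH, -, hH0, hHq⟩ := exists_avoiding_translates Λ m q
  have hπ := bijective_mfderiv_mk Λ
  have hHm : ∀ z, MDifferentiableAt 𝓘(ℂ, C2) 𝓘(ℂ, C2) H z := fun z =>
    mdifferentiableAt_iff_differentiableAt.2 (hH z)
  refine ⟨fun z => QuotientAddGroup.mk (H z), fun z => (hπ _).1.comp z (hHm z), ?_, ?_⟩
  · rintro z ⟨j, hj⟩
    refine hHq z (mem_iUnion.2 ⟨j, -q j + H z, ?_, by simp⟩)
    rw [← hq j] at hj
    exact QuotientAddGroup.eq.1 hj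
  · intro U hU hUd
    have hd : Dense ((QuotientAddGroup.mk : C2 → C2 ⧸ Λ) ⁻¹' U) :=
      hUd.preimage QuotientAddGroup.isOpenMap_coe
    obtain ⟨hmap, hbij⟩ := eventually_bijective_fderiv hH hH0
    have h1 : ∃ᶠ y in 𝓝 (H 0), y ∈ (QuotientAddGroup.mk : C2 → C2 ⧸ Λ) ⁻¹' U :=
      mem_closure_iff_frequently.1 (hd _)
    rw [← hmap, frequently_map] at h1
    obtain ⟨z, hz, hzb⟩ := (h1.and_eventually hbij).exists
    refine ⟨z, hz, ?_⟩
    have h2 := mfderiv_comp (I := 𝓘(ℂ, C2)) (I' := 𝓘(ℂ, C2)) (I'' := 𝓘(ℂ, C2)) z (hπ (H z)).1 (hHm z)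
    change Function.Bijective (mfderiv 𝓘(ℂ, C2) 𝓘(ℂ, C2)
      ((QuotientAddGroup.mk : C2 → C2 ⧸ Λ) ∘ H) z)
    rw [h2]
    refine (hπ (H z)).2.comp ?_
    rw [mfderiv_eq_fderiv]
    exact hzb

theorem compactSpace_quotient (hΛ : Submodule.span ℝ (Λ : Set C2) = ⊤) : CompactSpace (C2 ⧸ Λ) := by
  let L : Submodule ℤ C2 := AddSubgroup.toIntSubmodule Λ
  have hd : DiscreteTopology L := ‹DiscreteTopology Λ›
  have hz : IsZLattice ℝ L := ⟨hΛ⟩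
  let b := (Free.chooseBasis ℤ L).ofZLatticeBasis ℝ L
  have hspan : Submodule.span ℤ (Set.range b) = L := Basis.ofZLatticeBasis_span ℝ L _
  have hK : IsCompact (closure (ZSpan.fundamentalDomain b)) :=
    (ZSpan.fundamentalDomain_isBounded b).isCompact_closure
  rw [← isCompact_univ_iff]
  have h1 := hK.image (QuotientAddGroup.continuous_mk (N := Λ))
  convert h1
  refine (eq_univ_of_forall fun p => ?_).symm
  obtain ⟨x, rfl⟩ := QuotientAddGroup.mk_surjective p
  refine ⟨ZSpan.fract b x, subset_closure (ZSpan.fract_mem_fundamentalDomain b x), ?_⟩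
  refine QuotientAddGroup.eq.2 ?_
  have h2 : ((ZSpan.floor b x : Submodule.span ℤ (Set.range b)) : C2) ∈ Λ :=
    hspan.le (ZSpan.floor b x).2
  rw [ZSpan.fract_apply]
  simpa using h2

end Torus

/-! ### The main theorem -/

theorem proposition4p1 :
    (∀ (Λ : AddSubgroup C2), DiscreteTopology Λ → ∀ (m : ℕ) (q : Fin m → C2) (Λ₀ : Set C2),
      Λ₀ = ⋃ j, (fun v => v + q j) '' (Λ : Set C2) →
        IsTame Λ₀ ∧
        ∃ F : C2 → C2, IsDominatingMap F ∧ Function.Injective F ∧ ∀ z, F z ∈ Λ₀ᶜ) ∧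
    (∀ (Λ : AddSubgroup C2) [DiscreteTopology Λ], Submodule.span ℝ (Λ : Set C2) = ⊤ →
      (∀ T : Set (C2 ⧸ Λ), T.Finite → DominableByC2 Tᶜ) ∧
      (∀ (Y : Type*) [TopologicalSpace Y] [T2Space Y] [ConnectedSpace Y] [ChartedSpace C2 Y]
        [IsManifold 𝓘(ℂ, C2) ω Y],
        IsBimeromorphic 𝓘(ℂ, C2) 𝓘(ℂ, C2) Y (C2 ⧸ Λ) → DominableByC2 (univ : Set Y))) := by
  constructor
  · rintro Λ hΛ m q _ rfl
    obtain ⟨hcl, hd, F, hF, hF', hFA⟩ := isTame_iUnion_translates Λ m q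
    obtain ⟨H, hH, hHi, hH0, hHq⟩ := exists_avoiding_translates Λ m q
    refine ⟨⟨hcl, hd, F, hF, hF', 0, (0, 1), by simp, fun x hx => ⟨(F x).2, ?_⟩⟩,
      H, ⟨mdifferentiable_iff_differentiable.2 hH, 0, ?_⟩, hHi, hHq⟩
    · ext
      · simpa using hFA x hx
      · simp
    · rw [mfderiv_eq_fderiv]
      exact hH0
  · intro Λ _ hΛ
    refine ⟨fun T hT => ?_, ?_⟩
    · obtain ⟨F, hF, hFT, hFU⟩ := exists_dominating_compl_finite Λ T hT
      obtain ⟨z, -, hz⟩ := hFU univ isOpen_univ dense_univ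
      exact ⟨F, ⟨hF, z, hz⟩, hFT⟩
    · intro Y _ _ _ _ _ hY
      have := compactSpace_quotient Λ hΛ
      have hcl : IsClosed (Λ : Set C2) := AddSubgroup.isClosed_of_discrete
      have : T2Space (C2 ⧸ Λ) := inferInstance
      exact dominableByC2_of_isBimeromorphic (exists_dominating_compl_finite Λ) hY
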